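/- Let $G$ be a finite group. Let $\hat G$ be a set of representatives of the irreducible (finite-dimensional) unitary representations of $G$ modulo unitary equivalence, with the trivial representation $\mathbf 1$ on $\mathbb C$ in $\hat G$. For $\pi\in\hat G$ let $H_\pi$ be its Hilbert space, for $\pi,\rho,\sigma\in\hat G$ let $(\sigma,\pi\otimes\rho)=\{T\in B(H_\sigma,H_\pi\otimes H_\rho): T\sigma(g)=(\pi(g)\otimes\rho(g))T \text{ for all } g\in G\}$, with the inner product $\langle T,S\rangle 1=S^*T$, and let $\{T_{\pi,\rho}^{\sigma,a}\}_a$ be an orthonormal basis of $(\sigma,\pi\otimes\rho)$. Let $M$ be a factor of type $\mathrm{II}_1$. Write $T$ for $1_M\otimes T$ and omit tensor factors $1_\rho$ acting on the right. A cocycle twisted action $\{\alpha_\pi,U_{\pi,\rho}\}_{\pi,\rho\in\hat G}$ of $\hat G$ on $M$ consists of unital $*$-homomorphisms $\alpha_\pi:M\to M\otimes B(H_\pi)$ with $\alpha_{\mathbf 1}=\mathrm{id}_M$ and unitaries $U_{\pi,\rho}\in M\otimes B(H_\pi)\otimes B(H_\rho)$ such that 1. $U_{\pi,\mathbf 1}=U_{\mathbf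 1,\pi}=1$; 2. $(\alpha_\pi\otimes\mathrm{id}_\rho)(\alpha_\rho(x))\,U_{\pi,\rho}T=U_{\pi,\rho}T\,\alpha_\sigma(x)$ for all $x\in M$, $T\in(\sigma,\pi\otimes\rho)$; 3. with $U_{\pi,\rho}^{\sigma,a}:=U_{\pi,\rho}T_{\pi,\rho}^{\sigma,a}$, for all $\pi,\rho,\sigma\in\hat G$, $$\sum_{\eta,a,\xi,b}(\alpha_\pi\otimes\mathrm{id})(U_{\rho,\sigma}^{\eta,a})\,U_{\pi,\eta}^{\xi,b}\,T_{\pi,\eta}^{\xi,b\,*}(1_\pi\otimes T_{\rho,\sigma}^{\eta,a\,*})=\sum_{\zeta,c,\xi,d}(U_{\pi,\rho}^{\zeta,c}\otimes 1_\sigma)\,U_{\zeta,\sigma}^{\xi,d}\,T_{\zeta,\sigma}^{\xi,d\,*}(T_{\pi,\rho}^{\zeta,c\,*}\otimes 1_\sigma).$$ Theorem. Let $\{\alpha_\pi,U_{\pi,\rho}\}$ be a (not necessarily outer) cocycle twisted action of $\hat G$ on $M$. Then the 2-cocycle $U$ is a coboundary: there are unitaries $W_\pi\in M\otimes B(H_\pi)$,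 $\pi\in\hat G$, with $W_{\mathbf 1}=1$, such that $$W_\pi\,(\alpha_\pi\otimes\mathrm{id}_\rho)(W_\rho)\,U_{\pi,\rho}T=T\,W_\sigma\qquad\text{for all }\pi,\rho,\sigma\in\hat G,\ T\in(\sigma,\pi\otimes\rho),$$ and hence $U_{\pi,\rho}=(\partial_\alpha W^*)_{\pi,\rho}$ for all $\pi,\rho\in\hat G$, where $$(\partial_\alpha V)_{\pi,\rho}=\sum_{\sigma,a}(\alpha_\pi\otimes\mathrm{id}_\rho)(V_\rho)\,(V_\pi\otimes 1_\rho)\,T_{\pi,\rho}^{\sigma,a}\,V_\sigma^*\,T_{\pi,\rho}^{\sigma,a\,*}.$$ -/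

import Mathlib

open scoped ComplexOrder Kronecker Matrix

namespace GroupDual

/-! ### The dual of a finite group -/

section Dual

variable {G : Type*} [Group G]

/-- The representation on `ℂⁿ` given by a homomorphism to the unitary `n × n` matrices. -/
def toRepresentation {n : ℕ} (u : G →* Matrix.unitaryGroup (Fin n) ℂ) :
    Representation ℂ G (Fin n → ℂ) :=
  (Matrix.toLinAlgEquiv' (R := ℂ) (n := Fin n) :
      Matrix (Fin n) (Fin n) ℂ →* ((Fin n → ℂ) →ₗ[ℂ] (Fin n → ℂ))).comp
    ((Matrix.unitaryGroup (Fin n) ℂ).subtype.comp u)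

theorem toRepresentation_apply {n : ℕ} (u : G →* Matrix.unitaryGroup (Fin n) ℂ) (g : G)
    (v : Fin n → ℂ) : toRepresentation u g v = (u g : Matrix (Fin n) (Fin n) ℂ) *ᵥ v := rfl

variable (G) in
/-- An irreducible unitary representation of `G` on a finite dimensional Hilbert space, written
as unitary matrices with respect to a fixed orthonormal basis of the Hilbert space. -/
structure IrrRep where
  /-- the dimension `dπ` of the Hilbert space `H_π` -/
  dim : ℕ
  /-- the unitary matrices `π(g)` -/
  rep : G →* Matrix.unitaryGroup (Fin dim) ℂ
  /-- irreducibility (this includes that `H_π` is not zero) -/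
  irreducible : (toRepresentation rep).IsIrreducible

namespace IrrRep

/-- The matrix `π(g)`. -/
def mat (π : IrrRep G) (g : G) : Matrix (Fin π.dim) (Fin π.dim) ℂ := π.rep g

variable (G) in
/-- The trivial representation on `ℂ`. -/
def triv : IrrRep G where
  dim := 1
  rep := 1
  irreducible := by
    have key : ∀ p : Submodule ℂ (Fin 1 → ℂ), p = ⊥ ∨ p = ⊤ := by
      have : IsSimpleOrder (Submodule ℂ (Fin 1 → ℂ)) :=
        (isSimpleModule_iff ..).1 (isSimpleModule_iff_finrank_eq_one.2 (by simp))
      exact fun p => IsSimpleOrder.eq_bot_or_eq_top p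
    refine { exists_pair_ne := ⟨⊥, ⊤, fun h => ?_⟩, eq_bot_or_eq_top := fun p => ?_ }
    · have h2 := congrArg Subrepresentation.toSubmodule h
      exact bot_ne_top (α := Submodule ℂ (Fin 1 → ℂ)) h2
    · rcases key p.toSubmodule with h | h
      · left; exact Subrepresentation.toSubmodule_injective h
      · right; exact Subrepresentation.toSubmodule_injective h

/-- Unitary equivalence of representations. -/
def UnitaryEquiv (π σ : IrrRep G) : Prop :=
  ∃ V : Matrix (Fin σ.dim) (Fin π.dim) ℂ,
    Vᴴ * V = 1 ∧ V * Vᴴ = 1 ∧ ∀ g, V * π.mat g = σ.mat g * V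

/-- Linearly equivalent irreducible unitary representations are unitarily equivalent. -/
theorem unitaryEquiv_of_equiv {π σ : IrrRep G}
    (e : (toRepresentation π.rep).Equiv (toRepresentation σ.rep)) : UnitaryEquiv π σ := by
  have hirr := π.irreducible
  set T : Matrix (Fin σ.dim) (Fin π.dim) ℂ := LinearMap.toMatrix' e.toLinearEquiv.toLinearMap
    with hT
  set S : Matrix (Fin π.dim) (Fin σ.dim) ℂ := LinearMap.toMatrix' e.toLinearEquiv.symm.toLinearMap
    with hS
  have hTv : ∀ v, T *ᵥ v = e.toLinearEquiv v := fun v => by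
    rw [hT, LinearMap.toMatrix'_mulVec]; rfl
  have hTS : T * S = 1 := by
    rw [hT, hS, ← LinearMap.toMatrix'_comp, LinearEquiv.comp_symm, LinearMap.toMatrix'_id]
  have hST : S * T = 1 := by
    rw [hT, hS, ← LinearMap.toMatrix'_comp, LinearEquiv.symm_comp, LinearMap.toMatrix'_id]
  have hint : ∀ g, T * π.mat g = σ.mat g * T := fun g => by
    apply Matrix.mulVec_injective
    funext v
    change (T * π.mat g) *ᵥ v = (σ.mat g * T) *ᵥ v
    rw [← Matrix.mulVec_mulVec, ← Matrix.mulVec_mulVec, hTv, hTv]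
    exact Representation.IntertwiningMap.isIntertwining _ _ e.toIntertwiningMap g v
  have hadj : ∀ (τ : IrrRep G) g, (τ.mat g)ᴴ = τ.mat g⁻¹ := fun τ g => by
    unfold mat
    rw [map_inv]
    rfl
  have hcomm : ∀ g, (Tᴴ * T) * π.mat g = π.mat g * (Tᴴ * T) := fun g => by
    have h1 := congrArg Matrix.conjTranspose (hint g⁻¹)
    rw [Matrix.conjTranspose_mul, Matrix.conjTranspose_mul, hadj, hadj, inv_inv] at h1
    rw [Matrix.mul_assoc, hint, ← Matrix.mul_assoc, ← h1, Matrix.mul_assoc]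
  let f : (toRepresentation π.rep).IntertwiningMap (toRepresentation π.rep) :=
    { toLinearMap := Matrix.toLin' (Tᴴ * T)
      isIntertwining' := fun g => by
        refine LinearMap.ext fun v => ?_
        change (Tᴴ * T) *ᵥ (π.mat g *ᵥ v) = π.mat g *ᵥ ((Tᴴ * T) *ᵥ v)
        rw [Matrix.mulVec_mulVec, Matrix.mulVec_mulVec, hcomm] }
  obtain ⟨c, hc⟩ := (Representation.IsIrreducible.algebraMap_intertwiningMap_bijective_of_isAlgClosed
    (ρ := toRepresentation π.rep)).2 f
  have hTT : Tᴴ * T = c • (1 : Matrix (Fin π.dim) (Fin π.dim) ℂ) := by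
    apply Matrix.mulVec_injective
    funext v
    have h2 := congrArg (fun q : (toRepresentation π.rep).IntertwiningMap
      (toRepresentation π.rep) => q v) hc
    change _ = (Tᴴ * T) *ᵥ v at h2
    change (Tᴴ * T) *ᵥ v = (c • (1 : Matrix (Fin π.dim) (Fin π.dim) ℂ)) *ᵥ v
    rw [← h2, Matrix.smul_mulVec, Matrix.one_mulVec]
    rfl
  have hdim : 0 < π.dim := by
    by_contra h0
    have h0' : π.dim = 0 := by omega
    obtain ⟨p, q, hpq⟩ := hirr.exists_pair_ne
    apply hpq
    apply Subrepresentation.toSubmodule_injective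
    have : Subsingleton (Fin π.dim → ℂ) := by
      rw [h0']; infer_instance
    exact Subsingleton.elim _ _
  have hcpos : 0 ≤ c := by
    have h3 := (Matrix.posSemidef_conjTranspose_mul_self T).diag_nonneg (i := ⟨0, hdim⟩)
    rw [hTT] at h3
    simpa using h3
  have hc0 : c ≠ 0 := by
    rintro rfl
    rw [zero_smul] at hTT
    have hT0 : T = 0 := Matrix.conjTranspose_mul_self_eq_zero.1 hTT
    rw [hT0, Matrix.mul_zero] at hST
    have := congrFun (congrFun hST ⟨0, hdim⟩) ⟨0, hdim⟩
    simp at this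
  obtain ⟨r, hr0, rfl⟩ : ∃ r : ℝ, 0 ≤ r ∧ (r : ℂ) = c :=
    ⟨c.re, (Complex.le_def.1 hcpos).1, (Complex.eq_re_of_ofReal_le hcpos).symm⟩
  have hrpos : 0 < r := lt_of_le_of_ne hr0 (by rintro rfl; simp at hc0)
  have hsq : ((Real.sqrt r : ℝ) : ℂ) * (Real.sqrt r : ℝ) = (r : ℂ) := by
    rw [← Complex.ofReal_mul, Real.mul_self_sqrt hr0]
  have hs0 : ((Real.sqrt r : ℝ) : ℂ) ≠ 0 := by
    exact_mod_cast (Real.sqrt_pos.2 hrpos).ne'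
  set s : ℂ := ((Real.sqrt r : ℝ) : ℂ) with hs
  have hstar : star s = s := Complex.conj_ofReal _
  have hV1 : (s⁻¹ • T)ᴴ * (s⁻¹ • T) = 1 := by
    rw [Matrix.conjTranspose_smul, Matrix.smul_mul, Matrix.mul_smul, hTT, star_inv₀, hstar,
      smul_smul, smul_smul, ← hsq]
    rw [show s⁻¹ * s⁻¹ * (s * s) = 1 by field_simp, one_smul]
  refine ⟨s⁻¹ • T, hV1, ?_, fun g => ?_⟩
  · have h5 : (s⁻¹ • T) * (s • S) = 1 := by
      rw [Matrix.smul_mul, Matrix.mul_smul, smul_smul, inv_mul_cancel₀ hs0, one_smul, hTS]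
    have h6 : (s⁻¹ • T)ᴴ = s • S := by
      calc (s⁻¹ • T)ᴴ = (s⁻¹ • T)ᴴ * ((s⁻¹ • T) * (s • S)) := by rw [h5, Matrix.mul_one]
        _ = s • S := by rw [← Matrix.mul_assoc, hV1, Matrix.one_mul]
    rw [h6, h5]
  · rw [Matrix.smul_mul, hint, Matrix.mul_smul]

end IrrRep

variable (G) in
/-- A choice `Ĝ` of representatives of the classes of irreducible unitary representations of `G`
modulo unitary equivalence; the trivial class is represented by the trivial representation. -/
structure UnitaryDual where
  /-- the set of representatives -/
  carrier : Set (IrrRep G)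
  triv_mem : IrrRep.triv G ∈ carrier
  existsUnique : ∀ π : IrrRep G, ∃! σ, σ ∈ carrier ∧ IrrRep.UnitaryEquiv π σ

namespace UnitaryDual

instance : CoeSort (UnitaryDual G) (Type _) := ⟨fun D => D.carrier⟩

/-- A finite group has only finitely many classes of irreducible unitary representations. -/
instance [Finite G] (D : UnitaryDual G) : Finite D := by
  classical
  have := Fintype.ofFinite G
  have hN : (Nat.card G : ℂ) ≠ 0 := by
    exact_mod_cast Nat.card_pos.ne'
  let _ : Invertible (Nat.card G : ℂ) := invertibleOfNonzero hN
  let χ : D → (G → ℂ) := fun π => (toRepresentation π.1.rep).character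
  have horth : ∀ π σ : D, (Nat.card G : ℂ)⁻¹ * ∑ g : G, χ π g * χ σ g⁻¹ =
      if π = σ then 1 else 0 := by
    intro π σ
    have := π.1.irreducible
    have := σ.1.irreducible
    rw [Representation.char_orthonormal]
    by_cases h : π = σ
    · subst h
      rw [if_pos rfl, if_pos ⟨Representation.Equiv.refl _⟩]
    · rw [if_neg h, if_neg]
      rintro ⟨e⟩
      apply h
      obtain ⟨τ, -, hτ⟩ := D.existsUnique σ.1
      have h1 := hτ π.1 ⟨π.2, IrrRep.unitaryEquiv_of_equiv e⟩
      have h2 := hτ σ.1 ⟨σ.2, 1, by simp, by simp, by simp⟩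
      exact Subtype.ext (h1.trans h2.symm)
  have hli : LinearIndependent ℂ χ := by
    rw [linearIndependent_iff']
    intro s c hc σ hσ
    have h1 : (Nat.card G : ℂ)⁻¹ * ∑ g : G, (∑ π ∈ s, c π • χ π) g * χ σ g⁻¹ = c σ := by
      have : ∀ g : G, (∑ π ∈ s, c π • χ π) g * χ σ g⁻¹ =
          ∑ π ∈ s, c π * (χ π g * χ σ g⁻¹) := by
        intro g
        simp only [Finset.sum_apply, Pi.smul_apply, smul_eq_mul, Finset.sum_mul, mul_assoc]
      simp_rw [this]
      rw [Finset.sum_comm, Finset.mul_sum]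
      have h2 : ∀ π ∈ s, (Nat.card G : ℂ)⁻¹ * ∑ g : G, c π * (χ π g * χ σ g⁻¹) =
          if π = σ then c π else 0 := by
        intro π _
        rw [← Finset.mul_sum, mul_left_comm, horth, mul_ite, mul_one, mul_zero]
      rw [Finset.sum_congr rfl h2, Finset.sum_ite_eq' s σ c, if_pos hσ]
    rw [← h1, hc]
    simp
  exact hli.finite

noncomputable instance [Finite G] (D : UnitaryDual G) : Fintype D := Fintype.ofFinite D

/-- The trivial representation as an element of `Ĝ`. -/
def one (D : UnitaryDual G) : D := ⟨IrrRep.triv G, D.triv_mem⟩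

/-- The index set of the fixed orthonormal basis of `H_π`. -/
abbrev Ix {D : UnitaryDual G} (π : D) : Type := Fin π.1.dim

end UnitaryDual

open UnitaryDual

/-- The space `(σ, π ⊗ ρ)` of intertwiners. -/
def intertwiners {D : UnitaryDual G} (σ π ρ : D) : Submodule ℂ (Matrix (Ix π × Ix ρ) (Ix σ) ℂ) where
  carrier := {T | ∀ g, T * σ.1.mat g = (π.1.mat g ⊗ₖ ρ.1.mat g) * T}
  add_mem' := fun {S T} hS hT g => by rw [Matrix.add_mul, Matrix.mul_add, hS g, hT g]
  zero_mem' := fun g => by rw [Matrix.zero_mul, Matrix.mul_zero]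
  smul_mem' := fun c T hT g => by rw [Matrix.smul_mul, Matrix.mul_smul, hT g]

/-- The multiplicity `N_{π,ρ}^σ` of `σ` in `π ⊗ ρ`. -/
noncomputable def mult {D : UnitaryDual G} (π ρ σ : D) : ℕ :=
  Module.finrank ℂ (intertwiners σ π ρ)

/-- A choice, for all `π, ρ, σ ∈ Ĝ`, of an orthonormal basis `{T_{π,ρ}^{σ,a}}` of `(σ, π ⊗ ρ)` for
the inner product `⟨T, S⟩ 1 = S* T`. -/
structure IntertwinerBasis (D : UnitaryDual G) where
  /-- the intertwiner `T_{π,ρ}^{σ,a}` -/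
  T : ∀ π ρ σ : D, Fin (mult π ρ σ) → Matrix (Ix π × Ix ρ) (Ix σ) ℂ
  mem : ∀ π ρ σ a, T π ρ σ a ∈ intertwiners σ π ρ
  orthonormal : ∀ π ρ σ a b, (T π ρ σ b)ᴴ * T π ρ σ a = if a = b then 1 else 0
  span_eq : ∀ π ρ σ, Submodule.span ℂ (Set.range (T π ρ σ)) = intertwiners σ π ρ

end Dual

/-! ### Cocycle twisted actions

The elements of `A ⊗ B(H, K)` are the matrices with entries in `A`, with respect to the fixed
orthonormal bases of `H` and `K`. -/

section Actions

variable {A : Type*} [Ring A] [StarRing A] [Algebra ℂ A] [StarModule ℂ A]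

variable (A) in
/-- A scalar matrix `T` regarded as `1 ⊗ T`. -/
def scalar {m n : Type*} (T : Matrix m n ℂ) : Matrix m n A := T.map (algebraMap ℂ A)

/-- `(α ⊗ id)(X)`, for `α : A → A ⊗ B(H)` and `X ∈ A ⊗ B(K, L)`. -/
def amplify {h k l : Type*} [Fintype h] [DecidableEq h] (α : A →⋆ₐ[ℂ] Matrix h h A)
    (X : Matrix l k A) : Matrix (h × l) (h × k) A :=
  Matrix.of fun p q => α (X p.2 q.2) p.1 q.1

/-- The canonical identification of `A ⊗ B((H ⊗ K) ⊗ L)` with `A ⊗ B(H ⊗ (K ⊗ L))`. -/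
def assoc {h k l : Type*} (X : Matrix ((h × k) × l) ((h × k) × l) A) :
    Matrix (h × k × l) (h × k × l) A :=
  Matrix.reindex (Equiv.prodAssoc h k l) (Equiv.prodAssoc h k l) X

variable {G : Type*} [Group G] [Finite G] {D : UnitaryDual G}

open UnitaryDual

/-- `{α_π, U_{π,ρ}}` is a cocycle twisted action of `Ĝ` on `A`, where `α_π : A → A ⊗ B(H_π)` are
unital `*`-homomorphisms and `U_{π,ρ} ∈ A ⊗ B(H_π) ⊗ B(H_ρ)`. -/
structure IsCocycleTwistedAction (B : IntertwinerBasis D)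
    (α : ∀ π : D, A →⋆ₐ[ℂ] Matrix (Ix π) (Ix π) A)
    (U : ∀ π ρ : D, Matrix (Ix π × Ix ρ) (Ix π × Ix ρ) A) : Prop where
  /-- `α_𝟏 = id` -/
  map_one : ∀ x i j, α D.one x i j = x
  unitary_mem : ∀ π ρ, U π ρ ∈ unitary (Matrix (Ix π × Ix ρ) (Ix π × Ix ρ) A)
  right_one : ∀ π, U π D.one = 1
  left_one : ∀ π, U D.one π = 1
  /-- `(α_π ⊗ id_ρ)(α_ρ(x)) U_{π,ρ} T = U_{π,ρ} T α_σ(x)` for `T ∈ (σ, π ⊗ ρ)` -/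
  twisted : ∀ π ρ σ, ∀ T ∈ intertwiners σ π ρ, ∀ x,
    amplify (α π) (α ρ x) * U π ρ * scalar A T = U π ρ * scalar A T * α σ x
  /-- the 2-cocycle identity, where `U_{π,ρ}^{σ,a} = U_{π,ρ} T_{π,ρ}^{σ,a}` -/
  cocycle : ∀ π ρ σ,
    ∑ η : D, ∑ a, ∑ ξ : D, ∑ b,
      amplify (α π) (U ρ σ * scalar A (B.T ρ σ η a)) * (U π η * scalar A (B.T π η ξ b)) *
        scalar A (B.T π η ξ b)ᴴ *
        scalar A ((1 : Matrix (Ix π) (Ix π) ℂ) ⊗ₖ (B.T ρ σ η a)ᴴ) =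
    assoc (∑ ζ : D, ∑ c, ∑ ξ : D, ∑ d,
      (U π ρ * scalar A (B.T π ρ ζ c)) ⊗ₖ (1 : Matrix (Ix σ) (Ix σ) A) *
        (U ζ σ * scalar A (B.T ζ σ ξ d)) *
        scalar A (B.T ζ σ ξ d)ᴴ *
        scalar A ((B.T π ρ ζ c)ᴴ ⊗ₖ (1 : Matrix (Ix σ) (Ix σ) ℂ)))

/-- The coboundary `(∂_α W)_{π,ρ} = ∑_{σ,a} (α_π ⊗ id)(W_ρ) (W_π ⊗ 1) T W_σ* T*`, where
`T = T_{π,ρ}^{σ,a}`. -/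
noncomputable def coboundary (B : IntertwinerBasis D)
    (α : ∀ π : D, A →⋆ₐ[ℂ] Matrix (Ix π) (Ix π) A)
    (W : ∀ π : D, Matrix (Ix π) (Ix π) A) (π ρ : D) :
    Matrix (Ix π × Ix ρ) (Ix π × Ix ρ) A :=
  ∑ σ : D, ∑ a, amplify (α π) (W ρ) * (W π ⊗ₖ (1 : Matrix (Ix ρ) (Ix ρ) A)) *
    scalar A (B.T π ρ σ a) * (W σ)ᴴ * scalar A (B.T π ρ σ a)ᴴ

/-- The unitaries `W_π`, with `W_𝟏 = 1`, exhibit `U` as a coboundary: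
`(W_π ⊗ 1) (α_π ⊗ id)(W_ρ) U_{π,ρ} T = T W_σ` for `T ∈ (σ, π ⊗ ρ)`. -/
structure Trivializes (α : ∀ π : D, A →⋆ₐ[ℂ] Matrix (Ix π) (Ix π) A)
    (U : ∀ π ρ : D, Matrix (Ix π × Ix ρ) (Ix π × Ix ρ) A)
    (W : ∀ π : D, Matrix (Ix π) (Ix π) A) : Prop where
  unitary_mem : ∀ π, W π ∈ unitary (Matrix (Ix π) (Ix π) A)
  one : W D.one = 1
  intertwine : ∀ π ρ σ, ∀ T ∈ intertwiners σ π ρ,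
    (W π ⊗ₖ (1 : Matrix (Ix ρ) (Ix ρ) A)) * amplify (α π) (W ρ) * U π ρ * scalar A T =
      scalar A T * W σ

end Actions

/-! ### Factors of type II₁ -/

/-- A von Neumann algebra is a factor of type II₁ if it has trivial centre, is infinite
dimensional and has a faithful tracial state (which is then unique and normal). -/
structure IsTypeIIOneFactor {H : Type*} [NormedAddCommGroup H] [InnerProductSpace ℂ H]
    [CompleteSpace H] (M : VonNeumannAlgebra H) : Prop where
  factor : ∀ x ∈ M, (∀ y ∈ M, y * x = x * y) → ∃ c : ℂ, x = c • 1
  infinite : ¬ FiniteDimensional ℂ M.toStarSubalgebra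
  trace : ∃ τ : M.toStarSubalgebra →ₗ[ℂ] ℂ, τ 1 = 1 ∧ (∀ x, 0 ≤ τ (star x * x)) ∧
    (∀ x, τ (star x * x) = 0 → x = 0) ∧ ∀ x y, τ (x * y) = τ (y * x)

end GroupDual

/-! The algebras `B(H_π)` are the blocks of the group algebra `ℂ[G]`, so families indexed by `Ĝ` are
elements of group algebras. Fourier inversion (`exists_evalHom_eq`), with the completeness of the
irreducible representations, turns `α` into one homomorphism `a : A → A[G]` and `U` into one
invertible element of `A[G][G]`. In this language the intertwiners disappear: they only encode the
comultiplication `Δ(g) = g ⊗ g` (`amp_evalHom_diagHom`), and since `∑ T T* = 1` nothing is lost. The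
axioms become `(a ⊗ id)(a(x)) U = U (id ⊗ Δ)(a(x))` and `(a ⊗ id ⊗ id)(U) (id ⊗ id ⊗ Δ)(U) = (U ⊗ 1)
(id ⊗ Δ ⊗ id)(U)` (`groupAlgebra_twisted`, `groupAlgebra_cocycle`).

Let the last leg act on `ℓ²(G)` by left convolution, and let `Φ : A → A ⊗ B(ℓ²G)` be the map so
obtained from `a`. The diagonal matrix `F = ∑ g ⊗ e_{g,g}` implements `Δ` (`convMatrix_diagHom`).
Hence `X = U F` conjugates `Φ(x)` into `(a ⊗ id)(Φ(x))`, and the cocycle identity says that `X`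
trivialises `U` after tensoring with `B(ℓ²G)`. To return to `A`, choose a row `v` with `v v* = 1`
and `v* v = Φ(p)`, and put `W = v X⁻¹ a(v*)`. Conjugation by `X` carries `Φ(p)` to `a(Φ(p))`, which
makes `W` invertible and lets it inherit the trivialising property (`trivializer_spec`); the formal
inverse is the adjoint, so all `W_π` are unitary.

Only the existence of `p` and `v` uses that `M` is a factor of type II₁ (`exists_row`). Write `1` as
a sum of `|G|` projections equivalent to one projection `p` (`HasComparison.exists_division`). With
`T = τ ⊗ Tr`, the functional `T ∘ Φ` is tracial with value `|G|` at `1`, so `T(Φ(p)) = 1 =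
T(e_{g,g})`, and projections of equal trace in the matrix algebra are equivalent
(`HasComparison.exists_equivalence`). The comparison theory is derived for `M` and for its matrix
algebras at once from the four properties in `HasComparison` and a faithful trace; these properties
come from functional calculus, the bicommutant theorem and Zorn's lemma. -/

namespace GroupDual

/-! ### Group algebras with coefficients in a ring -/

section GroupAlgebra

open MonoidAlgebra

variable (G : Type*) [Group G] (R : Type*) [Ring R]

/-- The homomorphism `R[G] → R[G][G]`, `r g ↦ r g ⊗ g`. -/
noncomputable def diagHom : MonoidAlgebra R G →+* MonoidAlgebra (MonoidAlgebra R G) G :=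
  liftNCRingHom ((singleOneRingHom).comp singleOneRingHom)
    { toFun := fun g => single g (single g 1)
      map_one' := rfl
      map_mul' := fun g h => by simp [single_mul_single] }
    (fun r g => by simp [Commute, SemiconjBy, single_mul_single])

@[simp] theorem diagHom_single (g : G) (r : R) :
    diagHom G R (single g r) = single g (single g r) := by
  change liftNC _ _ _ = _
  rw [liftNC_single]
  simp [single_mul_single]

variable [Fintype G] [DecidableEq G]

/-- The matrix of left convolution by an element of `R[G]`. -/
noncomputable def convMatrix : MonoidAlgebra R G →+* Matrix G G R where
  toFun X := Matrix.of fun g h => X.coeff (g * h⁻¹)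
  map_zero' := by ext; simp
  map_add' X Y := by ext; simp
  map_one' := by
    ext g h
    simp only [Matrix.of_apply, one_def, coeff_single, Matrix.one_apply, Finsupp.single_apply]
    congr 1
    rw [@eq_comm _ 1, mul_inv_eq_one]
  map_mul' X Y := by
    ext g h
    rw [Matrix.of_apply, Matrix.mul_apply, coeff_mul_apply_right,
      Finsupp.sum_fintype _ _ (by simp)]
    refine Fintype.sum_equiv (Equiv.mulRight h) _ _ fun k => ?_
    simp [mul_assoc]

@[simp] theorem convMatrix_apply (X : MonoidAlgebra R G) (g h : G) :
    convMatrix G R X g h = X.coeff (g * h⁻¹) := rfl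

variable {R} {S : Type*} [Ring S]

theorem convMatrix_mapRingHom (f : R →+* S) (X : MonoidAlgebra R G) :
    convMatrix G S (mapRingHom G f X) = (convMatrix G R X).map f := by
  ext g h; simp

variable (R)

/-- The diagonal matrix `∑ g ⊗ e_{g,g}`. -/
noncomputable def fundMatrix : Matrix G G (MonoidAlgebra R G) :=
  Matrix.diagonal fun g => single g 1

/-- The diagonal matrix `∑ g⁻¹ ⊗ e_{g,g}`. -/
noncomputable def fundMatrixInv : Matrix G G (MonoidAlgebra R G) :=
  Matrix.diagonal fun g => single g⁻¹ 1

theorem fundMatrix_mul_inv : fundMatrix G R * fundMatrixInv G R = 1 := by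
  rw [fundMatrix, fundMatrixInv, Matrix.diagonal_mul_diagonal]
  simp [single_mul_single, ← one_def]

theorem fundMatrixInv_mul : fundMatrixInv G R * fundMatrix G R = 1 := by
  rw [fundMatrix, fundMatrixInv, Matrix.diagonal_mul_diagonal]
  simp [single_mul_single, ← one_def]

/-- On `ℓ²(G)` the comultiplication is inner: the entry of `conv(ΔX)` at `(g, k)` carries the group
element `g k⁻¹`, which is what conjugation by `∑ g ⊗ e_{g,g}` produces. -/
theorem convMatrix_diagHom (X : MonoidAlgebra R G) :
    convMatrix G _ (diagHom G R X) * fundMatrix G R =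
      fundMatrix G R * (convMatrix G R X).map (singleOneRingHom : R →+* MonoidAlgebra R G) := by
  have h : ∀ k, (diagHom G R X).coeff k = single k (X.coeff k) := by
    intro k
    induction X using MonoidAlgebra.induction_linear with
    | zero => simp
    | add x y hx hy => simp [hx, hy]
    | single a b =>
      by_cases hk : a = k
      · subst hk; simp
      · simp [hk]
  ext1 g k
  rw [fundMatrix, Matrix.mul_diagonal, Matrix.diagonal_mul]
  simp [h, single_mul_single]

variable {R}
variable {a : R →+* MonoidAlgebra R G} {U U' : MonoidAlgebra (MonoidAlgebra R G) G}
  {p : R} {v : Matrix Unit G R} {w : Matrix G Unit R}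

/-- The `1 × 1` matrix with entry `∑ (v_g ⊗ g⁻¹) U'_{g h⁻¹} a(w_h)`. -/
noncomputable def trivializer (a : R →+* MonoidAlgebra R G)
    (U' : MonoidAlgebra (MonoidAlgebra R G) G) (v : Matrix Unit G R) (w : Matrix G Unit R) :
    Matrix Unit Unit (MonoidAlgebra R G) :=
  v.map (singleOneRingHom : R →+* MonoidAlgebra R G) * fundMatrixInv G R * convMatrix G _ U' *
    w.map a

/-- The inverse of `trivializer`. -/
noncomputable def trivializerInv (a : R →+* MonoidAlgebra R G)
    (U : MonoidAlgebra (MonoidAlgebra R G) G) (v : Matrix Unit G R) (w : Matrix G Unit R) :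
    Matrix Unit Unit (MonoidAlgebra R G) :=
  v.map a * convMatrix G _ U * fundMatrix G R *
    w.map (singleOneRingHom : R →+* MonoidAlgebra R G)

theorem fundMatrixInv_mul_convMatrix_diagHom (X : MonoidAlgebra R G) :
    fundMatrixInv G R * convMatrix G _ (diagHom G R X) =
      (convMatrix G R X).map (singleOneRingHom : R →+* MonoidAlgebra R G) * fundMatrixInv G R := by
  have h := congrArg (fun Y => fundMatrixInv G R * Y * fundMatrixInv G R) (convMatrix_diagHom G R X)
  simp only [Matrix.mul_assoc, fundMatrix_mul_inv, Matrix.mul_one] at h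
  rw [h, ← Matrix.mul_assoc, fundMatrixInv_mul, Matrix.one_mul]

/-- The inner product `a(w) a(v)` is `a(Φ(p))`. The twisting relation moves it to the left of `U'`,
conjugation by `F` turns it into `Φ(p) = w v`, and `v w v = v` removes it. -/
theorem trivializer_absorb (hU'U : U' * U = 1) (hUU' : U * U' = 1)
    (h2 : ∀ x, mapRingHom G a (a x) * U = U * diagHom G R (a x))
    (hvw : v * w = 1) (hwv : w * v = convMatrix G R (a p)) :
    v.map (singleOneRingHom : R →+* MonoidAlgebra R G) * fundMatrixInv G R *
        convMatrix G _ U' * (w.map a * v.map a) =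
      v.map (singleOneRingHom : R →+* MonoidAlgebra R G) * fundMatrixInv G R *
        convMatrix G _ U' := by
  have h3 : U' * mapRingHom G a (a p) = diagHom G R (a p) * U' := by
    calc U' * mapRingHom G a (a p) = U' * (mapRingHom G a (a p) * U) * U' := by
          rw [mul_assoc, mul_assoc, hUU', mul_one]
      _ = _ := by rw [h2, ← mul_assoc, hU'U, one_mul]
  rw [← Matrix.map_mul, hwv, ← convMatrix_mapRingHom, Matrix.mul_assoc, ← map_mul, h3, map_mul,
    ← Matrix.mul_assoc, Matrix.mul_assoc _ (fundMatrixInv G R),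
    fundMatrixInv_mul_convMatrix_diagHom, ← Matrix.mul_assoc, ← Matrix.map_mul, ← hwv,
    ← Matrix.mul_assoc, hvw, Matrix.one_mul]

theorem trivializer_mul_inv (hU'U : U' * U = 1) (hUU' : U * U' = 1)
    (h2 : ∀ x, mapRingHom G a (a x) * U = U * diagHom G R (a x))
    (hvw : v * w = 1) (hwv : w * v = convMatrix G R (a p)) :
    trivializer G a U' v w * trivializerInv G a U v w = 1 := by
  have h := trivializer_absorb G hU'U hUU' h2 hvw hwv
  rw [trivializer, trivializerInv]
  simp only [← Matrix.mul_assoc] at h ⊢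
  rw [h, Matrix.mul_assoc _ _ (convMatrix G _ U), ← map_mul, hU'U, map_one, Matrix.mul_one,
    Matrix.mul_assoc _ (fundMatrixInv G R), fundMatrixInv_mul, Matrix.mul_one, ← Matrix.map_mul,
    hvw, Matrix.map_one _ (map_zero _) (map_one _)]

/-- In this order the middle factor is `F Φ(p) F⁻¹ = conv(Δ(a p))`, which `U` conjugates into
`a(Φ(p)) = a(w) a(v)`; what remains is `a(v w) a(v w)`. -/
theorem trivializerInv_mul (hUU' : U * U' = 1)
    (h2 : ∀ x, mapRingHom G a (a x) * U = U * diagHom G R (a x))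
    (hvw : v * w = 1) (hwv : w * v = convMatrix G R (a p)) :
    trivializerInv G a U v w * trivializer G a U' v w = 1 := by
  have h : fundMatrix G R * (w.map (singleOneRingHom : R →+* MonoidAlgebra R G) *
      v.map (singleOneRingHom : R →+* MonoidAlgebra R G)) * fundMatrixInv G R =
      convMatrix G _ (diagHom G R (a p)) := by
    rw [← Matrix.map_mul, hwv, ← convMatrix_diagHom, Matrix.mul_assoc, fundMatrix_mul_inv,
      Matrix.mul_one]
  have h' : convMatrix G _ U * convMatrix G _ (diagHom G R (a p)) * convMatrix G _ U' =
      w.map a * v.map a := by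
    rw [← map_mul, ← h2, ← map_mul, mul_assoc, hUU', mul_one, convMatrix_mapRingHom, ← hwv,
      Matrix.map_mul]
  calc trivializerInv G a U v w * trivializer G a U' v w
      = v.map a * (convMatrix G _ U * (fundMatrix G R *
        (w.map (singleOneRingHom : R →+* MonoidAlgebra R G) *
          v.map (singleOneRingHom : R →+* MonoidAlgebra R G)) * fundMatrixInv G R) *
          convMatrix G _ U') * w.map a := by
        simp only [trivializer, trivializerInv, Matrix.mul_assoc]
    _ = (v * w).map a * (v * w).map a := by
        rw [h, h', Matrix.map_mul]; simp only [Matrix.mul_assoc]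
    _ = 1 := by rw [hvw, Matrix.map_one _ (map_zero _) (map_one _), Matrix.one_mul]

/-- `(W ⊗ 1) (a ⊗ id)(W) U = (id ⊗ Δ)(W)`. -/
theorem trivializer_spec (hU'U : U' * U = 1) (hUU' : U * U' = 1)
    (h2 : ∀ x, mapRingHom G a (a x) * U = U * diagHom G R (a x))
    (h3 : mapRingHom G (mapRingHom G a) U * diagHom G _ U =
      singleOneRingHom U * mapRingHom G (diagHom G R) U)
    (hvw : v * w = 1) (hwv : w * v = convMatrix G R (a p)) :
    singleOneRingHom (trivializer G a U' v w () ()) *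
        mapRingHom G a (trivializer G a U' v w () ()) * U =
      diagHom G R (trivializer G a U' v w () ()) := by
  set ι : R →+* MonoidAlgebra R G := singleOneRingHom with hι
  set ι' : MonoidAlgebra R G →+* MonoidAlgebra (MonoidAlgebra R G) G := singleOneRingHom with hι'
  have habs := congrArg (fun Y => Y.map ι') (trivializer_absorb G hU'U hUU' h2 hvw hwv)
  simp only [Matrix.map_mul] at habs
  have hW1 : (trivializer G a U' v w).map ι' = (v.map ι).map ι' * (fundMatrixInv G R).map ι' *
      (convMatrix G _ U').map ι' * (w.map a).map ι' := by
    simp only [trivializer, Matrix.map_mul, hι]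
  have hW2 : (trivializer G a U' v w).map (mapRingHom G a) = (v.map a).map ι' *
      fundMatrixInv G (MonoidAlgebra R G) *
        convMatrix G _ (mapRingHom G (mapRingHom G a) U') * (w.map a).map (mapRingHom G a) := by
    simp only [trivializer, Matrix.map_mul, convMatrix_mapRingHom, Matrix.map_map]
    congr 3
    · ext; simp [ι']
    · ext g h
      rw [fundMatrixInv, fundMatrixInv, Matrix.diagonal_map (map_zero _)]
      simp [Matrix.diagonal_apply]
  have hW3 : (trivializer G a U' v w).map (diagHom G R) = (v.map ι).map ι' *
      ((fundMatrixInv G R).map ι' * fundMatrixInv G (MonoidAlgebra R G)) *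
      convMatrix G _ (mapRingHom G (diagHom G R) U') * (w.map a).map (diagHom G R) := by
    simp only [trivializer, Matrix.map_mul, convMatrix_mapRingHom, Matrix.map_map]
    congr 3
    · ext; simp [ι', ι]
    · rw [fundMatrixInv, fundMatrixInv, Matrix.diagonal_map (map_zero _),
        Matrix.diagonal_map (map_zero _), Matrix.diagonal_mul_diagonal]
      congr 1
      ext1 g
      simp [ι', single_mul_single]
  have hw : (w.map a).map (mapRingHom G a) * (Matrix.of fun _ _ : Unit => U) =
      convMatrix G _ (singleOneRingHom U) * (w.map a).map (diagHom G R) := by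
    ext1 g i
    have hc : convMatrix G _ (singleOneRingHom U) = Matrix.diagonal fun _ => U := by
      ext1 g h
      change (single 1 U).coeff (g * h⁻¹) = _
      rw [Matrix.diagonal_apply, coeff_single, Finsupp.single_apply]
      congr 1
      rw [@eq_comm _ 1, mul_inv_eq_one]
    rw [hc, Matrix.diagonal_mul]
    simp [Matrix.mul_apply, h2]
  -- The cocycle identity multiplied by inverses on both sides: this is the form in which it meets
  -- the `U'` inside `(a ⊗ id)(W)`.
  have h4 : mapRingHom G (mapRingHom G a) U' * singleOneRingHom U =
      diagHom G _ U * mapRingHom G (diagHom G R) U' := by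
    have e1 : mapRingHom G (mapRingHom G a) U' * mapRingHom G (mapRingHom G a) U = 1 := by
      rw [← map_mul, hU'U, map_one]
    have e2 : mapRingHom G (diagHom G R) U * mapRingHom G (diagHom G R) U' = 1 := by
      rw [← map_mul, hUU', map_one]
    calc _ = mapRingHom G (mapRingHom G a) U' * (singleOneRingHom U *
          mapRingHom G (diagHom G R) U) * mapRingHom G (diagHom G R) U' := by
          rw [mul_assoc, mul_assoc, e2, mul_one]
      _ = _ := by rw [← h3, ← mul_assoc, e1, one_mul]
  have hUm : (convMatrix G _ U').map ι' * (convMatrix G _ U).map ι' = 1 := by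
    rw [← Matrix.map_mul, ← map_mul, hU'U, map_one, Matrix.map_one _ (map_zero _) (map_one _)]
  -- Between the two factors `W` the product `a(w) a(v)` is absorbed (`habs`); `hw` moves `U` past
  -- `a(a(w))`; `h4` replaces `(a ⊗ id)(U') (U ⊗ 1)` by `(id ⊗ id ⊗ Δ)(U) (id ⊗ Δ ⊗ id)(U')`;
  -- passing the second `F⁻¹` turns the first of these factors into `U`, which cancels the `U'` of
  -- the left `W`. The remainder is `(id ⊗ Δ)(W)`, where `Δ` doubles `F⁻¹` into the product of the
  -- two copies (`hW3`).
  have key : (trivializer G a U' v w).map ι' * (trivializer G a U' v w).map (mapRingHom G a) *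
      (Matrix.of fun _ _ : Unit => U) = (trivializer G a U' v w).map (diagHom G R) := by
    have e3 : convMatrix G _ (mapRingHom G (mapRingHom G a) U') *
        convMatrix G _ (singleOneRingHom U) = convMatrix G _ (diagHom G _ U) *
          convMatrix G _ (mapRingHom G (diagHom G R) U') := by rw [← map_mul, h4, map_mul]
    rw [hW1, hW2, hW3, Matrix.mul_assoc, Matrix.mul_assoc _ _ (Matrix.of _), hw]
    simp only [← Matrix.mul_assoc] at habs ⊢
    rw [habs, Matrix.mul_assoc _ _ (convMatrix G _ (singleOneRingHom U)), e3]
    simp only [← Matrix.mul_assoc]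
    rw [Matrix.mul_assoc _ _ (convMatrix G _ (diagHom G _ U)),
      fundMatrixInv_mul_convMatrix_diagHom]
    simp only [← Matrix.mul_assoc]
    rw [Matrix.mul_assoc _ _ ((convMatrix G _ U).map _), hUm, Matrix.mul_one]
  have := congrFun (congrFun key ()) ()
  simpa [Matrix.mul_apply] using this

/-- The trivializer is killed by a counit. -/
theorem trivializer_counit (hvw : v * w = 1) (ε : MonoidAlgebra R G →+* R)
    (hε : ∀ g r, ε (single g r) = r) (ha : ∀ x, ε (a x) = x)
    (hU' : mapRingHom G ε U' = 1) : ε (trivializer G a U' v w () ()) = 1 := by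
  have h : (trivializer G a U' v w).map ε = 1 := by
    rw [trivializer, Matrix.map_mul, Matrix.map_mul, Matrix.map_mul, ← convMatrix_mapRingHom, hU',
      map_one, Matrix.mul_one, fundMatrixInv, Matrix.diagonal_map (map_zero _)]
    simp only [hε, Matrix.diagonal_one, Matrix.mul_one, Matrix.map_map]
    rw [← hvw]
    congr 1
    · ext; simp [hε]
    · ext; simp [ha]
  simpa using congrFun (congrFun h ()) ()

end GroupAlgebra

/-! ### Completeness of the irreducible representations -/

section Completeness

open UnitaryDual

/-- The columns of `S` form an orthonormal basis of `P`. Compression by `S` makes an invariant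
subspace into a representation by unitary matrices of size `dim P`. -/
theorem exists_isometry_onto {m : Type*} [Fintype m] [DecidableEq m]
    (P : Submodule ℂ (m → ℂ)) :
    ∃ S : Matrix m (Fin (Module.finrank ℂ P)) ℂ, Sᴴ * S = 1 ∧
      (∀ w, S *ᵥ w ∈ P) ∧ ∀ v ∈ P, S *ᵥ (Sᴴ *ᵥ v) = v := by
  let e : EuclideanSpace ℂ m ≃ₗ[ℂ] (m → ℂ) := WithLp.linearEquiv 2 ℂ (m → ℂ)
  let P' : Submodule ℂ (EuclideanSpace ℂ m) := P.comap e.toLinearMap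
  have hd : Module.finrank ℂ P' = Module.finrank ℂ P :=
    LinearEquiv.finrank_eq (e.ofSubmodule' P)
  let b : OrthonormalBasis (Fin (Module.finrank ℂ P)) ℂ P' :=
    (stdOrthonormalBasis ℂ P').reindex (finCongr hd)
  let S : Matrix m (Fin (Module.finrank ℂ P)) ℂ := Matrix.of fun i j => (b j : EuclideanSpace ℂ m) i
  have hS : ∀ w, S *ᵥ w = e (∑ j, w j • (b j : EuclideanSpace ℂ m)) := by
    intro w
    ext i
    simp [S, e, Matrix.mulVec, dotProduct, mul_comm]
  have hSH : ∀ v j, (Sᴴ *ᵥ v) j = inner ℂ (b j : EuclideanSpace ℂ m) (e.symm v) := by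
    intro v j
    simp [S, e, Matrix.mulVec, dotProduct, PiLp.inner_apply, mul_comm]
  refine ⟨S, ?_, fun w => ?_, fun v hv => ?_⟩
  · ext i j
    have h1 := orthonormal_iff_ite.1 b.orthonormal i j
    rw [Submodule.coe_inner] at h1
    rw [Matrix.one_apply, ← h1, Matrix.mul_apply]
    simp [S, PiLp.inner_apply, mul_comm]
  · rw [hS]
    have h2 : (∑ j, w j • (b j : EuclideanSpace ℂ m)) ∈ P' :=
      Submodule.sum_mem _ fun j _ => Submodule.smul_mem _ _ (b j).2
    exact h2
  · have h3 := b.sum_repr' ⟨e.symm v, by simpa [P'] using hv⟩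
    rw [hS]
    have h4 := congrArg (fun x : P' => e (x : EuclideanSpace ℂ m)) h3
    simp only [Submodule.coe_sum, Submodule.coe_smul, Submodule.coe_inner] at h4
    simp only [hSH]
    rw [h4]
    simp

variable {G : Type*} [Group G]

theorem IrrRep.mat_one (π : IrrRep G) : π.mat 1 = 1 := by
  simp [mat]

theorem IrrRep.mat_mul (π : IrrRep G) (g h : G) : π.mat (g * h) = π.mat g * π.mat h := by
  simp [mat]

theorem IrrRep.mat_conjTranspose (π : IrrRep G) (g : G) : (π.mat g)ᴴ = π.mat g⁻¹ := by
  unfold mat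
  rw [map_inv]
  rfl

theorem IrrRep.dim_pos (π : IrrRep G) : 0 < π.dim := by
  by_contra h0
  have h0' : π.dim = 0 := by omega
  obtain ⟨p, q, hpq⟩ := π.irreducible.exists_pair_ne
  apply hpq
  apply Subrepresentation.toSubmodule_injective
  have : Subsingleton (Fin π.dim → ℂ) := by
    rw [h0']; infer_instance
  exact Subsingleton.elim _ _

/-- A minimal invariant subspace gives an irreducible representation. -/
theorem exists_irrRep_of_minimal {m : Type*} [Fintype m] [DecidableEq m] (u : G →* Matrix m m ℂ)
    (hu : ∀ g, (u g)ᴴ = u g⁻¹) (P : Submodule ℂ (m → ℂ)) (hP : P ≠ ⊥)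
    (hinv : ∀ g, ∀ v ∈ P, u g *ᵥ v ∈ P)
    (hmin : ∀ Q : Submodule ℂ (m → ℂ), Q ≤ P → (∀ g, ∀ v ∈ Q, u g *ᵥ v ∈ Q) → Q ≠ ⊥ → Q = P) :
    ∃ (τ : IrrRep G) (S : Matrix m (Fin τ.dim) ℂ), Sᴴ * S = 1 ∧ (∀ w, S *ᵥ w ∈ P) ∧
      ∀ g, S * τ.mat g = u g * S := by
  obtain ⟨S, hS1, hSP, hPS⟩ := exists_isometry_onto P
  -- `S Sᴴ` fixes `P`, which contains the range of `u g * S`; this is what makes the compression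
  -- multiplicative.
  have hint : ∀ g, S * (Sᴴ * u g * S) = u g * S := by
    intro g
    apply Matrix.mulVec_injective
    funext w
    have := hPS _ (hinv g _ (hSP w))
    simpa [Matrix.mulVec_mulVec, Matrix.mul_assoc] using this
  have hmul : ∀ g h, Sᴴ * u (g * h) * S = (Sᴴ * u g * S) * (Sᴴ * u h * S) := by
    intro g h
    rw [Matrix.mul_assoc (Sᴴ * u g), hint, map_mul]
    simp only [Matrix.mul_assoc]
  have h1 : Sᴴ * u 1 * S = 1 := by rw [map_one, Matrix.mul_one, hS1]
  have hstar : ∀ g, (Sᴴ * u g * S)ᴴ = Sᴴ * u g⁻¹ * S := by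
    intro g
    rw [Matrix.conjTranspose_mul, Matrix.conjTranspose_mul, Matrix.conjTranspose_conjTranspose, hu,
      Matrix.mul_assoc]
  let τ : G →* Matrix.unitaryGroup (Fin (Module.finrank ℂ P)) ℂ :=
    { toFun := fun g => ⟨Sᴴ * u g * S, by
        rw [Matrix.mem_unitaryGroup_iff, Matrix.star_eq_conjTranspose, hstar, ← hmul,
          mul_inv_cancel, h1]⟩
      map_one' := Subtype.ext h1
      map_mul' := fun g h => Subtype.ext (hmul g h) }
  have hτ : ∀ g, ((τ g : Matrix _ _ ℂ)) = Sᴴ * u g * S := fun g => rfl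
  have hSinj : Function.Injective fun w => S *ᵥ w := by
    intro w w' h
    have := congrArg (fun v => Sᴴ *ᵥ v) h
    simpa [Matrix.mulVec_mulVec, hS1] using this
  have hirr : (toRepresentation τ).IsIrreducible := by
    refine { exists_pair_ne := ⟨⊥, ⊤, fun h => ?_⟩, eq_bot_or_eq_top := fun Q => ?_ }
    · apply hP
      have h2 : (⊥ : Submodule ℂ (Fin (Module.finrank ℂ P) → ℂ)) = ⊤ :=
        congrArg Subrepresentation.toSubmodule h
      rw [eq_bot_iff]
      intro v hv
      have h3 : Sᴴ *ᵥ v ∈ (⊥ : Submodule ℂ (Fin (Module.finrank ℂ P) → ℂ)) := by rw [h2]; trivial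
      rw [Submodule.mem_bot] at h3 ⊢
      rw [← hPS v hv, h3, Matrix.mulVec_zero]
    · let Q' : Submodule ℂ (m → ℂ) := Q.toSubmodule.map S.mulVecLin
      by_cases hQ : Q' = ⊥
      · left
        apply Subrepresentation.toSubmodule_injective
        change Q.toSubmodule = ⊥
        rw [eq_bot_iff]
        intro w hw
        have h4 : S *ᵥ w ∈ Q' := ⟨w, hw, rfl⟩
        rw [hQ, Submodule.mem_bot] at h4
        rw [Submodule.mem_bot]
        apply hSinj
        simpa using h4
      · right
        apply Subrepresentation.toSubmodule_injective
        change Q.toSubmodule = ⊤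
        have h5 : Q' = P := by
          apply hmin _ _ _ hQ
          · rintro _ ⟨w, -, rfl⟩
            exact hSP w
          · rintro g _ ⟨w, hw, rfl⟩
            have hgw : (τ g : Matrix _ _ ℂ) *ᵥ w ∈ Q.toSubmodule := Q.apply_mem_toSubmodule g hw
            refine ⟨_, hgw, ?_⟩
            simp only [Matrix.mulVecLin_apply, hτ, Matrix.mulVec_mulVec]
            rw [hint]
        rw [eq_top_iff]
        intro w _
        have h6 : S *ᵥ w ∈ Q' := by rw [h5]; exact hSP w
        obtain ⟨w', hw', h7⟩ := h6
        rw [← hSinj h7]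
        exact hw'
  exact ⟨⟨_, τ, hirr⟩, S, hS1, hSP, fun g => hint g⟩

theorem exists_minimal_invariant {ι m : Type*} [Fintype m] (u : ι → Matrix m m ℂ)
    (N : Submodule ℂ (m → ℂ)) (hN : N ≠ ⊥) (hinv : ∀ g, ∀ v ∈ N, u g *ᵥ v ∈ N) :
    ∃ P ≤ N, P ≠ ⊥ ∧ (∀ g, ∀ v ∈ P, u g *ᵥ v ∈ P) ∧
      ∀ Q : Submodule ℂ (m → ℂ), Q ≤ P → (∀ g, ∀ v ∈ Q, u g *ᵥ v ∈ Q) → Q ≠ ⊥ → Q = P := by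
  obtain ⟨P, ⟨hP1, hP2, hP3⟩, hmin⟩ := WellFounded.has_min
    (wellFounded_lt (α := Submodule ℂ (m → ℂ)))
    {P | P ≤ N ∧ P ≠ ⊥ ∧ ∀ g, ∀ v ∈ P, u g *ᵥ v ∈ P} ⟨N, le_rfl, hN, hinv⟩
  refine ⟨P, hP1, hP2, hP3, fun Q hQP hQ hQ0 => ?_⟩
  by_contra hne
  exact hmin Q ⟨hQP.trans hP1, hQ0, hQ⟩ (lt_of_le_of_ne hQP hne)

/-- The intertwiners from the irreducible representations separate operators. -/
theorem eq_zero_of_mul_intertwiner (D : UnitaryDual G) {m l : Type*} [Fintype m] [DecidableEq m]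
    (u : G →* Matrix m m ℂ) (hu : ∀ g, (u g)ᴴ = u g⁻¹) (X : Matrix l m ℂ)
    (hX : ∀ (σ : D) (S : Matrix m (Ix σ) ℂ), (∀ g, S * σ.1.mat g = u g * S) → X * S = 0) :
    X = 0 := by
  -- `N` is the orthogonal complement of the sum of the ranges of all intertwiners. It is invariant,
  -- so if it were nonzero it would contain an irreducible subspace, equivalent to some `σ ∈ Ĝ`. The
  -- embedding of `σ` onto that subspace is itself one of the intertwiners whose adjoints vanish on
  -- `N`, which is absurd. The columns of `Xᴴ` lie in `N`.
  let N : Submodule ℂ (m → ℂ) :=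
    { carrier := {v | ∀ (σ : D) (S : Matrix m (Ix σ) ℂ), (∀ g, S * σ.1.mat g = u g * S) →
        Sᴴ *ᵥ v = 0}
      add_mem' := fun {v w} hv hw σ S hS => by rw [Matrix.mulVec_add, hv σ S hS, hw σ S hS, add_zero]
      zero_mem' := fun σ S hS => Matrix.mulVec_zero _
      smul_mem' := fun c v hv σ S hS => by rw [Matrix.mulVec_smul, hv σ S hS, smul_zero] }
  have hinv : ∀ g, ∀ v ∈ N, u g *ᵥ v ∈ N := by
    intro g v hv σ S hS
    have h1 : Sᴴ * u g = σ.1.mat g * Sᴴ := by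
      have := congrArg Matrix.conjTranspose (hS g⁻¹)
      rw [Matrix.conjTranspose_mul, Matrix.conjTranspose_mul, hu, IrrRep.mat_conjTranspose,
        inv_inv] at this
      exact this.symm
    rw [Matrix.mulVec_mulVec, h1, ← Matrix.mulVec_mulVec, hv σ S hS, Matrix.mulVec_zero]
  have hN : N = ⊥ := by
    by_contra hN
    obtain ⟨P, hPN, hP0, hPinv, hPmin⟩ := exists_minimal_invariant u N hN hinv
    obtain ⟨τ, S, hS1, hSP, hS⟩ := exists_irrRep_of_minimal u hu P hP0 hPinv hPmin
    obtain ⟨σ, ⟨hσD, V, hV1, hV2, hV⟩, -⟩ := D.existsUnique τ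
    have hV' : ∀ g, Vᴴ * σ.mat g = τ.mat g * Vᴴ := by
      intro g
      calc Vᴴ * σ.mat g = Vᴴ * (σ.mat g * V) * Vᴴ := by
            rw [Matrix.mul_assoc, Matrix.mul_assoc, hV2, Matrix.mul_one]
        _ = _ := by rw [← hV, ← Matrix.mul_assoc, hV1, Matrix.one_mul]
    have hV0 : V = 0 := by
      apply Matrix.mulVec_injective
      funext w
      have := hPN (hSP w) ⟨σ, hσD⟩ (S * Vᴴ) (fun g => by
        rw [Matrix.mul_assoc, hV', ← Matrix.mul_assoc, hS, Matrix.mul_assoc])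
      rw [Matrix.mulVec_mulVec, Matrix.conjTranspose_mul, Matrix.conjTranspose_conjTranspose,
        Matrix.mul_assoc, hS1, Matrix.mul_one] at this
      rw [this, Matrix.zero_mulVec]
    rw [hV0, Matrix.mul_zero] at hV1
    have := congrFun (congrFun hV1 ⟨0, τ.dim_pos⟩) ⟨0, τ.dim_pos⟩
    simp at this
  have h2 : Xᴴ = 0 := by
    ext i j
    have h3 : Xᴴ.col j ∈ N := by
      intro σ S hS
      have h4 := congrArg Matrix.conjTranspose (hX σ S hS)
      rw [Matrix.conjTranspose_mul, Matrix.conjTranspose_zero] at h4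
      ext k
      exact congrFun (congrFun h4 k) j
    rw [hN, Submodule.mem_bot] at h3
    exact congrFun h3 i
  simpa using congrArg Matrix.conjTranspose h2

end Completeness

/-! ### Fourier transform -/

section Fourier

open UnitaryDual MonoidAlgebra

variable {G : Type*} [Group G]

/-- Schur's lemma for inequivalent representations. -/
theorem intertwiner_eq_zero {D : UnitaryDual G} {ρ σ : D} (h : ρ ≠ σ)
    (Y : Matrix (Ix σ) (Ix ρ) ℂ) (hY : ∀ g, Y * ρ.1.mat g = σ.1.mat g * Y) : Y = 0 := by
  have := ρ.1.irreducible
  have := σ.1.irreducible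
  let f : (toRepresentation ρ.1.rep).IntertwiningMap (toRepresentation σ.1.rep) :=
    { toLinearMap := Matrix.toLin' Y
      isIntertwining' := fun g => by
        refine LinearMap.ext fun v => ?_
        change Y *ᵥ (ρ.1.mat g *ᵥ v) = σ.1.mat g *ᵥ (Y *ᵥ v)
        rw [Matrix.mulVec_mulVec, Matrix.mulVec_mulVec, hY] }
  rcases Representation.IsIrreducible.bijective_or_eq_zero f with hf | hf
  · exfalso
    apply h
    obtain ⟨τ, -, hτ⟩ := D.existsUnique ρ.1
    have h1 := hτ σ.1 ⟨σ.2, IrrRep.unitaryEquiv_of_equiv (f.ofBijective hf)⟩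
    have h2 := hτ ρ.1 ⟨ρ.2, 1, by simp, by simp, by simp⟩
    exact Subtype.ext (h2.trans h1.symm)
  · apply Matrix.mulVec_injective
    funext v
    have h1 := congrArg (fun q : (toRepresentation ρ.1.rep).IntertwiningMap
      (toRepresentation σ.1.rep) => q v) hf
    rw [Matrix.zero_mulVec]
    exact h1

/-- Schur's lemma for an irreducible representation. -/
theorem intertwiner_eq_smul (π : IrrRep G)
    (Y : Matrix (Fin π.dim) (Fin π.dim) ℂ) (hY : ∀ g, Y * π.mat g = π.mat g * Y) :
    ∃ c : ℂ, Y = c • 1 := by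
  have := π.irreducible
  let f : (toRepresentation π.rep).IntertwiningMap (toRepresentation π.rep) :=
    { toLinearMap := Matrix.toLin' Y
      isIntertwining' := fun g => by
        refine LinearMap.ext fun v => ?_
        change Y *ᵥ (π.mat g *ᵥ v) = π.mat g *ᵥ (Y *ᵥ v)
        rw [Matrix.mulVec_mulVec, Matrix.mulVec_mulVec, hY] }
  obtain ⟨c, hc⟩ := (Representation.IsIrreducible.algebraMap_intertwiningMap_bijective_of_isAlgClosed
    (ρ := toRepresentation π.rep)).2 f
  refine ⟨c, ?_⟩
  apply Matrix.mulVec_injective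
  funext v
  have h2 := congrArg (fun q : (toRepresentation π.rep).IntertwiningMap
    (toRepresentation π.rep) => q v) hc
  change _ = Y *ᵥ v at h2
  rw [← h2, Matrix.smul_mulVec, Matrix.one_mulVec]
  rfl

variable [Fintype G]

/-- Averaging over the group makes any matrix an intertwiner. For a matrix unit `E` the entries of
the average are the inner products of matrix coefficients, so Schur's lemma gives the orthogonality
relations. -/
theorem average_intertwines (ρ σ : IrrRep G) (E : Matrix (Fin σ.dim) (Fin ρ.dim) ℂ) (h : G) :
    (∑ g, σ.mat g * E * ρ.mat g⁻¹) * ρ.mat h = σ.mat h * ∑ g, σ.mat g * E * ρ.mat g⁻¹ := by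
  rw [Matrix.sum_mul, Matrix.mul_sum]
  refine Fintype.sum_equiv (Equiv.mulLeft h⁻¹) _ _ fun g => ?_
  have h1 : σ.mat h * σ.mat (h⁻¹ * g) = σ.mat g := by
    rw [← IrrRep.mat_mul, mul_inv_cancel_left]
  have h2 : ρ.mat (h⁻¹ * g)⁻¹ = ρ.mat g⁻¹ * ρ.mat h := by
    rw [← IrrRep.mat_mul]; congr 1; group
  simp only [Equiv.coe_mulLeft]
  rw [h2, ← Matrix.mul_assoc, ← Matrix.mul_assoc, ← Matrix.mul_assoc, h1]

theorem sum_coeff_mul_coeff_eq (ρ σ : IrrRep G) (k l : Fin σ.dim) (i j : Fin ρ.dim) :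
    ∑ g, σ.mat g k l * ρ.mat g⁻¹ j i =
      (∑ g, σ.mat g * Matrix.single l j (1 : ℂ) * ρ.mat g⁻¹) k i := by
  rw [Matrix.sum_apply]
  refine Finset.sum_congr rfl fun g _ => ?_
  simp [Matrix.mul_apply, Matrix.single_apply, ite_and]

/-- Orthogonality of the matrix coefficients of inequivalent representations. -/
theorem sum_coeff_mul_coeff_of_ne {D : UnitaryDual G} {ρ σ : D} (h : σ ≠ ρ) (k l : Ix σ)
    (i j : Ix ρ) : ∑ g, σ.1.mat g k l * ρ.1.mat g⁻¹ j i = 0 := by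
  rw [sum_coeff_mul_coeff_eq, intertwiner_eq_zero h.symm _ (average_intertwines ρ.1 σ.1 _)]
  rfl

/-- Orthogonality of the matrix coefficients of an irreducible representation. -/
theorem dim_mul_sum_coeff_mul_coeff (σ : IrrRep G) (k l i j : Fin σ.dim) :
    (σ.dim : ℂ) * ∑ g, σ.mat g k l * σ.mat g⁻¹ j i =
      if k = i ∧ j = l then (Fintype.card G : ℂ) else 0 := by
  obtain ⟨c, hc⟩ := intertwiner_eq_smul σ _
    (average_intertwines σ σ (Matrix.single l j (1 : ℂ)))
  -- The trace determines the Schur scalar: each of the `|G|` summands is conjugate to the matrix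
  -- unit.
  have htr : (σ.dim : ℂ) * c = if j = l then (Fintype.card G : ℂ) else 0 := by
    have h1 := congrArg Matrix.trace hc
    have h2 : ∀ g, (σ.mat g * Matrix.single l j (1 : ℂ) * σ.mat g⁻¹).trace =
        if j = l then 1 else 0 := by
      intro g
      rw [Matrix.trace_mul_comm, ← Matrix.mul_assoc, ← IrrRep.mat_mul, inv_mul_cancel,
        IrrRep.mat_one, Matrix.one_mul]
      split_ifs with h
      · rw [h, Matrix.trace_single_eq_same]
      · rw [Matrix.trace_single_eq_of_ne _ _ _ (Ne.symm h)]
    rw [Matrix.trace_sum, Finset.sum_congr rfl fun g _ => h2 g, Matrix.trace_smul,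
      Matrix.trace_one] at h1
    rw [mul_comm]
    simpa using h1.symm
  rw [sum_coeff_mul_coeff_eq, hc, Matrix.smul_apply, smul_eq_mul, ← mul_assoc, htr,
    Matrix.one_apply]
  by_cases h1 : k = i <;> by_cases h2 : j = l <;> simp [h1, h2]

/-- Matrix coefficients span all functions on the group. -/
theorem eq_zero_of_sum_mat_eq_zero [DecidableEq G] (D : UnitaryDual G) (f : G → ℂ)
    (hf : ∀ σ : D, ∑ g, f g • σ.1.mat g = 0) : f = 0 := by
  -- In the left regular representation `∑ f g • u g` is convolution by `f`. It vanishes on the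
  -- range of every intertwiner, hence is zero, and its column at `1` is `f`.
  let u : G →* Matrix G G ℂ :=
    ((convMatrix G ℂ).toMonoidHom).comp (MonoidAlgebra.of ℂ G)
  have hua : ∀ g h k, u g h k = if h = g * k then 1 else 0 := by
    intro g h k
    change (MonoidAlgebra.single g (1 : ℂ)).coeff (h * k⁻¹) = _
    rw [coeff_single, Finsupp.single_apply]
    congr 1
    rw [eq_mul_inv_iff_mul_eq, @eq_comm _ h]
  have hu : ∀ g, (u g)ᴴ = u g⁻¹ := by
    intro g
    ext h k
    rw [Matrix.conjTranspose_apply, hua, hua]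
    have : k = g * h ↔ h = g⁻¹ * k := by rw [eq_inv_mul_iff_mul_eq, @eq_comm _ k]
    by_cases hk : k = g * h
    · rw [if_pos hk, if_pos (this.1 hk), star_one]
    · rw [if_neg hk, if_neg (fun h => hk (this.2 h)), star_zero]
  have h0 : ∑ g, f g • u g = 0 := by
    apply eq_zero_of_mul_intertwiner D u hu
    intro σ S hS
    have : (∑ g, f g • u g) * S = S * ∑ g, f g • σ.1.mat g := by
      rw [Matrix.sum_mul, Matrix.mul_sum]
      refine Finset.sum_congr rfl fun g _ => ?_
      rw [Matrix.smul_mul, Matrix.mul_smul, hS]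
    rw [this, hf, Matrix.mul_zero]
  funext g
  have := congrFun (congrFun h0 g) 1
  rw [Matrix.sum_apply] at this
  simpa [hua, Matrix.smul_apply] using this

/-- By duality: a functional vanishing on all matrix coefficients is a function on `G` whose Fourier
transform is zero. -/
theorem span_mat_eq_top (D : UnitaryDual G) :
    Submodule.span ℂ (Set.range fun x : (Σ σ : D, Ix σ × Ix σ) => fun g : G =>
      x.1.1.mat g x.2.1 x.2.2) = ⊤ := by
  classical
  by_contra h
  obtain ⟨φ, hφ0, hφ⟩ := Submodule.exists_le_ker_of_lt_top _ (lt_top_iff_ne_top.2 h)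
  apply hφ0
  have h1 : ∀ w : G → ℂ, φ w = ∑ g, w g * φ (Pi.single g 1) := by
    intro w
    conv_lhs => rw [← Finset.univ_sum_single w]
    rw [map_sum]
    refine Finset.sum_congr rfl fun g _ => ?_
    rw [← smul_eq_mul, ← map_smul, ← Pi.single_smul, smul_eq_mul, mul_one]
  have h2 : (fun g => φ (Pi.single g 1)) = 0 := by
    apply eq_zero_of_sum_mat_eq_zero D
    intro σ
    ext i j
    have h3 := hφ (Submodule.subset_span ⟨⟨σ, i, j⟩, rfl⟩)
    rw [LinearMap.mem_ker, h1] at h3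
    rw [Matrix.sum_apply]
    simpa [mul_comm] using h3
  ext w
  have := congrFun h2
  simp only [Pi.zero_apply] at this
  simp [this]

variable (R : Type*) [Ring R] [Algebra ℂ R]

/-- The extension of the representation `σ` to `R[G]`. -/
noncomputable def evalHom (σ : IrrRep G) :
    MonoidAlgebra R G →+* Matrix (Fin σ.dim) (Fin σ.dim) R :=
  liftNCRingHom (Matrix.scalar (Fin σ.dim) : R →+* _)
    { toFun := fun g => scalar R (σ.mat g)
      map_one' := by
        rw [IrrRep.mat_one, scalar, Matrix.map_one _ (map_zero _) (map_one _)]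
      map_mul' := fun g h => by rw [IrrRep.mat_mul, scalar, Matrix.map_mul]; rfl }
    (fun r g => by
      change Matrix.scalar _ r * _ = _ * Matrix.scalar _ r
      ext i j
      simp [scalar, Algebra.commutes])

theorem evalHom_apply (σ : IrrRep G) (X : MonoidAlgebra R G) (i j : Fin σ.dim) :
    evalHom R σ X i j = ∑ g, σ.mat g i j • X.coeff g := by
  induction X using MonoidAlgebra.induction_linear with
  | zero => simp
  | add x y hx hy => simp [hx, hy, Finset.sum_add_distrib]
  | single g r =>
    classical
    have : evalHom R σ (single g r) = Matrix.scalar _ r * scalar R (σ.mat g) := liftNC_single ..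
    rw [this]
    simp [Finsupp.single_apply, scalar, Algebra.smul_def, Algebra.commutes]

variable {R}

theorem eq_zero_of_evalHom (D : UnitaryDual G) (X : MonoidAlgebra R G)
    (hX : ∀ σ : D, evalHom R σ.1 X = 0) : X = 0 := by
  classical
  let L : (G → ℂ) →ₗ[ℂ] R :=
    { toFun := fun f => ∑ g, f g • X.coeff g
      map_add' := fun f f' => by simp [add_smul, Finset.sum_add_distrib]
      map_smul' := fun c f => by simp [Finset.smul_sum, smul_smul] }
  have hL : (⊤ : Submodule ℂ (G → ℂ)) ≤ LinearMap.ker L := by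
    rw [← span_mat_eq_top D, Submodule.span_le]
    rintro _ ⟨⟨σ, i, j⟩, rfl⟩
    have := congrFun (congrFun (hX σ) i) j
    rw [evalHom_apply] at this
    exact this
  ext g
  have : L (Pi.single g 1) = 0 := hL trivial
  simpa [L, Pi.single_apply] using this

theorem evalHom_ext (D : UnitaryDual G) {X Y : MonoidAlgebra R G}
    (h : ∀ σ : D, evalHom R σ.1 X = evalHom R σ.1 Y) : X = Y :=
  sub_eq_zero.1 (eq_zero_of_evalHom D _ fun σ => by rw [map_sub, h, sub_self])

/-- The inverse Fourier transform. -/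
theorem exists_evalHom_eq (D : UnitaryDual G) (Y : ∀ σ : D, Matrix (Ix σ) (Ix σ) R) :
    ∃ X : MonoidAlgebra R G, ∀ σ : D, evalHom R σ.1 X = Y σ := by
  classical
  have hcard : (Fintype.card G : ℂ) ≠ 0 := by exact_mod_cast Fintype.card_ne_zero
  have hsum : ∀ (σ ρ : D) (k l : Ix σ) (i j : Ix ρ),
      ∑ g, (σ.1.mat g k l * ((Fintype.card G : ℂ)⁻¹ * (ρ.1.dim * ρ.1.mat g⁻¹ j i))) =
        (Fintype.card G : ℂ)⁻¹ * (ρ.1.dim * ∑ g, σ.1.mat g k l * ρ.1.mat g⁻¹ j i) := by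
    intro σ ρ k l i j
    rw [Finset.mul_sum, Finset.mul_sum]
    exact Finset.sum_congr rfl fun g _ => by ring
  -- Fourier inversion: the coefficient at `g` is `|G|⁻¹ ∑ d_ρ Tr(Y_ρ ρ(g⁻¹))`, with the trace
  -- written out in coordinates.
  refine ⟨∑ g, ∑ ρ : D, ∑ i, ∑ j, single g
    (((Fintype.card G : ℂ)⁻¹ * (ρ.1.dim * ρ.1.mat g⁻¹ j i)) • Y ρ i j), fun σ => ?_⟩
  ext k l
  have h1 : ∀ g (r : R), evalHom R σ.1 (single g r) k l = σ.1.mat g k l • r := by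
    intro g r
    rw [evalHom_apply]
    simp [Finsupp.single_apply]
  simp only [map_sum, Matrix.sum_apply, h1, smul_smul]
  rw [Finset.sum_comm]
  have h2 : ∀ ρ : D, ∑ g, ∑ i, ∑ j, (σ.1.mat g k l * ((Fintype.card G : ℂ)⁻¹ *
      (ρ.1.dim * ρ.1.mat g⁻¹ j i))) • Y ρ i j = ∑ i, ∑ j, ((Fintype.card G : ℂ)⁻¹ *
      (ρ.1.dim * ∑ g, σ.1.mat g k l * ρ.1.mat g⁻¹ j i)) • Y ρ i j := by
    intro ρ
    rw [Finset.sum_comm]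
    refine Finset.sum_congr rfl fun i _ => ?_
    rw [Finset.sum_comm]
    refine Finset.sum_congr rfl fun j _ => ?_
    rw [← Finset.sum_smul, hsum]
  rw [Finset.sum_congr rfl fun ρ _ => h2 ρ, Finset.sum_eq_single σ]
  · rw [Finset.sum_eq_single k, Finset.sum_eq_single l]
    · rw [dim_mul_sum_coeff_mul_coeff, if_pos ⟨rfl, rfl⟩, inv_mul_cancel₀ hcard, one_smul]
    · intro j _ hj
      rw [dim_mul_sum_coeff_mul_coeff, if_neg (fun h => hj h.2), mul_zero, zero_smul]
    · simp
    · intro i _ hi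
      refine Finset.sum_eq_zero fun j _ => ?_
      rw [dim_mul_sum_coeff_mul_coeff, if_neg (fun h => hi h.1.symm), mul_zero, zero_smul]
    · simp
  · intro ρ _ hρ
    refine Finset.sum_eq_zero fun i _ => Finset.sum_eq_zero fun j _ => ?_
    rw [sum_coeff_mul_coeff_of_ne hρ.symm, mul_zero, mul_zero, zero_smul]
  · simp

end Fourier

/-! ### From families indexed by the dual to the group algebra -/

section Amplification

variable {R S : Type*} [Ring R] [Ring S] {h k l m : Type*} [Fintype h] [DecidableEq h]

/-- The entrywise application of a homomorphism `f : R → S ⊗ B(H)`. -/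
def amp (f : R →+* Matrix h h S) (X : Matrix l k R) : Matrix (h × l) (h × k) S :=
  Matrix.of fun p q => f (X p.2 q.2) p.1 q.1

theorem amp_apply (f : R →+* Matrix h h S) (X : Matrix l k R) (i j : h) (a : l) (b : k) :
    amp f X (i, a) (j, b) = f (X a b) i j := rfl

theorem amp_mul [Fintype k] (f : R →+* Matrix h h S) (X : Matrix l k R) (Y : Matrix k m R) :
    amp f (X * Y) = amp f X * amp f Y := by
  ext ⟨i, a⟩ ⟨j, b⟩
  simp only [amp_apply, Matrix.mul_apply, map_sum, map_mul, Matrix.sum_apply,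
    Fintype.sum_prod_type]
  rw [Finset.sum_comm]

theorem amp_one [DecidableEq k] (f : R →+* Matrix h h S) :
    amp f (1 : Matrix k k R) = 1 := by
  ext ⟨i, a⟩ ⟨j, b⟩
  by_cases hab : a = b <;> by_cases hij : i = j <;> simp [amp_apply, Matrix.one_apply, hab, hij]

theorem kronecker_one_mul [Fintype k] [Fintype m] [DecidableEq m] {n : Type*} (X : Matrix l k R)
    (Y : Matrix k n R) : (X * Y) ⊗ₖ (1 : Matrix m m R) =
      (X ⊗ₖ (1 : Matrix m m R)) * (Y ⊗ₖ (1 : Matrix m m R)) := by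
  ext ⟨i, a⟩ ⟨j, b⟩
  by_cases hab : a = b <;>
    simp [Matrix.mul_apply, Fintype.sum_prod_type, Matrix.one_apply, hab]

variable [Algebra ℂ R] [Algebra ℂ S]

theorem amp_scalar (f : R →+* Matrix h h S) (hf : ∀ c : ℂ, f (algebraMap ℂ R c) =
    algebraMap ℂ _ c) (T : Matrix l k ℂ) :
    amp f (scalar R T) = scalar S ((1 : Matrix h h ℂ) ⊗ₖ T) := by
  ext ⟨i, a⟩ ⟨j, b⟩
  by_cases hij : i = j <;>
    simp [amp_apply, scalar, hf, Matrix.algebraMap_matrix_apply, hij]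

theorem scalar_mul [Fintype k] (T : Matrix l k ℂ) (T' : Matrix k m ℂ) :
    scalar R (T * T') = scalar R T * scalar R T' := by
  simp [scalar, Matrix.map_mul]

theorem scalar_one [DecidableEq k] : scalar R (1 : Matrix k k ℂ) = 1 := by
  simp [scalar]

theorem scalar_sum {ι : Type*} (s : Finset ι) (T : ι → Matrix l k ℂ) :
    scalar R (∑ i ∈ s, T i) = ∑ i ∈ s, scalar R (T i) := by
  ext a b
  simp [scalar, Matrix.sum_apply]

theorem scalar_kronecker_one [DecidableEq m] (T : Matrix l k ℂ) :
    scalar R (T ⊗ₖ (1 : Matrix m m ℂ)) = scalar R T ⊗ₖ (1 : Matrix m m R) := by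
  ext ⟨i, a⟩ ⟨j, b⟩
  by_cases hab : a = b <;> simp [scalar, hab]

end Amplification

/-! ### Resolution of the identity on `H_π ⊗ H_ρ` by intertwiners -/

section Completeness

open UnitaryDual

variable {G : Type*} [Group G] [Finite G] {D : UnitaryDual G}

/-- `∑ T T* = 1`. -/
theorem sum_intertwiner_mul_conjTranspose (B : IntertwinerBasis D) (π ρ : D) :
    ∑ σ : D, ∑ a, B.T π ρ σ a * (B.T π ρ σ a)ᴴ = 1 := by
  classical
  let u : G →* Matrix (Ix π × Ix ρ) (Ix π × Ix ρ) ℂ :=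
    { toFun := fun g => π.1.mat g ⊗ₖ ρ.1.mat g
      map_one' := by rw [IrrRep.mat_one, IrrRep.mat_one, Matrix.one_kronecker_one]
      map_mul' := fun g h => by
        rw [IrrRep.mat_mul, IrrRep.mat_mul, Matrix.mul_kronecker_mul] }
  have hu : ∀ g, u g = π.1.mat g ⊗ₖ ρ.1.mat g := fun g => rfl
  symm
  rw [← sub_eq_zero]
  apply eq_zero_of_mul_intertwiner D u
  · intro g
    rw [hu, hu, Matrix.conjTranspose_kronecker, IrrRep.mat_conjTranspose,
      IrrRep.mat_conjTranspose]
  · intro σ S hS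
    have hS' : S ∈ intertwiners σ π ρ := hS
    rw [← B.span_eq] at hS'
    rw [Matrix.sub_mul, Matrix.one_mul, sub_eq_zero, Matrix.sum_mul]
    symm
    rw [Finset.sum_eq_single σ]
    · clear hS
      induction hS' using Submodule.span_induction with
      | mem S hS =>
        obtain ⟨a, rfl⟩ := hS
        rw [Matrix.sum_mul, Finset.sum_eq_single a]
        · rw [Matrix.mul_assoc, B.orthonormal, if_pos rfl, Matrix.mul_one]
        · intro b _ hb
          rw [Matrix.mul_assoc, B.orthonormal, if_neg hb.symm, Matrix.mul_zero]
        · simp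
      | zero => simp
      | add S S' _ _ h h' => rw [Matrix.mul_add, h, h']
      | smul c S _ h => rw [Matrix.mul_smul, h]
    · intro τ _ hτ
      rw [Matrix.sum_mul]
      refine Finset.sum_eq_zero fun a _ => ?_
      -- `T* S` intertwines the inequivalent `σ` and `τ`, so Schur's lemma kills the cross terms.
      rw [Matrix.mul_assoc, intertwiner_eq_zero hτ.symm ((B.T π ρ τ a)ᴴ * S), Matrix.mul_zero]
      intro g
      have h1 := congrArg Matrix.conjTranspose (B.mem π ρ τ a g⁻¹)
      rw [Matrix.conjTranspose_mul, Matrix.conjTranspose_mul, Matrix.conjTranspose_kronecker,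
        IrrRep.mat_conjTranspose, IrrRep.mat_conjTranspose, IrrRep.mat_conjTranspose, inv_inv] at h1
      rw [Matrix.mul_assoc, hS, hu, ← Matrix.mul_assoc, ← h1, Matrix.mul_assoc]
    · simp

variable {A : Type*} [Ring A] [Algebra ℂ A]

theorem sum_scalar_intertwiner (B : IntertwinerBasis D) (π ρ : D) :
    ∑ σ : D, ∑ a, scalar A (B.T π ρ σ a) * scalar A (B.T π ρ σ a)ᴴ = 1 := by
  have h := congrArg (scalar A) (sum_intertwiner_mul_conjTranspose B π ρ)
  rw [scalar_one] at h
  rw [← h]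
  simp only [scalar_sum, scalar_mul]

/-- Operators on `H_π ⊗ H_ρ` are determined on the ranges of the intertwiners. -/
theorem eq_of_mul_scalar_eq (B : IntertwinerBasis D) {l : Type*} (π ρ : D)
    {X Y : Matrix l (Ix π × Ix ρ) A}
    (h : ∀ σ, ∀ T ∈ intertwiners σ π ρ, X * scalar A T = Y * scalar A T) : X = Y := by
  rw [← Matrix.mul_one X, ← Matrix.mul_one Y, ← sum_scalar_intertwiner B π ρ]
  simp only [Matrix.mul_sum, ← Matrix.mul_assoc]
  refine Finset.sum_congr rfl fun σ _ => Finset.sum_congr rfl fun a _ => ?_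
  rw [h σ _ (B.mem π ρ σ a)]

end Completeness

/-! ### Compatibility of the Fourier transform with products, tensor units and the comultiplication
-/

section Evaluation

open UnitaryDual MonoidAlgebra

variable {G : Type*} [Group G] [Fintype G] {D : UnitaryDual G}
variable {R S : Type*} [Ring R] [Algebra ℂ R] [Ring S] [Algebra ℂ S]

theorem evalHom_single (σ : IrrRep G) (g : G) (r : R) (i j : Fin σ.dim) :
    evalHom R σ (single g r) i j = σ.mat g i j • r := by
  classical
  rw [evalHom_apply]
  simp [Finsupp.single_apply]

theorem evalHom_mapRingHom (σ : IrrRep G) (f : R →+* S) (hf : ∀ (c : ℂ) r, f (c • r) = c • f r)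
    (X : MonoidAlgebra R G) : evalHom S σ (mapRingHom G f X) = (evalHom R σ X).map f := by
  ext i j
  simp [evalHom_apply, hf]

theorem evalHom_smul (σ : IrrRep G) (c : ℂ) (X : MonoidAlgebra R G) :
    evalHom R σ (c • X) = c • evalHom R σ X := by
  ext i j
  simp [evalHom_apply, Finset.smul_sum, smul_smul, mul_comm]

theorem evalHom_algebraMap (σ : IrrRep G) (c : ℂ) :
    evalHom R σ (algebraMap ℂ _ c) = algebraMap ℂ _ c := by
  rw [Algebra.algebraMap_eq_smul_one, evalHom_smul, map_one, Algebra.algebraMap_eq_smul_one]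

theorem amp_evalHom_ext (D : UnitaryDual G) {k l : Type*} {X Y : Matrix l k (MonoidAlgebra R G)}
    (h : ∀ π : D, amp (evalHom R π.1) X = amp (evalHom R π.1) Y) : X = Y := by
  ext1 a b
  refine evalHom_ext D fun π => ?_
  ext i j
  exact congrFun (congrFun (h π) (i, a)) (j, b)

theorem amp_evalHom_singleOne (π ρ : IrrRep G) (X : MonoidAlgebra R G) :
    amp (evalHom R π) (evalHom (MonoidAlgebra R G) ρ (singleOneRingHom X)) =
      evalHom R π X ⊗ₖ (1 : Matrix (Fin ρ.dim) (Fin ρ.dim) R) := by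
  ext ⟨i, a⟩ ⟨j, b⟩
  have h := evalHom_single ρ 1 X a b
  rw [amp_apply]
  change evalHom R π (evalHom (MonoidAlgebra R G) ρ (single 1 X) a b) i j = _
  rw [h, IrrRep.mat_one, evalHom_smul]
  by_cases hab : a = b
  · subst hab; simp
  · simp [hab]

/-- `Δ(g) = g ⊗ g` evaluates to `π(g) ⊗ ρ(g)`, so on group elements this is the defining property of
`T`. It is the link between intertwiners and the comultiplication. -/
theorem amp_evalHom_diagHom {π ρ σ : D} {T : Matrix (Ix π × Ix ρ) (Ix σ) ℂ}
    (hT : T ∈ intertwiners σ π ρ) (X : MonoidAlgebra R G) :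
    amp (evalHom R π.1) (evalHom (MonoidAlgebra R G) ρ.1 (diagHom G R X)) * scalar R T =
      scalar R T * evalHom R σ.1 X := by
  induction X using MonoidAlgebra.induction_linear with
  | zero => 
    ext; simp [amp, Matrix.mul_apply]
  | add x y hx hy =>
    have hadd : ∀ Y Z : Matrix (Ix ρ) (Ix ρ) (MonoidAlgebra R G), amp (evalHom R π.1) (Y + Z) =
      amp (evalHom R π.1) Y + amp (evalHom R π.1) Z := fun Y Z => by ext; simp [amp]
    rw [map_add, map_add, map_add, hadd, Matrix.add_mul, hx, hy, Matrix.mul_add]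
  | single g r =>
    ext ⟨i, a⟩ j
    have h1 := congrFun (congrFun (hT g) (i, a)) j
    have h2 := congrArg (fun c : ℂ => c • r) h1
    simp only [Matrix.mul_apply, Finset.sum_smul] at h2 ⊢
    simp only [scalar, Matrix.map_apply, evalHom_single]
    refine Eq.trans (Eq.trans (Finset.sum_congr rfl fun q _ => ?_) h2.symm)
      (Finset.sum_congr rfl fun q _ => ?_)
    · rw [← Algebra.commutes, ← Algebra.smul_def]
      obtain ⟨b, c⟩ := q
      rw [amp_apply, diagHom_single, evalHom_single, evalHom_smul, Matrix.smul_apply,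
        evalHom_single, smul_smul, smul_smul]
      congr 1
      simp; ring
    · rw [← Algebra.smul_def, smul_smul]

end Evaluation

/-! ### The axioms of a cocycle twisted action as identities in group algebras -/

section Translation

open UnitaryDual MonoidAlgebra

variable {G : Type*} [Group G] {D : UnitaryDual G}
variable {A : Type*} [Ring A] [Algebra ℂ A]

theorem smul_mapRingHom {a : A →+* MonoidAlgebra A G}
    (hac : ∀ (c : ℂ) x, a (c • x) = c • a x) (c : ℂ)
    (X : MonoidAlgebra A G) : mapRingHom G a (c • X) = c • mapRingHom G a X := by
  ext g; simp [hac]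

theorem smul_diagHom (c : ℂ) (X : MonoidAlgebra A G) :
    diagHom G A (c • X) = c • diagHom G A X := by
  induction X using MonoidAlgebra.induction_linear with
  | zero => simp
  | add x y hx hy => rw [smul_add, map_add, hx, hy, map_add, smul_add]
  | single g r => simp

section

variable [StarRing A] {α : ∀ π : D, A →⋆ₐ[ℂ] Matrix (Ix π) (Ix π) A}

theorem amp_evalHom_map {a : A →+* MonoidAlgebra A G}
    (ha : ∀ (π : D) x, evalHom A π.1 (a x) = α π x) {k l : Type*}
    (π : D) (X : Matrix l k A) : amp (evalHom A π.1) (X.map a) = amplify (α π) X := by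
  ext ⟨i, b⟩ ⟨j, c⟩
  rw [amp_apply, Matrix.map_apply, ha]
  rfl

theorem amplify_mul_scalar {k l m : Type*} [Fintype k] (π : D) (X : Matrix l k A)
    (T : Matrix k m ℂ) : amplify (α π) (X * scalar A T) =
      amplify (α π) X * scalar A ((1 : Matrix (Ix π) (Ix π) ℂ) ⊗ₖ T) := by
  rw [← amp_scalar (α π : A →+* Matrix (Ix π) (Ix π) A) (fun c => AlgHomClass.commutes (α π) c)]
  exact amp_mul (α π : A →+* Matrix (Ix π) (Ix π) A) X _

end

variable [Fintype G]

/-- The inverse Fourier transform in two variables. -/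
theorem exists_amp_evalHom_eq (U : ∀ π ρ : D, Matrix (Ix π × Ix ρ) (Ix π × Ix ρ) A) :
    ∃ X : MonoidAlgebra (MonoidAlgebra A G) G,
      ∀ π ρ : D, amp (evalHom A π.1) (evalHom _ ρ.1 X) = U π ρ := by
  choose Y hY using fun (ρ : D) (k l : Ix ρ) => exists_evalHom_eq D
    (fun π => Matrix.of fun i j => U π ρ (i, k) (j, l))
  obtain ⟨X, hX⟩ := exists_evalHom_eq D fun ρ => Matrix.of (Y ρ)
  refine ⟨X, fun π ρ => ?_⟩
  ext ⟨i, k⟩ ⟨j, l⟩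
  rw [hX, amp_apply, Matrix.of_apply, hY, Matrix.of_apply]

theorem amp_amp_evalHom_ext (D : UnitaryDual G) {X Y : MonoidAlgebra (MonoidAlgebra A G) G}
    (h : ∀ π ρ : D, amp (evalHom A π.1) (evalHom _ ρ.1 X) =
      amp (evalHom A π.1) (evalHom _ ρ.1 Y)) : X = Y :=
  evalHom_ext D fun ρ => amp_evalHom_ext D fun π => h π ρ

variable {U : ∀ π ρ : D, Matrix (Ix π × Ix ρ) (Ix π × Ix ρ) A}

theorem amp_amp_kronecker_one (π ρ σ : D) (V : MonoidAlgebra (MonoidAlgebra A G) G)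
    (hV : ∀ π ρ : D, amp (evalHom A π.1) (evalHom _ ρ.1 V) = U π ρ) :
    amp (evalHom A π.1) (amp (evalHom _ ρ.1) (evalHom _ σ.1 (singleOneRingHom V))) =
      assoc (U π ρ ⊗ₖ (1 : Matrix (Ix σ) (Ix σ) A)) := by
  rw [amp_evalHom_singleOne]
  ext ⟨i, b, c⟩ ⟨i', b', c'⟩
  by_cases h : c = c' <;> simp [amp_apply, assoc, h, ← hV]

/-- `Δ` acts here on the first group leg only, so `amp_evalHom_diagHom` is applied to each matrix
entry in the `σ`-coordinates; the reindexing brackets `H_π ⊗ H_ρ` together. -/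
theorem amp_amp_diagHom_mul (π ρ σ ζ : D) (V : MonoidAlgebra (MonoidAlgebra A G) G)
    (hV : ∀ π ρ : D, amp (evalHom A π.1) (evalHom _ ρ.1 V) = U π ρ)
    {T : Matrix (Ix π × Ix ρ) (Ix ζ) ℂ} (hT : T ∈ intertwiners ζ π ρ) :
    (Matrix.reindex (Equiv.prodAssoc (Ix π) (Ix ρ) (Ix σ)) (Equiv.prodAssoc _ _ _)).symm
      (amp (evalHom A π.1) (amp (evalHom _ ρ.1) (evalHom _ σ.1 (mapRingHom G (diagHom G A) V)))) *
        scalar A (T ⊗ₖ (1 : Matrix (Ix σ) (Ix σ) ℂ)) =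
      scalar A (T ⊗ₖ (1 : Matrix (Ix σ) (Ix σ) ℂ)) * U ζ σ := by
  rw [evalHom_mapRingHom _ _ smul_diagHom]
  ext ⟨⟨i, b⟩, c⟩ ⟨j, c'⟩
  have h := congrFun (congrFun (amp_evalHom_diagHom (R := A) hT (evalHom _ σ.1 V c c')) (i, b)) j
  rw [Matrix.mul_apply, Matrix.mul_apply] at h ⊢
  simp only [scalar_kronecker_one]
  refine (Fintype.sum_prod_type _).trans (Eq.trans (Eq.trans (Finset.sum_congr rfl fun q _ => ?_) h)
    (Eq.trans (Finset.sum_congr rfl fun q _ => ?_) (Fintype.sum_prod_type _).symm))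
  · rw [Finset.sum_eq_single c']
    · simp [amp_apply]
      rfl
    · intro c'' _ hc
      simp [hc]
    · simp
  · rw [Finset.sum_eq_single c]
    · simp [← hV, amp_apply]
    · intro c'' _ hc
      simp [Ne.symm hc]
    · simp

/-- Here `Δ` acts on the last group leg, so the identity for `ρ`, `σ` has only to be amplified by
`H_π`. -/
theorem amp_amp_diagHom_mul' (π ρ σ η : D) (V : MonoidAlgebra (MonoidAlgebra A G) G)
    (hV : ∀ π ρ : D, amp (evalHom A π.1) (evalHom _ ρ.1 V) = U π ρ)
    {T : Matrix (Ix ρ × Ix σ) (Ix η) ℂ} (hT : T ∈ intertwiners η ρ σ) :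
    amp (evalHom A π.1) (amp (evalHom _ ρ.1) (evalHom _ σ.1 (diagHom G _ V))) *
        scalar A ((1 : Matrix (Ix π) (Ix π) ℂ) ⊗ₖ T) =
      scalar A ((1 : Matrix (Ix π) (Ix π) ℂ) ⊗ₖ T) * U π η := by
  rw [← amp_scalar (evalHom A π.1) (evalHom_algebraMap π.1), ← amp_mul, amp_evalHom_diagHom hT,
    amp_mul, hV]

/-- The inner double sums on both sides of the cocycle identity are resolutions of the identity and
collapse. -/
theorem sum_insert_intertwiner (B : IntertwinerBasis D) {k l : Type*} (π ρ : D)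
    (P : Matrix k (Ix π × Ix ρ) A) (V : Matrix (Ix π × Ix ρ) (Ix π × Ix ρ) A)
    (Q : Matrix (Ix π × Ix ρ) l A) :
    ∑ ξ : D, ∑ b, P * (V * scalar A (B.T π ρ ξ b)) * scalar A (B.T π ρ ξ b)ᴴ * Q = P * V * Q := by
  have h : P * V * (∑ ξ : D, ∑ b, scalar A (B.T π ρ ξ b) * scalar A (B.T π ρ ξ b)ᴴ) * Q =
      P * V * Q := by rw [sum_scalar_intertwiner, Matrix.mul_one]
  rw [← h]
  simp only [Matrix.mul_sum, Matrix.sum_mul, Matrix.mul_assoc]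

theorem sum_one_kronecker_intertwiner (B : IntertwinerBasis D) (π ρ σ : D) :
    ∑ η : D, ∑ a, scalar A ((1 : Matrix (Ix π) (Ix π) ℂ) ⊗ₖ B.T ρ σ η a) *
      scalar A ((1 : Matrix (Ix π) (Ix π) ℂ) ⊗ₖ (B.T ρ σ η a)ᴴ) = 1 := by
  simp only [← scalar_mul, ← scalar_sum, ← Matrix.mul_kronecker_mul, Matrix.one_mul]
  have h : ∑ η : D, ∑ a, (1 : Matrix (Ix π) (Ix π) ℂ) ⊗ₖ (B.T ρ σ η a * (B.T ρ σ η a)ᴴ) =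
      (1 : Matrix (Ix π) (Ix π) ℂ) ⊗ₖ ∑ η : D, ∑ a, B.T ρ σ η a * (B.T ρ σ η a)ᴴ := by
    ext ⟨i, b⟩ ⟨j, c⟩
    simp [Matrix.sum_apply, Finset.mul_sum]
  rw [h, sum_intertwiner_mul_conjTranspose, Matrix.one_kronecker_one, scalar_one]

theorem sum_intertwiner_kronecker_one (B : IntertwinerBasis D) (π ρ σ : D) :
    ∑ ζ : D, ∑ a, scalar A (B.T π ρ ζ a ⊗ₖ (1 : Matrix (Ix σ) (Ix σ) ℂ)) *
      scalar A ((B.T π ρ ζ a)ᴴ ⊗ₖ (1 : Matrix (Ix σ) (Ix σ) ℂ)) = 1 := by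
  simp only [← scalar_mul, ← scalar_sum, ← Matrix.mul_kronecker_mul, Matrix.one_mul]
  have h : ∑ ζ : D, ∑ a, (B.T π ρ ζ a * (B.T π ρ ζ a)ᴴ) ⊗ₖ (1 : Matrix (Ix σ) (Ix σ) ℂ) =
      (∑ ζ : D, ∑ a, B.T π ρ ζ a * (B.T π ρ ζ a)ᴴ) ⊗ₖ (1 : Matrix (Ix σ) (Ix σ) ℂ) := by
    ext ⟨i, b⟩ ⟨j, c⟩
    simp [Matrix.sum_apply, Finset.sum_mul]
  rw [h, sum_intertwiner_mul_conjTranspose, Matrix.one_kronecker_one, scalar_one]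

variable [StarRing A]

theorem evalHom_conjTranspose [StarModule ℂ A] (σ : IrrRep G) (X Y : MonoidAlgebra A G)
    (h : ∀ g, Y.coeff g = star (X.coeff g⁻¹)) : evalHom A σ Y = (evalHom A σ X)ᴴ := by
  ext i j
  rw [Matrix.conjTranspose_apply, evalHom_apply, evalHom_apply, star_sum]
  refine Fintype.sum_equiv (Equiv.inv G) _ _ fun g => ?_
  rw [Equiv.inv_apply, star_smul, h, ← Matrix.conjTranspose_apply, IrrRep.mat_conjTranspose,
    inv_inv]

/-- The family `α` assembles to a homomorphism `A → A[G]`. -/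
theorem exists_groupAlgebraHom [StarModule ℂ A]
    (α : ∀ π : D, A →⋆ₐ[ℂ] Matrix (Ix π) (Ix π) A) :
    ∃ a : A →+* MonoidAlgebra A G, (∀ (π : D) x, evalHom A π.1 (a x) = α π x) ∧
      (∀ (c : ℂ) x, a (c • x) = c • a x) ∧
      ∀ x g, (a (star x)).coeff g = star ((a x).coeff g⁻¹) := by
  choose a ha using fun x : A => exists_evalHom_eq D fun π => α π x
  refine ⟨
    { toFun := a
      map_zero' := evalHom_ext D fun σ => by simp [ha]
      map_one' := evalHom_ext D fun σ => by simp [ha]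
      map_add' := fun x y => evalHom_ext D fun σ => by simp [ha]
      map_mul' := fun x y => evalHom_ext D fun σ => by simp [ha] }, fun π x => ha x π,
      fun c x => evalHom_ext D fun σ => ?_, fun x g => ?_⟩
  · change evalHom A σ.1 (a (c • x)) = evalHom A σ.1 (c • a x)
    rw [evalHom_smul, ha, ha, map_smul]
  · change (a (star x)).coeff g = star ((a x).coeff g⁻¹)
    let Y : MonoidAlgebra A G := ofCoeff (Finsupp.equivFunOnFinite.symm fun g =>
      star ((a x).coeff g⁻¹))
    have hY : a (star x) = Y := evalHom_ext D fun σ => by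
      rw [evalHom_conjTranspose σ.1 (a x) Y (fun _ => rfl), ha, ha, map_star,
        Matrix.star_eq_conjTranspose]
    rw [hY]
    rfl

variable {B : IntertwinerBasis D} {α : ∀ π : D, A →⋆ₐ[ℂ] Matrix (Ix π) (Ix π) A}
  {a : A →+* MonoidAlgebra A G}

/-- The hypothesis is known only after multiplication by each `T`. The ranges of the `T` exhaust
`H_π ⊗ H_ρ`, and on them `(id ⊗ Δ)(a(x))` acts as `α_σ(x)`. -/
theorem groupAlgebra_twisted (hαU : IsCocycleTwistedAction B α U)
    (ha : ∀ (π : D) x, evalHom A π.1 (a x) = α π x) (hac : ∀ (c : ℂ) x, a (c • x) = c • a x)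
    {V : MonoidAlgebra (MonoidAlgebra A G) G}
    (hV : ∀ π ρ : D, amp (evalHom A π.1) (evalHom _ ρ.1 V) = U π ρ) (x : A) :
    mapRingHom G a (a x) * V = V * diagHom G A (a x) := by
  refine amp_amp_evalHom_ext D fun π ρ => ?_
  rw [map_mul, map_mul, amp_mul, amp_mul, hV, evalHom_mapRingHom _ _ hac, ha, amp_evalHom_map ha]
  refine eq_of_mul_scalar_eq B π ρ fun σ T hT => ?_
  rw [hαU.twisted π ρ σ T hT, Matrix.mul_assoc (U π ρ), Matrix.mul_assoc (U π ρ),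
    amp_evalHom_diagHom hT, ha]

/-- Inserting `∑ T T* = 1` next to the comultiplied copies of `V` recovers, in each component `(π,
ρ, σ)`, the two sides of the cocycle identity of the action. -/
theorem groupAlgebra_cocycle (hαU : IsCocycleTwistedAction B α U)
    (ha : ∀ (π : D) x, evalHom A π.1 (a x) = α π x) (hac : ∀ (c : ℂ) x, a (c • x) = c • a x)
    {V : MonoidAlgebra (MonoidAlgebra A G) G}
    (hV : ∀ π ρ : D, amp (evalHom A π.1) (evalHom _ ρ.1 V) = U π ρ) :
    mapRingHom G (mapRingHom G a) V * diagHom G _ V =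
      singleOneRingHom V * mapRingHom G (diagHom G A) V := by
  refine evalHom_ext D fun σ => amp_evalHom_ext D fun ρ => amp_evalHom_ext D fun π => ?_
  have h := hαU.cocycle π ρ σ
  have hl : amp (evalHom A π.1) (amp (evalHom _ ρ.1) (evalHom _ σ.1
      (mapRingHom G (mapRingHom G a) V))) = amplify (α π) (U ρ σ) := by
    rw [evalHom_mapRingHom _ _ (smul_mapRingHom hac), ← amp_evalHom_map ha, ← hV]
    congr 1
    ext1 ⟨i, b⟩ ⟨j, c⟩
    rw [amp_apply, Matrix.map_apply, evalHom_mapRingHom _ _ hac, Matrix.map_apply, Matrix.map_apply,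
      amp_apply]
  set Y := amp (evalHom A π.1) (amp (evalHom _ ρ.1) (evalHom _ σ.1 (diagHom G _ V))) with hY
  set Z := (Matrix.reindex (Equiv.prodAssoc (Ix π) (Ix ρ) (Ix σ)) (Equiv.prodAssoc _ _ _)).symm
      (amp (evalHom A π.1) (amp (evalHom _ ρ.1) (evalHom _ σ.1 (mapRingHom G (diagHom G A) V))))
    with hZ
  rw [map_mul, map_mul, amp_mul, amp_mul, amp_mul, amp_mul, hl, amp_amp_kronecker_one π ρ σ V hV]
  have hl2 : amplify (α π) (U ρ σ) * Y = ∑ η : D, ∑ a, ∑ ξ : D, ∑ b,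
      amplify (α π) (U ρ σ * scalar A (B.T ρ σ η a)) * (U π η * scalar A (B.T π η ξ b)) *
        scalar A (B.T π η ξ b)ᴴ *
        scalar A ((1 : Matrix (Ix π) (Ix π) ℂ) ⊗ₖ (B.T ρ σ η a)ᴴ) := by
    simp only [sum_insert_intertwiner]
    rw [← Matrix.mul_one (amplify (α π) (U ρ σ) * Y), ← sum_one_kronecker_intertwiner B π ρ σ]
    simp only [Matrix.mul_sum]
    refine Finset.sum_congr rfl fun η _ => Finset.sum_congr rfl fun b _ => ?_
    have hT := amp_amp_diagHom_mul' π ρ σ η V hV (B.mem ρ σ η b)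
    rw [amplify_mul_scalar, Matrix.mul_assoc _ _ (U π η), ← hT]
    simp only [Matrix.mul_assoc, hY]
  have hr2 : (U π ρ ⊗ₖ (1 : Matrix (Ix σ) (Ix σ) A)) * Z = ∑ ζ : D, ∑ c, ∑ ξ : D, ∑ d,
      (U π ρ * scalar A (B.T π ρ ζ c)) ⊗ₖ (1 : Matrix (Ix σ) (Ix σ) A) *
        (U ζ σ * scalar A (B.T ζ σ ξ d)) *
        scalar A (B.T ζ σ ξ d)ᴴ *
        scalar A ((B.T π ρ ζ c)ᴴ ⊗ₖ (1 : Matrix (Ix σ) (Ix σ) ℂ)) := by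
    simp only [sum_insert_intertwiner]
    rw [← Matrix.mul_one (_ * Z), ← sum_intertwiner_kronecker_one B π ρ σ]
    simp only [Matrix.mul_sum]
    refine Finset.sum_congr rfl fun ζ _ => Finset.sum_congr rfl fun b _ => ?_
    have hT := amp_amp_diagHom_mul π ρ σ ζ V hV (B.mem π ρ ζ b)
    rw [kronecker_one_mul, ← scalar_kronecker_one, Matrix.mul_assoc _ _ (U ζ σ), ← hT]
    simp only [Matrix.mul_assoc, hZ]
  rw [hl2, h, ← hr2]
  have hassoc : ∀ X Y : Matrix ((Ix π × Ix ρ) × Ix σ) ((Ix π × Ix ρ) × Ix σ) A,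
      assoc (X * Y) = assoc X * assoc Y := fun X Y => by
    simp only [assoc, Matrix.reindex_apply, Matrix.submatrix_mul_equiv]
  rw [hassoc]
  congr 1

end Translation

/-! ### Reduction of the theorem to finding a row over `A` -/

section Reduction

open UnitaryDual MonoidAlgebra

variable {G : Type*} [Group G] {D : UnitaryDual G}

/-- The sum of the coefficients. -/
noncomputable def counit (G : Type*) [Group G] (R : Type*) [Ring R] : MonoidAlgebra R G →+* R :=
  liftNCRingHom (RingHom.id R) (1 : G →* R) fun _ _ => by simp

@[simp] theorem counit_single {R : Type*} [Ring R] (g : G) (r : R) :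
    counit G R (single g r) = r := by
  change liftNC _ _ _ = _
  rw [liftNC_single]
  simp

variable [Fintype G]

/-- The adjoint of an element of the group algebra. -/
noncomputable def conjCoeff {R : Type*} [Ring R] (s : R → R) (X : MonoidAlgebra R G) :
    MonoidAlgebra R G :=
  ofCoeff (Finsupp.equivFunOnFinite.symm fun g => s (X.coeff g⁻¹))

theorem coeff_conjCoeff {R : Type*} [Ring R] (s : R → R) (X : MonoidAlgebra R G) (g : G) :
    (conjCoeff s X).coeff g = s (X.coeff g⁻¹) := rfl

section

variable {R : Type*} [Ring R] [Algebra ℂ R]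

theorem evalHom_triv (X : MonoidAlgebra R G) (i j : Fin 1) :
    evalHom R (IrrRep.triv G) X i j = counit G R X := by
  induction X using MonoidAlgebra.induction_linear with
  | zero => rw [map_zero, map_zero]; rfl
  | add x y hx hy => rw [map_add, map_add, ← hx, ← hy]; rfl
  | single g r =>
    refine (evalHom_single (IrrRep.triv G) g r i j).trans ?_
    have : (IrrRep.triv G).mat g i j = 1 := by
      change (1 : Matrix (Fin 1) (Fin 1) ℂ) i j = 1
      rw [Subsingleton.elim i j, Matrix.one_apply_eq]
    rw [this, one_smul, counit_single]

theorem counit_smul (c : ℂ) (X : MonoidAlgebra R G) :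
    counit G R (c • X) = c • counit G R X := by
  rw [← evalHom_triv _ 0 0, ← evalHom_triv _ 0 0, evalHom_smul]
  rfl

end

variable {A : Type*} [Ring A] [StarRing A] [Algebra ℂ A] [StarModule ℂ A]

theorem evalHom_conjCoeff (σ : IrrRep G) (X : MonoidAlgebra A G) :
    evalHom A σ (conjCoeff star X) = (evalHom A σ X)ᴴ :=
  evalHom_conjTranspose σ X _ fun g => coeff_conjCoeff star X g

theorem amp_evalHom_conjCoeff (π ρ : D) (V : MonoidAlgebra (MonoidAlgebra A G) G) :
    amp (evalHom A π.1) (evalHom _ ρ.1 (conjCoeff (conjCoeff star) V)) =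
      (amp (evalHom A π.1) (evalHom _ ρ.1 V))ᴴ := by
  ext ⟨i, k⟩ ⟨j, l⟩
  rw [Matrix.conjTranspose_apply, amp_apply, amp_apply, evalHom_apply _ ρ.1, evalHom_apply _ ρ.1, map_sum,
    map_sum, Matrix.sum_apply, Matrix.sum_apply, star_sum]
  refine Fintype.sum_equiv (Equiv.inv G) _ _ fun g => ?_
  rw [coeff_conjCoeff, evalHom_smul, evalHom_smul, evalHom_conjCoeff, Matrix.smul_apply,
    Matrix.smul_apply, star_smul, Equiv.inv_apply, Matrix.conjTranspose_apply,
    ← Matrix.conjTranspose_apply (ρ.1.mat g⁻¹), IrrRep.mat_conjTranspose, inv_inv]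

variable [DecidableEq G]

/-- With `w = v*` and `U' = U*` the formal inverse is the adjoint, so the purely algebraic inverse
relations yield unitarity. -/
theorem evalHom_trivializerInv (π : D) {a : A →+* MonoidAlgebra A G}
    (has : ∀ x g, (a (star x)).coeff g = star ((a x).coeff g⁻¹))
    (V : MonoidAlgebra (MonoidAlgebra A G) G) (v : Matrix Unit G A) :
    evalHom A π.1 (trivializerInv G a V v vᴴ () ()) =
      (evalHom A π.1 (trivializer G a (conjCoeff (conjCoeff star) V) v vᴴ () ()))ᴴ := by
  have h1 : ∀ x, evalHom A π.1 (a (star x)) = (evalHom A π.1 (a x))ᴴ := fun x =>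
    evalHom_conjTranspose π.1 _ _ (has x)
  have h2 : ∀ g (x : A), evalHom A π.1 (single g⁻¹ (star x)) = (evalHom A π.1 (single g x))ᴴ := by
    intro g x
    refine evalHom_conjTranspose π.1 _ _ fun h => ?_
    rw [coeff_single, coeff_single, Finsupp.single_apply, Finsupp.single_apply]
    by_cases hg : g = h⁻¹
    · simp [hg]
    · rw [if_neg hg, if_neg (fun h' => hg (by rw [← h', inv_inv])), star_zero]
  have e1 : v.map (singleOneRingHom : A →+* MonoidAlgebra A G) * fundMatrixInv G A =
      Matrix.of fun i g => singleOneRingHom (v i g) * single g⁻¹ 1 := by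
    ext1 i g
    rw [fundMatrixInv, Matrix.mul_diagonal]
    rfl
  have e2 : v.map a * convMatrix G _ V * fundMatrix G A =
      Matrix.of fun i g => (v.map a * convMatrix G _ V) i g * single g 1 := by
    ext1 i g
    rw [fundMatrix, Matrix.mul_diagonal]
    rfl
  rw [trivializer, trivializerInv, e1, e2]
  simp only [Matrix.mul_apply, Matrix.of_apply, Matrix.map_apply, map_sum, Matrix.conjTranspose_apply, map_mul,
    Finset.sum_mul, Matrix.conjTranspose_sum, Matrix.conjTranspose_mul, convMatrix_apply,
    coeff_conjCoeff, evalHom_conjCoeff, Matrix.conjTranspose_conjTranspose, h1]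
  rw [Finset.sum_comm]
  refine Finset.sum_congr rfl fun g _ => Finset.sum_congr rfl fun h _ => ?_
  have h3 : evalHom A π.1 (singleOneRingHom (star (v () h))) =
      (evalHom A π.1 (singleOneRingHom (v () h)))ᴴ := by
    have := h2 1 (v () h)
    rwa [inv_one] at this
  have h4 : evalHom A π.1 (single h 1) = (evalHom A π.1 (single h⁻¹ (1 : A)))ᴴ := by
    rw [← h2, inv_inv, star_one]
  rw [h3, h4, mul_inv_rev, inv_inv]
  simp only [Matrix.mul_assoc]

/-- The `2`-cocycle is a coboundary as soon as for every homomorphism `Φ : A → A ⊗ B(ℓ²G)` some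
`Φ(p)` is equivalent to a minimal projection of `B(ℓ²G)`. -/
theorem exists_trivializes {B : IntertwinerBasis D}
    {α : ∀ π : D, A →⋆ₐ[ℂ] Matrix (Ix π) (Ix π) A}
    {U : ∀ π ρ : D, Matrix (Ix π × Ix ρ) (Ix π × Ix ρ) A}
    (hαU : IsCocycleTwistedAction B α U)
    (hrow : ∀ Φ : A →⋆ₐ[ℂ] Matrix G G A, ∃ (p : A) (v : Matrix Unit G A),
      v * vᴴ = 1 ∧ vᴴ * v = Φ p) :
    ∃ W : ∀ π : D, Matrix (Ix π) (Ix π) A, Trivializes α U W ∧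
      ∀ π ρ : D, U π ρ = coboundary B α (fun π => (W π)ᴴ) π ρ := by
  obtain ⟨a, ha, hac, has⟩ := exists_groupAlgebraHom α
  obtain ⟨V, hV⟩ := exists_amp_evalHom_eq U
  let Φ : A →⋆ₐ[ℂ] Matrix G G A :=
    { ((convMatrix G A).comp a) with
      commutes' := fun c => by
        change convMatrix G A (a (algebraMap ℂ A c)) = _
        rw [Algebra.algebraMap_eq_smul_one, hac, map_one, Algebra.algebraMap_eq_smul_one]
        ext g h
        exact congrArg (c • ·) (congrFun (congrFun (map_one (convMatrix G A)) g) h)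
      map_star' := fun x => by
        ext g h
        change (a (star x)).coeff _ = star ((a x).coeff _)
        rw [has, mul_inv_rev, inv_inv] }
  obtain ⟨p, v, hvw, hwv⟩ := hrow Φ
  replace hwv : vᴴ * v = convMatrix G A (a p) := hwv
  set V' := conjCoeff (conjCoeff star) V with hV'
  have hVs : ∀ π ρ : D, amp (evalHom A π.1) (evalHom _ ρ.1 V') = (U π ρ)ᴴ := fun π ρ => by
    rw [hV', amp_evalHom_conjCoeff, hV]
  have hV'V : V' * V = 1 := amp_amp_evalHom_ext D fun π ρ => by
    rw [map_mul, amp_mul, hVs, hV, map_one, amp_one]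
    exact (Unitary.mem_iff.1 (hαU.unitary_mem π ρ)).1
  have hVV' : V * V' = 1 := amp_amp_evalHom_ext D fun π ρ => by
    rw [map_mul, amp_mul, hVs, hV, map_one, amp_one]
    exact (Unitary.mem_iff.1 (hαU.unitary_mem π ρ)).2
  have h2 := groupAlgebra_twisted hαU ha hac hV
  have h3 := groupAlgebra_cocycle hαU ha hac hV
  set w := trivializer G a V' v vᴴ () () with hw
  have hspec := trivializer_spec G hV'V hVV' h2 h3 hvw hwv
  rw [← hw] at hspec
  have hww' : w * trivializerInv G a V v vᴴ () () = 1 := by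
    have := congrFun (congrFun (trivializer_mul_inv G hV'V hVV' h2 hvw hwv) ()) ()
    simpa [Matrix.mul_apply] using this
  have hw'w : trivializerInv G a V v vᴴ () () * w = 1 := by
    have := congrFun (congrFun (trivializerInv_mul G hVV' h2 hvw hwv) ()) ()
    simpa [Matrix.mul_apply] using this
  have hstar : ∀ π : D, (evalHom A π.1 w)ᴴ = evalHom A π.1 (trivializerInv G a V v vᴴ () ()) :=
    fun π => (evalHom_trivializerInv π has V v).symm
  have hint : ∀ π ρ σ, ∀ T ∈ intertwiners σ π ρ,
      (evalHom A π.1 w ⊗ₖ (1 : Matrix (Ix ρ) (Ix ρ) A)) * amplify (α π) (evalHom A ρ.1 w) * U π ρ *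
        scalar A T = scalar A T * evalHom A σ.1 w := by
    intro π ρ σ T hT
    have h := congrArg (fun X => amp (evalHom A π.1) (evalHom _ ρ.1 X) * scalar A T) hspec
    rwa [map_mul, map_mul, amp_mul, amp_mul, hV, amp_evalHom_singleOne,
      evalHom_mapRingHom _ _ hac, amp_evalHom_map ha, amp_evalHom_diagHom hT] at h
  have hu1 : ∀ π : D, (evalHom A π.1 w)ᴴ * evalHom A π.1 w = 1 := fun π => by
    rw [hstar, ← map_mul, hw'w, map_one]
  have hu2 : ∀ π : D, evalHom A π.1 w * (evalHom A π.1 w)ᴴ = 1 := fun π => by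
    rw [hstar, ← map_mul, hww', map_one]
  refine ⟨fun π => evalHom A π.1 w, ⟨fun π => Unitary.mem_iff.2 ⟨hu1 π, hu2 π⟩, ?_, hint⟩, ?_⟩
  -- Evaluation at the trivial representation is the counit. The normalisations `α_𝟏 = id` and
  -- `U_{𝟏,ρ} = 1` are exactly what `trivializer_counit` needs.
  · have hε : counit G A w = 1 := by
      refine trivializer_counit G hvw (counit G A) counit_single (fun x => ?_) ?_
      · rw [← evalHom_triv _ 0 0]
        exact (congrFun (congrFun (ha D.one x) (0 : Fin 1)) (0 : Fin 1)).trans (hαU.map_one x _ _)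
      · refine evalHom_ext D fun ρ => ?_
        rw [evalHom_mapRingHom _ _ counit_smul, map_one]
        ext k l
        let i₀ : Ix D.one := (0 : Fin 1)
        have h := congrFun (congrFun (hVs D.one ρ) (i₀, k)) (i₀, l)
        rw [hαU.left_one, Matrix.conjTranspose_one] at h
        rw [Matrix.map_apply, ← evalHom_triv _ 0 0]
        refine h.trans ?_
        by_cases hkl : k = l
        · subst hkl; simp
        · rw [Matrix.one_apply_ne hkl, Matrix.one_apply_ne (fun h => hkl (Prod.ext_iff.1 h).2)]
    ext i j
    have : evalHom A (IrrRep.triv G) w i j = _ := evalHom_triv w i j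
    refine this.trans ?_
    rw [hε]
    have hij : i = j := Subsingleton.elim (α := Fin 1) i j
    rw [hij, Matrix.one_apply_eq]
  · intro π ρ
    have hA : amplify (α π) (evalHom A ρ.1 w)ᴴ * amplify (α π) (evalHom A ρ.1 w) = 1 := by
      rw [← amp_evalHom_map ha, ← amp_evalHom_map ha, ← amp_mul, ← Matrix.map_mul, hu1,
        Matrix.map_one _ (map_zero _) (map_one _), amp_one]
    have hB : ((evalHom A π.1 w)ᴴ ⊗ₖ (1 : Matrix (Ix ρ) (Ix ρ) A)) *
        (evalHom A π.1 w ⊗ₖ (1 : Matrix (Ix ρ) (Ix ρ) A)) = 1 := by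
      rw [← kronecker_one_mul, hu1]
      ext ⟨i, k⟩ ⟨j, l⟩
      by_cases hij : i = j <;> by_cases hkl : k = l <;> simp [Matrix.one_apply, hij, hkl]
    -- With the resolution of the identity inserted on the left, the two sides agree summand by
    -- summand after cancelling `W_π` and `α_π(W_ρ)` against their adjoints.
    rw [coboundary, ← Matrix.mul_one (U π ρ), ← sum_scalar_intertwiner B π ρ]
    simp only [Matrix.mul_sum, Matrix.conjTranspose_conjTranspose]
    refine Finset.sum_congr rfl fun σ _ => Finset.sum_congr rfl fun b _ => ?_
    rw [← Matrix.mul_assoc]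
    congr 1
    rw [Matrix.mul_assoc _ (scalar A _), ← hint π ρ σ _ (B.mem π ρ σ b)]
    calc U π ρ * scalar A (B.T π ρ σ b)
        = amplify (α π) (evalHom A ρ.1 w)ᴴ * (((evalHom A π.1 w)ᴴ ⊗ₖ
          (1 : Matrix (Ix ρ) (Ix ρ) A)) * (evalHom A π.1 w ⊗ₖ (1 : Matrix (Ix ρ) (Ix ρ) A))) *
          amplify (α π) (evalHom A ρ.1 w) * (U π ρ * scalar A (B.T π ρ σ b)) := by
          rw [hB, Matrix.mul_one, hA, Matrix.one_mul]
      _ = _ := by simp only [Matrix.mul_assoc]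

end Reduction

/-! ### Projections and partial isometries in von Neumann algebras -/

section VonNeumann

variable {H : Type*} [NormedAddCommGroup H] [InnerProductSpace ℂ H] [CompleteSpace H]

/-- The projection onto the closure of a subspace. -/
noncomputable def closureProj (K : Submodule ℂ H) : H →L[ℂ] H :=
  K.topologicalClosure.starProjection

theorem isStarProjection_closureProj (K : Submodule ℂ H) : IsStarProjection (closureProj K) :=
  isStarProjection_starProjection

theorem closureProj_apply_of_mem {K : Submodule ℂ H} {ξ : H} (h : ξ ∈ K) :
    closureProj K ξ = ξ :=
  Submodule.starProjection_eq_self_iff.2 (K.le_topologicalClosure h)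

/-- An operator vanishing on a subspace vanishes on its closure. -/
theorem mul_closureProj_eq_zero {K : Submodule ℂ H} {y : H →L[ℂ] H} (h : ∀ ξ ∈ K, y ξ = 0) :
    y * closureProj K = 0 := by
  have hle : K.topologicalClosure ≤ LinearMap.ker y.toLinearMap :=
    K.topologicalClosure_minimal (fun ξ hξ => h ξ hξ) y.isClosed_ker
  ext ξ
  exact hle (Submodule.starProjection_apply_mem _ ξ)

/-- Invariance under the commutant passes to the closure by continuity, and a projection belongs to
`N` exactly when its range is invariant under the commutant. -/
theorem closureProj_mem (N : VonNeumannAlgebra H) {K : Submodule ℂ H}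
    (hK : ∀ y ∈ N.commutant, ∀ ξ ∈ K, y ξ ∈ K) : closureProj K ∈ N := by
  rw [VonNeumannAlgebra.IsStarProjection.mem_iff (isStarProjection_closureProj K)]
  intro y hy
  have hr : (closureProj K).range = K.topologicalClosure := Submodule.range_starProjection _
  rw [hr, Module.End.mem_invtSubmodule]
  have hle : K.topologicalClosure ≤ K.topologicalClosure.comap y.toLinearMap :=
    K.topologicalClosure_minimal (fun ξ hξ => K.le_topologicalClosure (hK y hy ξ hξ))
      (K.isClosed_topologicalClosure.preimage y.continuous)
  exact hle

/-- In a factor, `a M b = 0` implies `a = 0` or `b = 0`. -/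
theorem eq_zero_or_eq_zero_of_factor (M : VonNeumannAlgebra H)
    (hM : ∀ x ∈ M, (∀ y ∈ M, y * x = x * y) → ∃ c : ℂ, x = c • 1)
    {a b : H →L[ℂ] H} (hb : b ∈ M) (h : ∀ x ∈ M, a * x * b = 0) : a = 0 ∨ b = 0 := by
  by_cases hb0 : b = 0
  · exact Or.inr hb0
  left
  -- The projection onto the closure of `M b H` is the central support of `b`: it lies in `M` and in
  -- its commutant, so it is a scalar, and it fixes `b ≠ 0`, so it is `1`. Since `a` vanishes on `M
  -- b H`, it vanishes.
  let K : Submodule ℂ H := Submodule.span ℂ {ξ | ∃ x ∈ M, ∃ η, ξ = x (b η)}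
  have hK : ∀ y : H →L[ℂ] H, (∀ x ∈ M, ∀ η, y (x (b η)) ∈ K) → ∀ ξ ∈ K, y ξ ∈ K := by
    intro y hy ξ hξ
    have : K ≤ K.comap y.toLinearMap := by
      rw [Submodule.span_le]
      rintro _ ⟨x, hx, η, rfl⟩
      exact hy x hx η
    exact this hξ
  have hzM : closureProj K ∈ M := by
    refine closureProj_mem M fun y hy => hK y fun x hx η => Submodule.subset_span ⟨x, hx, y η, ?_⟩
    rw [VonNeumannAlgebra.mem_commutant_iff] at hy
    have h1 : y * x = x * y := (hy x hx).symm
    have h2 : y * b = b * y := (hy b hb).symm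
    calc y (x (b η)) = (y * x) (b η) := rfl
      _ = x ((y * b) η) := by rw [h1]; rfl
      _ = x (b (y η)) := by rw [h2]; rfl
  have hzM' : closureProj K ∈ M.commutant := by
    refine closureProj_mem _ fun y hy => hK y fun x hx η => Submodule.subset_span ⟨y * x, ?_, η, rfl⟩
    rw [VonNeumannAlgebra.commutant_commutant] at hy
    exact mul_mem hy hx
  obtain ⟨c, hc⟩ := hM _ hzM (VonNeumannAlgebra.mem_commutant_iff.1 hzM')
  have hzb : closureProj K * b = b := by
    ext η
    exact closureProj_apply_of_mem (Submodule.subset_span ⟨1, one_mem M, η, rfl⟩)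
  have hc1 : c = 1 := by
    rw [hc, smul_mul_assoc, one_mul] at hzb
    have : (c - 1) • b = 0 := by rw [sub_smul, hzb, one_smul, sub_self]
    rcases smul_eq_zero.1 this with h | h
    · exact sub_eq_zero.1 h
    · exact absurd h hb0
  have haz : a * closureProj K = 0 := by
    apply mul_closureProj_eq_zero
    intro ξ hξ
    have : K ≤ LinearMap.ker a.toLinearMap := by
      rw [Submodule.span_le]
      rintro _ ⟨x, hx, η, rfl⟩
      exact congrArg (fun z : H →L[ℂ] H => z η) (h x hx)
    exact this hξ
  rwa [hc, hc1, one_smul, mul_one] at haz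

/-- Whatever commutes with `h` commutes with `f(h)`, so the bicommutant theorem applies. -/
theorem cfc_mem (N : VonNeumannAlgebra H) {h : H →L[ℂ] H} (hN : h ∈ N) (f : ℝ → ℝ) :
    cfc f h ∈ N := by
  rw [← VonNeumannAlgebra.commutant_commutant N, VonNeumannAlgebra.mem_commutant_iff]
  intro y hy
  have hc : Commute h y := (VonNeumannAlgebra.mem_commutant_iff.1 hy) h hN
  exact (hc.cfc_real f).symm

/-- A self-adjoint operator is `a² - b²` with `a`, `b` self-adjoint and `a b = 0`. -/
theorem exists_sq_sub_sq (N : VonNeumannAlgebra H) {k : H →L[ℂ] H} (hN : k ∈ N)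
    (hk : IsSelfAdjoint k) : ∃ a ∈ N, ∃ b ∈ N, IsSelfAdjoint a ∧ IsSelfAdjoint b ∧
      k = a * a - b * b ∧ a * b = 0 := by
  refine ⟨cfc (fun t : ℝ => Real.sqrt t) k, cfc_mem N hN _, cfc (fun t : ℝ => Real.sqrt (-t)) k,
    cfc_mem N hN _, cfc_predicate _ _, cfc_predicate _ _, ?_, ?_⟩
  · rw [← cfc_mul _ _ k, ← cfc_mul _ _ k, ← cfc_sub _ _ k]
    conv_lhs => rw [← cfc_id ℝ k]
    congr 1
    funext t
    rcases le_total 0 t with ht | ht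
    · rw [Real.mul_self_sqrt ht, Real.sqrt_eq_zero_of_nonpos (by linarith)]; simp
    · rw [Real.sqrt_eq_zero_of_nonpos ht, Real.mul_self_sqrt (by linarith)]; simp
  · rw [← cfc_mul _ _ k, ← cfc_const_zero ℝ k]
    congr 1
    funext t
    rcases le_total 0 t with ht | ht
    · rw [Real.sqrt_eq_zero_of_nonpos (show -t ≤ 0 by linarith), mul_zero]
    · rw [Real.sqrt_eq_zero_of_nonpos ht, zero_mul]

/-- Every nonzero element dominates a nonzero partial isometry. -/
theorem exists_partialIsometry (N : VonNeumannAlgebra H) {x : H →L[ℂ] H} (hx : x ∈ N)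
    (hx0 : x ≠ 0) : ∃ u ∈ N, u ≠ 0 ∧ IsStarProjection (star u * u) ∧
      (∀ b, x * b = 0 → u * b = 0) ∧ ∀ b, b * x = 0 → b * u = 0 := by
  set h := star x * x with hh
  have hsa : IsSelfAdjoint h := IsSelfAdjoint.star_mul_self x
  have hN : h ∈ N := mul_mem (star_mem hx) hx
  have hh0 : 0 < ‖h‖ := by
    rw [hh, CStarRing.norm_star_mul_self]
    exact mul_pos (norm_pos_iff.2 hx0) (norm_pos_iff.2 hx0)
  -- A cut-off strictly between `0` and `‖h‖`: above `δ` the function `t ↦ t^(-1/2)` is bounded, and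
  -- the spectral part above `δ` is not zero.
  set δ := ‖h‖ / 2 with hδ
  have hδ0 : 0 < δ := by positivity
  have hmax : ∀ t : ℝ, 0 < max t δ := fun t => lt_max_of_lt_right hδ0
  -- `φ` is chosen so that `h φ(h) = (h - δ)₊`; the factor `h = x* x` shows that whatever `x` kills
  -- from the right is killed by `g`. `κ` is a continuous extension of `t^(-1/2)` from `[δ, ∞)`, so
  -- `κ(h) h κ(h)` acts as `1` on the range of `g`. With `q` the range projection of `g`, the
  -- element `x κ(h) q` is a polar part of `x` cut down to `q`.
  let φ : ℝ → ℝ := fun t => max (t - δ) 0 / max t δ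
  let κ : ℝ → ℝ := fun t => (Real.sqrt (max t δ))⁻¹
  have hφc : Continuous φ := by
    refine Continuous.div (by fun_prop) (by fun_prop) fun t => (hmax t).ne'
  have hκc : Continuous κ := by
    refine Continuous.inv₀ (by fun_prop) fun t => (Real.sqrt_pos.2 (hmax t)).ne'
  set g := h * cfc φ h with hg
  have hgc : g = cfc (fun t : ℝ => max (t - δ) 0) h := by
    have : g = cfc (fun t : ℝ => t) h * cfc φ h := by rw [cfc_id' ℝ h]
    rw [this, ← cfc_mul (fun t : ℝ => t) φ h (by fun_prop) hφc.continuousOn]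
    congr 1
    funext t
    simp only [φ]
    rcases le_total t δ with ht | ht
    · rw [max_eq_right (by linarith)]; simp
    · rw [max_eq_left ht, mul_div_cancel₀]
      linarith
  set k := cfc κ h with hk
  have hksa : IsSelfAdjoint k := cfc_predicate _ _
  have hkhk : k * h * k * g = g := by
    have : k * h * k * g = cfc κ h * cfc (fun t : ℝ => t) h * cfc κ h *
        cfc (fun t : ℝ => max (t - δ) 0) h := by rw [cfc_id' ℝ h, ← hgc]
    have hc2 : Continuous fun t => κ t * t := hκc.mul continuous_id
    rw [this, hgc, ← cfc_mul κ (fun t => t) h hκc.continuousOn (by fun_prop),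
      ← cfc_mul (fun t => κ t * t) κ h hc2.continuousOn hκc.continuousOn,
      ← cfc_mul (fun t => κ t * t * κ t) _ h (hc2.mul hκc).continuousOn (by fun_prop)]
    congr 1
    funext t
    rcases le_total t δ with ht | ht
    · rw [max_eq_right (a := t - δ) (by linarith), mul_zero]
    · have hs : κ t * κ t = t⁻¹ := by
        simp only [κ]
        rw [max_eq_left ht, ← mul_inv, Real.mul_self_sqrt (by linarith)]
      have ht0 : t ≠ 0 := by linarith
      rw [show κ t * t * κ t = (κ t * κ t) * t by ring, hs, inv_mul_cancel₀ ht0, one_mul]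
  have hg0 : g ≠ 0 := by
    intro h0
    -- If `(h - δ)₊ = 0`, then the spectrum of `h` lies in `[0, δ]`.
    have hle : ‖h‖ ≤ δ := by
      rw [← cfc_id' ℝ h]
      refine norm_cfc_le hδ0.le fun t ht => ?_
      have ht0 : 0 ≤ t := spectrum_star_mul_self_nonneg t ht
      rw [Real.norm_of_nonneg ht0]
      rw [hgc, ← cfc_const_zero ℝ h] at h0
      have := (cfc_eq_cfc_iff_eqOn).1 h0 ht
      have := le_max_left (t - δ) 0
      linarith
    linarith
  let K : Submodule ℂ H := LinearMap.range g.toLinearMap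
  set q := closureProj K with hq
  have hqp : IsStarProjection q := isStarProjection_closureProj K
  have hqg : q * g = g := by
    ext ξ
    exact closureProj_apply_of_mem ⟨ξ, rfl⟩
  have hyq : ∀ y : H →L[ℂ] H, y * g = 0 → y * q = 0 := by
    intro y hy
    apply mul_closureProj_eq_zero
    rintro _ ⟨ξ, rfl⟩
    exact congrArg (fun z : H →L[ℂ] H => z ξ) hy
  have hgN : g ∈ N := mul_mem hN (cfc_mem N hN _)
  have hqN : q ∈ N := by
    refine closureProj_mem N ?_
    rintro y hy _ ⟨ξ, rfl⟩
    refine ⟨y ξ, ?_⟩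
    have := (VonNeumannAlgebra.mem_commutant_iff.1 hy) g hgN
    exact congrArg (fun z : H →L[ℂ] H => z ξ) this
  have hkq : k * h * k * q = q := by
    have := hyq (k * h * k - 1) (by rw [sub_mul, hkhk, one_mul, sub_self])
    rwa [sub_mul, one_mul, sub_eq_zero] at this
  have hstar : star (x * k * q) * (x * k * q) = q := by
    rw [star_mul, star_mul, hksa.star_eq, hqp.isSelfAdjoint.star_eq]
    calc q * (k * star x) * (x * k * q) = q * (k * h * k * q) := by
          rw [hh]; simp only [mul_assoc]
      _ = q := by rw [hkq, hqp.isIdempotentElem.eq]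
  refine ⟨x * k * q, mul_mem (mul_mem hx (cfc_mem N hN _)) hqN, ?_, ?_, ?_, ?_⟩
  · intro h0
    rw [h0, mul_zero] at hstar
    rw [← hstar, zero_mul] at hqg
    exact hg0 hqg.symm
  · rw [hstar]; exact hqp
  · intro b hb
    have h1 : star b * q = 0 := hyq _ (by
      rw [hg, hh, ← mul_assoc, ← mul_assoc, ← star_mul, hb, star_zero, zero_mul, zero_mul])
    have h2 : q * b = 0 := by
      have := congrArg star h1
      rwa [star_mul, star_star, hqp.isSelfAdjoint.star_eq, star_zero] at this
    rw [mul_assoc, h2, mul_zero]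
  · intro b hb
    rw [← mul_assoc, ← mul_assoc, hb, zero_mul, zero_mul]

end VonNeumann

/-! ### Systems of partial isometries with a common initial projection -/

/-- Partial isometries `x i = e (x i) f` with common initial projection `p` and pairwise orthogonal
final projections. -/
structure IsSystem {A ι : Type*} [Ring A] [StarRing A] [DecidableEq ι] (e f : A) (x : ι → A)
    (p : A) : Prop where
  proj : IsStarProjection p
  star_mul : ∀ i j, star (x i) * x j = if i = j then p else 0
  left : ∀ i, e * x i = x i
  right : ∀ i, x i * f = x i

section Maximal

open Filter Topology

variable {H : Type*} [NormedAddCommGroup H] [InnerProductSpace ℂ H] [CompleteSpace H]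

theorem eq_zero_of_star_mul_self {y : H →L[ℂ] H} (h : star y * y = 0) : y = 0 :=
  CStarRing.star_mul_self_eq_zero_iff y |>.1 h

theorem mul_eq_self_of_star_mul {x p : H →L[ℂ] H} (hp : IsStarProjection p)
    (h : star x * x = p) : x * p = x := by
  have h1 : star (x * p - x) * (x * p - x) = 0 := by
    rw [star_sub, star_mul, hp.isSelfAdjoint.star_eq]
    calc (p * star x - star x) * (x * p - x)
        = p * (star x * x) * p - p * (star x * x) - (star x * x) * p + star x * x := by
          noncomm_ring
      _ = 0 := by rw [h]; simp [hp.isIdempotentElem.eq]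
  exact sub_eq_zero.1 (eq_zero_of_star_mul_self h1)

theorem norm_le_one_of_isStarProjection {x p : H →L[ℂ] H} (hp : IsStarProjection p)
    (h : star x * x = p) : ‖x‖ ≤ 1 := by
  have h1 : ‖p‖ ≤ 1 := by
    by_contra! hlt
    have h2 : ‖p‖ = ‖p‖ * ‖p‖ := by
      have := CStarRing.norm_star_mul_self (x := p)
      rwa [hp.isSelfAdjoint.star_eq, hp.isIdempotentElem.eq] at this
    nlinarith
  have h2 := CStarRing.norm_star_mul_self (x := x)
  rw [h] at h2
  nlinarith [norm_nonneg x]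

theorem inner_apply_apply (x y : H →L[ℂ] H) (ξ η : H) :
    inner ℂ (x ξ) (y η) = inner ℂ ξ ((star x * y) η) := by
  rw [ContinuousLinearMap.star_eq_adjoint, mul_apply_eq_comp,
    ContinuousLinearMap.adjoint_inner_right]

/-- An increasing net of partial isometries converges strongly. -/
theorem exists_tendsto_of_increasing {c : Type*} [Preorder c] [IsDirectedOrder c] [Nonempty c]
    (x p : c → H →L[ℂ] H) (hp : ∀ a, IsStarProjection (p a)) (hx : ∀ a, star (x a) * x a = p a)
    (hpp : ∀ a b, a ≤ b → p b * p a = p a) (hxp : ∀ a b, a ≤ b → x b * p a = x a) (ξ : H) :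
    ∃ η, Tendsto (fun a => x a ξ) atTop (𝓝 η) := by
  -- Pythagoras: the increment is orthogonal to `x a ξ`. The squared norms are therefore increasing
  -- and bounded, and convergence of the numbers gives the Cauchy property of the vectors.
  have hsq : ∀ a b, a ≤ b → ‖x b ξ - x a ξ‖ ^ 2 = ‖x b ξ‖ ^ 2 - ‖x a ξ‖ ^ 2 := by
    intro a b hab
    have h1 : inner ℂ (x b ξ) (x a ξ) = inner ℂ (x a ξ) (x a ξ) := by
      rw [inner_apply_apply, inner_apply_apply, hx, ← hxp a b hab, ← mul_assoc, hx, hpp a b hab]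
    have h2 := norm_sub_sq (𝕜 := ℂ) (x b ξ) (x a ξ)
    rw [h1, inner_self_eq_norm_sq] at h2
    rw [h2]; ring
  have hmono : ∀ a b, a ≤ b → ‖x a ξ‖ ^ 2 ≤ ‖x b ξ‖ ^ 2 := by
    intro a b hab
    have := hsq a b hab
    nlinarith [sq_nonneg ‖x b ξ - x a ξ‖]
  have hbdd : BddAbove (Set.range fun a => ‖x a ξ‖ ^ 2) := by
    refine ⟨‖ξ‖ ^ 2, ?_⟩
    rintro _ ⟨a, rfl⟩
    have h1 := norm_le_one_of_isStarProjection (hp a) (hx a)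
    have h2 := (x a).le_of_opNorm_le h1 ξ
    rw [one_mul] at h2
    exact pow_le_pow_left₀ (norm_nonneg _) h2 2
  have hc : CauchySeq fun a => x a ξ := by
    refine Metric.cauchy_iff.2 ⟨inferInstance, fun ε hε => ?_⟩
    obtain ⟨a, ha⟩ := exists_lt_of_lt_ciSup (f := fun a => ‖x a ξ‖ ^ 2)
      (show (⨆ a, ‖x a ξ‖ ^ 2) - (ε / 2) ^ 2 < ⨆ a, ‖x a ξ‖ ^ 2 by
        have : 0 < (ε / 2) ^ 2 := by positivity
        linarith)
    have hclose : ∀ b, a ≤ b → dist (x b ξ) (x a ξ) < ε / 2 := by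
      intro b hab
      have h1 := hsq a b hab
      have h2 : ‖x b ξ‖ ^ 2 ≤ ⨆ a, ‖x a ξ‖ ^ 2 := le_ciSup hbdd b
      rw [dist_eq_norm]
      refine lt_of_pow_lt_pow_left₀ 2 (by positivity) ?_
      linarith
    refine ⟨(fun a => x a ξ) '' Set.Ici a, Filter.image_mem_map (Filter.mem_atTop a), ?_⟩
    rintro _ ⟨b, hb, rfl⟩ _ ⟨b', hb', rfl⟩
    calc dist (x b ξ) (x b' ξ) ≤ dist (x b ξ) (x a ξ) + dist (x b' ξ) (x a ξ) :=
          dist_triangle_right _ _ _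
      _ < ε := by linarith [hclose b hb, hclose b' hb']
  exact cauchySeq_tendsto_of_complete hc

/-- The strong limit of an increasing net of systems of partial isometries. -/
theorem exists_limit_system (N : VonNeumannAlgebra H) {ι : Type*} [DecidableEq ι] [Nonempty ι]
    {c : Type*} [Preorder c] [IsDirectedOrder c] [Nonempty c] {e f : H →L[ℂ] H}
    (x : c → ι → H →L[ℂ] H) (p : c → H →L[ℂ] H) (hN : ∀ a i, x a i ∈ N)
    (hx : ∀ a, IsSystem e f (x a) (p a))
    (hpp : ∀ a b, a ≤ b → p b * p a = p a) (hxp : ∀ a b, a ≤ b → ∀ i, x b i * p a = x a i) :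
    ∃ (z : ι → H →L[ℂ] H) (P : H →L[ℂ] H), (∀ i, z i ∈ N) ∧ IsSystem e f z P ∧
      ∀ a, P * p a = p a ∧ ∀ i, z i * p a = x a i := by
  have hxx : ∀ a i, star (x a i) * x a i = p a := fun a i => by
    rw [(hx a).star_mul, if_pos rfl]
  have hlim : ∀ i ξ, ∃ η, Tendsto (fun a => x a i ξ) atTop (𝓝 η) := fun i ξ =>
    exists_tendsto_of_increasing (fun a => x a i) p (fun a => (hx a).proj) (fun a => hxx a i) hpp
      (fun a b hab => hxp a b hab i) ξ
  choose F hF using hlim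
  have hbdd : ∀ i, Bornology.IsBounded (Set.range fun a => x a i) := fun i =>
    isBounded_iff_forall_norm_le.2 ⟨1, by
      rintro _ ⟨a, rfl⟩
      exact norm_le_one_of_isStarProjection (hx a).proj (hxx a i)⟩
  let z : ι → H →L[ℂ] H := fun i => ContinuousLinearMap.ofTendstoOfBoundedRange (F i)
    (fun a => x a i) (tendsto_pi_nhds.2 (hF i)) (hbdd i)
  have hz : ∀ i ξ, Tendsto (fun a => x a i ξ) atTop (𝓝 (z i ξ)) := hF
  obtain ⟨i₀⟩ := ‹Nonempty ι›
  -- Multiplication of operators is not continuous along the net, but inner products of vectors are;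
  -- `hzz` uses this to show that `P` does not depend on `i₀`.
  set P := star (z i₀) * z i₀ with hP
  have hext : ∀ y y' : H →L[ℂ] H, (∀ ξ η, inner ℂ ξ (y η) = inner ℂ ξ (y' η)) → y = y' :=
    fun y y' h => ContinuousLinearMap.ext fun η => ext_inner_left ℂ fun ξ => h ξ η
  have hzz : ∀ i j, star (z i) * z j = if i = j then P else 0 := by
    intro i j
    refine hext _ _ fun ξ η => ?_
    rw [← inner_apply_apply]
    have h1 : Tendsto (fun a => inner ℂ (x a i ξ) (x a j η)) atTop
      (𝓝 (inner ℂ (z i ξ) (z j η))) := (hz i ξ).inner (hz j η)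
    split_ifs with hij
    · subst hij
      have h2 : Tendsto (fun a => inner ℂ (x a i₀ ξ) (x a i₀ η)) atTop
        (𝓝 (inner ℂ (z i₀ ξ) (z i₀ η))) := (hz i₀ ξ).inner (hz i₀ η)
      rw [hP, ← inner_apply_apply]
      refine tendsto_nhds_unique h1 (h2.congr fun a => ?_)
      rw [inner_apply_apply, inner_apply_apply, hxx, hxx]
    · refine tendsto_nhds_unique h1 (tendsto_const_nhds.congr fun a => ?_)
      rw [inner_apply_apply, (hx a).star_mul, if_neg hij]
  have hev : ∀ a i, z i * p a = x a i := by
    intro a i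
    ext ξ
    refine tendsto_nhds_unique (hz i (p a ξ)) (tendsto_const_nhds.congr' ?_)
    filter_upwards [Filter.mem_atTop a] with b hb
    exact (congrArg (fun y : H →L[ℂ] H => y ξ) (hxp a b hb i)).symm
  have hPp : ∀ a, P * p a = p a := by
    intro a
    rw [hP, mul_assoc, hev]
    refine hext _ _ fun ξ η => ?_
    rw [← inner_apply_apply]
    refine tendsto_nhds_unique ((hz i₀ ξ).inner tendsto_const_nhds) (tendsto_const_nhds.congr' ?_)
    filter_upwards [Filter.mem_atTop a] with b hb
    rw [inner_apply_apply, ← hxp a b hb, ← mul_assoc, hxx, hpp a b hb]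
  have hPs : star P = P := by rw [hP, star_mul, star_star]
  have hpP : ∀ a, p a * P = p a := by
    intro a
    have := congrArg star (hPp a)
    rwa [star_mul, hPs, (hx a).proj.isSelfAdjoint.star_eq] at this
  have hzP : ∀ i, z i * P = z i := by
    intro i
    ext ξ
    refine tendsto_nhds_unique (hz i (P ξ)) ((hz i ξ).congr fun a => ?_)
    have h1 : x a i * P = x a i := by
      rw [← mul_eq_self_of_star_mul (hx a).proj (hxx a i), mul_assoc, hpP]
    exact (congrArg (fun y : H →L[ℂ] H => y ξ) h1).symm
  refine ⟨z, P, fun i => ?_, ⟨⟨?_, hPs⟩, hzz, fun i => ?_, fun i => ?_⟩,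
    fun a => ⟨hPp a, hev a⟩⟩
  · rw [← VonNeumannAlgebra.commutant_commutant N, VonNeumannAlgebra.mem_commutant_iff]
    intro y hy
    ext ξ
    refine tendsto_nhds_unique ((y.continuous.tendsto _).comp (hz i ξ))
      ((hz i (y ξ)).congr fun a => ?_)
    have := (VonNeumannAlgebra.mem_commutant_iff.1 hy) _ (hN a i)
    exact congrArg (fun w : H →L[ℂ] H => w ξ) this
  · change P * P = P
    nth_rw 1 [hP]
    rw [mul_assoc, hzP]
  · ext ξ
    refine tendsto_nhds_unique ((e.continuous.tendsto _).comp (hz i ξ))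
      ((hz i ξ).congr fun a => ?_)
    exact (congrArg (fun w : H →L[ℂ] H => w ξ) ((hx a).left i)).symm
  · ext ξ
    refine tendsto_nhds_unique (hz i (f ξ)) ((hz i ξ).congr fun a => ?_)
    exact (congrArg (fun w : H →L[ℂ] H => w ξ) ((hx a).right i)).symm

/-- Zorn's lemma for a relation with upper bounds for directed families. -/
theorem exists_maximal_of_directed_bounded {S : Type*} (r : S → S → Prop) (hrefl : ∀ a, r a a)
    (htrans : ∀ a b c, r a b → r b c → r a c) (s₀ : S)
    (h : ∀ (c : Set S) [Preorder c] [IsDirectedOrder c] [Nonempty c] (φ : c → S),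
      (∀ a b, a ≤ b → r (φ a) (φ b)) → ∃ z, ∀ a, r (φ a) z) : ∃ m, ∀ a, r m a → r a m := by
  refine exists_maximal_of_chains_bounded (fun c hc => ?_) fun {a b c} => htrans a b c
  by_cases hne : c.Nonempty
  · let _ : Preorder c :=
      { le := fun a b => r a b
        le_refl := fun a => hrefl a
        le_trans := fun a b d => htrans a b d }
    have : Nonempty c := hne.to_subtype
    have : IsDirectedOrder c := ⟨fun a b => by
      by_cases hab : a = b
      · exact ⟨a, hrefl a, hab ▸ hrefl a⟩
      · rcases hc a.2 b.2 (fun h => hab (Subtype.ext h)) with h | h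
        · exact ⟨b, h, hrefl b⟩
        · exact ⟨a, hrefl a, h⟩⟩
    obtain ⟨z, hz⟩ := h c (fun a => a.1) fun a b hab => hab
    exact ⟨z, fun a ha => hz ⟨a, ha⟩⟩
  · exact ⟨s₀, fun a ha => absurd ⟨a, ha⟩ hne⟩

/-- Zorn's lemma for systems of partial isometries. -/
theorem exists_maximal_system (N : VonNeumannAlgebra H) (ι : Type*) [DecidableEq ι] [Nonempty ι]
    (e f : H →L[ℂ] H) :
    ∃ (x : ι → H →L[ℂ] H) (p : H →L[ℂ] H), (∀ i, x i ∈ N) ∧ IsSystem e f x p ∧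
      ∀ (u : ι → H →L[ℂ] H) (q : H →L[ℂ] H), (∀ i, u i ∈ N) → IsSystem e f u q →
        (∀ i j, star (x i) * u j = 0) → p * q = 0 → q = 0 := by
  let S := {xp : (ι → H →L[ℂ] H) × (H →L[ℂ] H) // (∀ i, xp.1 i ∈ N) ∧ IsSystem e f xp.1 xp.2}
  -- `b` extends `a`: the initial projection grows and the partial isometries agree on the smaller
  -- one.
  let r : S → S → Prop := fun a b => b.1.2 * a.1.2 = a.1.2 ∧ ∀ i, b.1.1 i * a.1.2 = a.1.1 i
  have hrefl : ∀ a, r a a := fun a =>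
    ⟨a.2.2.proj.isIdempotentElem.eq, fun i => mul_eq_self_of_star_mul a.2.2.proj (by
      rw [a.2.2.star_mul, if_pos rfl])⟩
  have htrans : ∀ a b c, r a b → r b c → r a c := by
    rintro a b c ⟨h1, h2⟩ ⟨h3, h4⟩
    refine ⟨?_, fun i => ?_⟩
    · rw [← h1, ← mul_assoc, h3]
    · rw [← h1, ← mul_assoc, h4, h2]
  obtain ⟨m, hm⟩ := exists_maximal_of_directed_bounded r hrefl htrans
    ⟨(0, 0), fun i => zero_mem N, ⟨.zero _, fun i j => by simp, fun i => by simp, fun i => by simp⟩⟩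
    fun c _ _ _ φ hφ => by
      obtain ⟨z, P, hz1, hz2, hz3⟩ := exists_limit_system N (e := e) (f := f)
        (fun a => (φ a).1.1) (fun a => (φ a).1.2) (fun a => (φ a).2.1) (fun a => (φ a).2.2)
        (fun a b hab => (hφ a b hab).1) (fun a b hab => (hφ a b hab).2)
      exact ⟨⟨(z, P), hz1, hz2⟩, hz3⟩
  obtain ⟨⟨x, p⟩, hxN, hx⟩ := m
  refine ⟨x, p, hxN, hx, fun u q huN hu hxu hpq => ?_⟩
  simp only at hx hxN
  have hqp : q * p = 0 := by
    have := congrArg star hpq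
    rwa [star_mul, hx.proj.isSelfAdjoint.star_eq, hu.proj.isSelfAdjoint.star_eq,
      star_zero] at this
  have hux : ∀ i j, star (u i) * x j = 0 := fun i j => by
    have := congrArg star (hxu j i)
    rwa [star_mul, star_star, star_zero] at this
  have huq : ∀ i, u i * q = u i := fun i => mul_eq_self_of_star_mul hu.proj (by
    rw [hu.star_mul, if_pos rfl])
  have hxp : ∀ i, x i * p = x i := fun i => mul_eq_self_of_star_mul hx.proj (by
    rw [hx.star_mul, if_pos rfl])
  -- An orthogonal system can be added, and the sum extends `x`; maximality then forces `p + q ≤ p`.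
  have hs : IsSystem e f (fun i => x i + u i) (p + q) := by
    refine ⟨hx.proj.add hu.proj hpq, fun i j => ?_, fun i => ?_, fun i => ?_⟩
    · rw [star_add, add_mul, mul_add, mul_add, hx.star_mul, hu.star_mul, hxu, hux]
      split_ifs <;> simp
    · rw [mul_add, hx.left, hu.left]
    · rw [add_mul, hx.right, hu.right]
  have h1 := hm ⟨(fun i => x i + u i, p + q), fun i => add_mem (hxN i) (huN i), hs⟩ ⟨by
    change (p + q) * p = p
    rw [add_mul, hqp, hx.proj.isIdempotentElem.eq, add_zero], fun i => by
    change (x i + u i) * p = x i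
    rw [add_mul, hxp, ← huq, mul_assoc, hqp, mul_zero, add_zero]⟩
  have h2 : p * (p + q) = p + q := h1.1
  rw [mul_add, hx.proj.isIdempotentElem.eq, hpq, add_zero] at h2
  simpa using h2

end Maximal

/-! ### Comparison and division of projections by means of a trace -/

/-- The properties of factors on which the comparison theory of projections rests. -/
structure HasComparison (A : Type*) [Ring A] [StarRing A] : Prop where
  exists_partialIsometry : ∀ x : A, x ≠ 0 → ∃ u : A, u ≠ 0 ∧ IsStarProjection (star u * u) ∧
    (∀ b, x * b = 0 → u * b = 0) ∧ ∀ b, b * x = 0 → b * u = 0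
  exists_maximal : ∀ (n : ℕ) [NeZero n] (e f : A), ∃ (x : Fin n → A) (p : A), IsSystem e f x p ∧
    ∀ (u : Fin n → A) (q : A), IsSystem e f u q → (∀ i j, star (x i) * u j = 0) → p * q = 0 → q = 0
  prime : ∀ a b : A, (∀ x, a * x * b = 0) → a = 0 ∨ b = 0
  exists_sq_sub_sq : ∀ k : A, IsSelfAdjoint k → ∃ a b : A, IsSelfAdjoint a ∧ IsSelfAdjoint b ∧
    k = a * a - b * b ∧ a * b = 0

/-- A faithful positive trace. -/
structure IsFaithfulTrace {A : Type*} [Ring A] [StarRing A] [Algebra ℂ A] (τ : A →ₗ[ℂ] ℂ) :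
    Prop where
  nonneg : ∀ x, 0 ≤ τ (star x * x)
  faithful : ∀ x, τ (star x * x) = 0 → x = 0
  mul_comm : ∀ x y, τ (x * y) = τ (y * x)

section Comparison

variable {A : Type*} [Ring A] [StarRing A]

theorem star_sum_mul_star {ι : Type*} [Fintype ι] (x : ι → A) : star (∑ j, x j * star (x j)) = ∑ j, x j * star (x j) := by
  rw [star_sum]
  exact Finset.sum_congr rfl fun j _ => by rw [star_mul, star_star]

/-- A nonzero partial isometry between two nonzero projections. -/
theorem HasComparison.exists_between (hA : HasComparison A) {e f : A} (he : e ≠ 0) (hf : f ≠ 0)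
    (hee : e * e = e) (hff : f * f = f) :
    ∃ u : A, u ≠ 0 ∧ IsStarProjection (star u * u) ∧ e * u = u ∧ u * f = u := by
  have h1 : ∃ y, e * y * f ≠ 0 := by
    by_contra! h
    rcases hA.prime e f h with h | h
    · exact he h
    · exact hf h
  obtain ⟨y, hy⟩ := h1
  obtain ⟨u, hu0, hu, hr, hl⟩ := hA.exists_partialIsometry _ hy
  refine ⟨u, hu0, hu, ?_, ?_⟩
  · have := hl (1 - e) (by rw [sub_mul, one_mul, ← mul_assoc, ← mul_assoc, hee, sub_self])
    rw [sub_mul, one_mul, sub_eq_zero] at this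
    exact this.symm
  · have := hr (1 - f) (by rw [mul_sub, mul_one, mul_assoc _ f f, hff, sub_self])
    rw [mul_sub, mul_one, sub_eq_zero] at this
    exact this.symm

/-- Orthogonal nonzero subprojections of a projection. -/
theorem exists_orthogonal (hsplit : ∀ r : A, IsStarProjection r → r ≠ 0 →
      ∃ s, IsStarProjection s ∧ r * s = s ∧ s ≠ 0 ∧ s ≠ r) :
    ∀ (k : ℕ) (r : A), IsStarProjection r → r ≠ 0 → ∃ t : Fin k → A,
      (∀ i, IsStarProjection (t i)) ∧ (∀ i, t i ≠ 0) ∧ (∀ i, r * t i = t i) ∧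
      ∀ i j, i ≠ j → t i * t j = 0
  | 0, r, _, _ => ⟨fun i => i.elim0, fun i => i.elim0, fun i => i.elim0, fun i => i.elim0,
      fun i => i.elim0⟩
  | k + 1, r, hr, hr0 => by
    obtain ⟨s, hs, hrs, hs0, hsr⟩ := hsplit r hr hr0
    have hsr' : s * r = s := by
      have := congrArg star hrs
      rwa [star_mul, hs.isSelfAdjoint.star_eq, hr.isSelfAdjoint.star_eq] at this
    obtain ⟨t, ht, ht0, hrt, htt⟩ := exists_orthogonal hsplit k (r - s)
      (hs.sub_of_mul_eq_right hr hrs) (fun h => hsr (sub_eq_zero.1 h).symm)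
    have hst : ∀ i, s * t i = 0 := fun i => by
      rw [← hrt, ← mul_assoc, mul_sub, hsr', hs.isIdempotentElem.eq, sub_self, zero_mul]
    have hts : ∀ i, t i * s = 0 := fun i => by
      have := congrArg star (hst i)
      rwa [star_mul, hs.isSelfAdjoint.star_eq, (ht i).isSelfAdjoint.star_eq, star_zero] at this
    have hrt' : ∀ i, r * t i = t i := fun i => by
      rw [← hrt, ← mul_assoc, mul_sub, hr.isIdempotentElem.eq, hrs]
    refine ⟨Fin.cons s t, fun i => ?_, fun i => ?_, fun i => ?_, fun i j hij => ?_⟩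
    · cases i using Fin.cases with
      | zero => simpa using hs
      | succ i => simpa using ht i
    · cases i using Fin.cases with
      | zero => simpa using hs0
      | succ i => simpa using ht0 i
    · cases i using Fin.cases with
      | zero => simpa using hrs
      | succ i => simpa using hrt' i
    · cases i using Fin.cases with
      | zero =>
        cases j using Fin.cases with
        | zero => exact absurd rfl hij
        | succ j => simpa using hst j
      | succ i =>
        cases j using Fin.cases with
        | zero => simpa using hts i
        | succ j => simpa using htt i j (fun h => hij (by rw [h]))

variable [Algebra ℂ A] {τ : A →ₗ[ℂ] ℂ}

/-- Faithfulness of the trace takes over the role of the C*-identity, as `A` carries no norm here.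
-/
theorem IsFaithfulTrace.eq_zero (hτ : IsFaithfulTrace τ) {x : A} (h : star x * x = 0) : x = 0 :=
  hτ.faithful x (by rw [h, map_zero])

theorem IsFaithfulTrace.eq_zero_of_proj (hτ : IsFaithfulTrace τ) {p : A} (hp : IsStarProjection p)
    (h : τ p = 0) : p = 0 :=
  hτ.faithful p (by rw [hp.isSelfAdjoint.star_eq, hp.isIdempotentElem.eq, h])

theorem IsFaithfulTrace.nonneg_of_proj (hτ : IsFaithfulTrace τ) {p : A}
    (hp : IsStarProjection p) : 0 ≤ τ p := by
  have := hτ.nonneg p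
  rwa [hp.isSelfAdjoint.star_eq, hp.isIdempotentElem.eq] at this

theorem IsFaithfulTrace.mul_proj (hτ : IsFaithfulTrace τ) {x p : A} (hp : IsStarProjection p)
    (h : star x * x = p) : x * p = x := by
  have h1 : star (x * p - x) * (x * p - x) = 0 := by
    rw [star_sub, star_mul, hp.isSelfAdjoint.star_eq]
    calc (p * star x - star x) * (x * p - x)
        = p * (star x * x) * p - p * (star x * x) - (star x * x) * p + star x * x := by
          noncomm_ring
      _ = 0 := by rw [h]; simp [hp.isIdempotentElem.eq]
  exact sub_eq_zero.1 (hτ.eq_zero h1)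

namespace IsSystem

variable {ι : Type*} [DecidableEq ι] {e f p : A} {x : ι → A}

theorem mul_proj (hτ : IsFaithfulTrace τ) (hx : IsSystem e f x p) (i : ι) : x i * p = x i :=
  hτ.mul_proj hx.proj (by rw [hx.star_mul, if_pos rfl])

theorem proj_mul_star (hτ : IsFaithfulTrace τ) (hx : IsSystem e f x p) (i : ι) :
    p * star (x i) = star (x i) := by
  have := congrArg star (hx.mul_proj hτ i)
  rwa [StarMul.star_mul, hx.proj.isSelfAdjoint.star_eq] at this

variable [Fintype ι]

theorem star_mul_sum (hτ : IsFaithfulTrace τ) (hx : IsSystem e f x p) (i : ι) :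
    star (x i) * ∑ j, x j * star (x j) = star (x i) := by
  rw [Finset.mul_sum, Finset.sum_eq_single i]
  · rw [← mul_assoc, hx.star_mul, if_pos rfl, hx.proj_mul_star hτ]
  · intro j _ hj
    rw [← mul_assoc, hx.star_mul, if_neg hj.symm, zero_mul]
  · simp

theorem isStarProjection_sum (hτ : IsFaithfulTrace τ) (hx : IsSystem e f x p) :
    IsStarProjection (∑ j, x j * star (x j)) := by
  refine ⟨?_, star_sum_mul_star x⟩
  change _ * _ = _
  rw [Finset.sum_mul]
  exact Finset.sum_congr rfl fun i _ => by rw [mul_assoc, hx.star_mul_sum hτ]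

theorem trace_sum (hτ : IsFaithfulTrace τ) (hx : IsSystem e f x p) :
    τ (∑ j, x j * star (x j)) = Fintype.card ι * τ p := by
  have : ∀ j, τ (x j * star (x j)) = τ p := fun j => by
    rw [hτ.mul_comm, hx.star_mul, if_pos rfl]
  rw [map_sum, Finset.sum_congr rfl fun j _ => this j]
  simp

end IsSystem

/-- Projections of equal trace are equivalent. -/
theorem HasComparison.exists_equivalence (hA : HasComparison A) (hτ : IsFaithfulTrace τ) {e f : A}
    (he : IsStarProjection e) (hf : IsStarProjection f) (hef : τ e = τ f) :
    ∃ u : A, u * star u = e ∧ star u * u = f := by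
  -- A maximal partial isometry from under `f` to under `e`. The two remainders have equal trace, so
  -- they vanish together; if both were nonzero, a partial isometry between them would enlarge `x`.
  obtain ⟨x, p, hx, hmax⟩ := hA.exists_maximal 1 e f
  have hxx : star (x 0) * x 0 = p := by rw [hx.star_mul, if_pos rfl]
  have hxe : e * (x 0 * star (x 0)) = x 0 * star (x 0) := by rw [← mul_assoc, hx.left]
  have hpf : p * f = p := by rw [← hxx, mul_assoc, hx.right]
  have hxs : IsStarProjection (x 0 * star (x 0)) := by
    simpa using hx.isStarProjection_sum hτ
  have he' : IsStarProjection (e - x 0 * star (x 0)) :=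
    hxs.sub_of_mul_eq_right he hxe
  have hf' : IsStarProjection (f - p) := hx.proj.sub_of_mul_eq_left hf hpf
  have hτe : τ (e - x 0 * star (x 0)) = τ (f - p) := by
    rw [map_sub, map_sub, hef, hτ.mul_comm, hxx]
  by_cases hf0 : f - p = 0
  · refine ⟨x 0, ?_, ?_⟩
    · rw [hf0, map_zero] at hτe
      exact (sub_eq_zero.1 (hτ.eq_zero_of_proj he' hτe)).symm
    · rw [hxx]; exact (sub_eq_zero.1 hf0).symm
  · exfalso
    have he0 : e - x 0 * star (x 0) ≠ 0 := by
      intro h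
      rw [h, map_zero] at hτe
      exact hf0 (hτ.eq_zero_of_proj hf' hτe.symm)
    obtain ⟨u, hu0, hu, hl, hr⟩ := hA.exists_between he0 hf0 he'.isIdempotentElem.eq
      hf'.isIdempotentElem.eq
    have hee : e * (e - x 0 * star (x 0)) = e - x 0 * star (x 0) := by
      rw [mul_sub, he.isIdempotentElem.eq, hxe]
    have hff : (f - p) * f = f - p := by rw [sub_mul, hf.isIdempotentElem.eq, hpf]
    have hxe' : star (x 0) * e = star (x 0) := by
      have := congrArg star (hx.left 0)
      rwa [star_mul, he.isSelfAdjoint.star_eq] at this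
    have h1 : star (x 0) * (e - x 0 * star (x 0)) = 0 := by
      rw [mul_sub, hxe', ← mul_assoc, hxx, hx.proj_mul_star hτ, sub_self]
    have h2 : p * (f - p) = 0 := by rw [mul_sub, hpf, hx.proj.isIdempotentElem.eq, sub_self]
    have hq : (f - p) * (star u * u) = star u * u := by
      have := congrArg star hr
      rw [star_mul, hf'.isSelfAdjoint.star_eq] at this
      rw [← mul_assoc, this]
    have := hmax (fun _ => u) (star u * u)
      ⟨hu, fun i j => by rw [if_pos (Subsingleton.elim i j)], fun i => by rw [← hl, ← mul_assoc, hee],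
        fun i => by rw [← hr, mul_assoc, hff]⟩
      (fun i j => by rw [Subsingleton.elim i 0, ← hl, ← mul_assoc, h1, zero_mul])
      (by rw [← hq, ← mul_assoc, h2, zero_mul])
    exact hu0 (hτ.eq_zero this)

/-- Finitely many nonzero projections contain equivalent nonzero subprojections. -/
theorem HasComparison.exists_common (hA : HasComparison A) (hτ : IsFaithfulTrace τ) {s : A}
    (hs : IsStarProjection s) (hs0 : s ≠ 0) : ∀ (k : ℕ) (r : Fin k → A),
    (∀ i, IsStarProjection (r i)) → (∀ i, r i ≠ 0) → ∃ (u : Fin k → A) (q : A), q ≠ 0 ∧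
      IsStarProjection q ∧ s * q = q ∧ ∀ i, star (u i) * u i = q ∧ r i * u i = u i
  | 0, r, _, _ => ⟨fun i => i.elim0, s, hs0, hs, hs.isIdempotentElem.eq, fun i => i.elim0⟩
  | k + 1, r, hr, hr0 => by
    obtain ⟨u, q, hq0, hq, hsq, hu⟩ := hA.exists_common hτ hs hs0 k (fun i => r i.castSucc)
      (fun i => hr _) (fun i => hr0 _)
    obtain ⟨w, hw0, hw, hl, hwr⟩ := hA.exists_between (hr0 (Fin.last k)) hq0
      (hr _).isIdempotentElem.eq hq.isIdempotentElem.eq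
    have hqw : q * (star w * w) = star w * w := by
      have := congrArg star hwr
      rw [star_mul, hq.isSelfAdjoint.star_eq] at this
      rw [← mul_assoc, this]
    -- The earlier partial isometries are restricted to the smaller initial projection of the new
    -- one.
    refine ⟨Fin.snoc (fun i => u i * (star w * w)) w, star w * w,
      fun h => hw0 (hτ.eq_zero h), hw, ?_, fun i => ?_⟩
    · rw [← hqw, ← mul_assoc, hsq]
    · induction i using Fin.lastCases with
      | last => simpa using hl
      | cast i =>
        simp only [Fin.snoc_castSucc]
        refine ⟨?_, ?_⟩
        · rw [star_mul, hw.isSelfAdjoint.star_eq, mul_assoc, ← mul_assoc (star (u i)), (hu i).1, hqw,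
            hw.isIdempotentElem.eq]
        · rw [← mul_assoc, (hu i).2]

/-- The unit is a sum of `n` equivalent projections. -/
theorem HasComparison.exists_division (hA : HasComparison A) (hτ : IsFaithfulTrace τ)
    (hsplit : ∀ r : A, IsStarProjection r → r ≠ 0 →
      ∃ s, IsStarProjection s ∧ r * s = s ∧ s ≠ 0 ∧ s ≠ r) (n : ℕ) [NeZero n] :
    ∃ (x : Fin n → A) (p : A), IsSystem 1 1 x p ∧ ∑ i, x i * star (x i) = 1 := by
  obtain ⟨x, p, hx, hmax⟩ := hA.exists_maximal n (1 : A) 1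
  refine ⟨x, p, hx, ?_⟩
  by_contra hne
  set E := ∑ i, x i * star (x i) with hE
  have hr : IsStarProjection (1 - E) := (hx.isStarProjection_sum hτ).one_sub
  have hr0 : 1 - E ≠ 0 := fun h => hne (sub_eq_zero.1 h).symm
  have hs : IsStarProjection (1 - p) := hx.proj.one_sub
  -- There must be room on the initial side as well. If `p = 1`, then `τ(E) = n τ(1) ≥ τ(1)`, so the
  -- faithful trace gives `E = 1`.
  have hs0 : 1 - p ≠ 0 := by
    intro h
    have hp1 : p = 1 := (sub_eq_zero.1 h).symm
    have h1 := hx.trace_sum hτ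
    have h2 := hτ.nonneg_of_proj hr
    have h3 := hτ.nonneg_of_proj (.one A)
    have hn : (1 : ℂ) ≤ n := by exact_mod_cast NeZero.one_le
    have h4 : (n : ℂ) * τ 1 ≥ 1 * τ 1 := mul_le_mul_of_nonneg_right hn h3
    refine hr0 (hτ.eq_zero_of_proj hr (le_antisymm ?_ h2))
    rw [map_sub, hE, h1, hp1, Fintype.card_fin, sub_nonpos]
    simpa using h4
  -- `n` orthogonal pieces of `1 - E` and a piece of `1 - p` share a nonzero equivalent
  -- subprojection, which extends the maximal system.
  obtain ⟨t, ht, ht0, hrt, htt⟩ := exists_orthogonal hsplit n _ hr hr0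
  obtain ⟨u, q, hq0, hq, hsq, hu⟩ := hA.exists_common hτ hs hs0 n t ht ht0
  refine hq0 (hmax u q ⟨hq, fun i j => ?_, fun i => one_mul _, fun i => mul_one _⟩
    (fun i j => ?_) ?_)
  · split_ifs with hij
    · rw [hij, (hu j).1]
    · rw [← (hu i).2, ← (hu j).2, star_mul, (ht i).isSelfAdjoint.star_eq, mul_assoc,
        ← mul_assoc (t i), htt i j hij, zero_mul, mul_zero]
  · rw [← (hu j).2, ← hrt, ← mul_assoc, ← mul_assoc, mul_sub, mul_one, hE, hx.star_mul_sum hτ,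
      sub_self, zero_mul, zero_mul]
  · rw [← hsq, ← mul_assoc, hx.proj.mul_one_sub_self, zero_mul]

end Comparison

/-! ### Minimal projections -/

section Minimal

variable {A : Type*} [Ring A] [StarRing A] [Algebra ℂ A] {τ : A →ₗ[ℂ] ℂ}

/-- Positivity is available on squares only, and `4 h = (h + 1)² - (h - 1)²`. -/
theorem IsFaithfulTrace.isSelfAdjoint_apply (hτ : IsFaithfulTrace τ) {h : A}
    (hh : IsSelfAdjoint h) : IsSelfAdjoint (τ h) := by
  have hr : ∀ y : A, IsSelfAdjoint y → IsSelfAdjoint (τ (y * y)) := fun y hy => by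
    have := hτ.nonneg y
    rw [hy.star_eq] at this
    exact IsSelfAdjoint.of_nonneg this
  have h1 : τ ((h + 1) * (h + 1)) - τ ((h - 1) * (h - 1)) = 4 * τ h := by
    have : (h + 1) * (h + 1) - (h - 1) * (h - 1) = (4 : ℂ) • h := by
      rw [show (4 : ℂ) = ((4 : ℕ) : ℂ) by norm_num, Nat.cast_smul_eq_nsmul]
      noncomm_ring
    rw [← map_sub, this, map_smul, smul_eq_mul]
  have h2 : τ h = 4⁻¹ * (τ ((h + 1) * (h + 1)) - τ ((h - 1) * (h - 1))) := by
    rw [h1, inv_mul_cancel_left₀ (by norm_num)]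
  have h4 : IsSelfAdjoint (4⁻¹ : ℂ) := by
    rw [isSelfAdjoint_iff, star_inv₀]; simp
  rw [h2]
  exact h4.mul ((hr _ (hh.add (.one A))).sub (hr _ (hh.sub (.one A))))

/-- Powers of `a` are stripped off one at a time: `(a² y)* (a² y) = y* a (a³ y)` and `(a y)* (a y) =
y* (a² y)`. -/
theorem IsFaithfulTrace.mul_eq_zero_of_cube (hτ : IsFaithfulTrace τ) {a y : A}
    (ha : IsSelfAdjoint a) (h : a * a * a * y = 0) : a * y = 0 := by
  have h2 : a * a * y = 0 := hτ.eq_zero (by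
    rw [star_mul, star_mul, ha.star_eq]
    calc star y * (a * a) * (a * a * y) = star y * a * (a * a * a * y) := by noncomm_ring
      _ = 0 := by rw [h, mul_zero])
  exact hτ.eq_zero (by
    rw [star_mul, ha.star_eq]
    calc star y * a * (a * y) = star y * (a * a * y) := by noncomm_ring
      _ = 0 := by rw [h2, mul_zero])

variable {r : A}

/-- An algebra spanned by a complete system over a minimal projection is finite dimensional. -/
theorem finiteDimensional_of_system (hτ : IsFaithfulTrace τ) {ι : Type*} [Fintype ι]
    [DecidableEq ι] {x : ι → A} (hx : IsSystem 1 1 x r) (hsum : ∑ i, x i * star (x i) = 1)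
    (hcorner : ∀ y, ∃ c : ℂ, r * y * r = c • r) : FiniteDimensional ℂ A := by
  have htop : Submodule.span ℂ (Set.range fun p : ι × ι => x p.1 * star (x p.2)) = ⊤ := by
    rw [eq_top_iff]
    intro y _
    -- Cutting `y` by the complete system on both sides moves every block into the corner of `r`,
    -- which is scalar.
    have hy : y = ∑ i, ∑ j, x i * (r * (star (x i) * y * x j) * r) * star (x j) := by
      have : ∀ i j, x i * (r * (star (x i) * y * x j) * r) * star (x j) =
          (x i * star (x i)) * y * (x j * star (x j)) := fun i j => by
        calc _ = (x i * r) * star (x i) * y * x j * (r * star (x j)) := by noncomm_ring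
          _ = _ := by rw [hx.mul_proj hτ, hx.proj_mul_star hτ]; noncomm_ring
      simp_rw [this, ← Finset.mul_sum, hsum, mul_one, ← Finset.sum_mul, hsum, one_mul]
    rw [hy]
    refine Submodule.sum_mem _ fun i _ => Submodule.sum_mem _ fun j _ => ?_
    obtain ⟨c, hc⟩ := hcorner (star (x i) * y * x j)
    rw [hc, mul_smul_comm, smul_mul_assoc, hx.mul_proj hτ]
    exact Submodule.smul_mem _ _ (Submodule.subset_span ⟨(i, j), rfl⟩)
  exact ⟨htop ▸ Submodule.fg_span (Set.finite_range _)⟩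

variable [StarModule ℂ A]

/-- The corner of a minimal projection consists of scalars. -/
theorem HasComparison.corner_eq_smul_of_isSelfAdjoint (hA : HasComparison A)
    (hτ : IsFaithfulTrace τ) (hr : IsStarProjection r) (hr0 : r ≠ 0)
    (hmin : ∀ s, IsStarProjection s → r * s = s → s ≠ 0 → s = r) {x : A} (hx : IsSelfAdjoint x) :
    ∃ c : ℂ, r * x * r = c • r := by
  have hrr := hr.isIdempotentElem.eq
  have hrs := hr.isSelfAdjoint
  have hτr : τ r ≠ 0 := fun h => hr0 (hτ.eq_zero_of_proj hr h)
  have hxs : IsSelfAdjoint (r * x * r) := by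
    rw [isSelfAdjoint_iff, star_mul, star_mul, hx.star_eq, hrs.star_eq, mul_assoc]
  -- The only possible scalar: it makes `k = r x r - c r` traceless.
  set c := τ (r * x * r) * (τ r)⁻¹ with hc
  refine ⟨c, ?_⟩
  have hcs : IsSelfAdjoint c := by
    refine (hτ.isSelfAdjoint_apply hxs).mul ?_
    rw [isSelfAdjoint_iff, star_inv₀, (hτ.isSelfAdjoint_apply hrs).star_eq]
  set k := r * x * r - c • r with hk
  have hks : IsSelfAdjoint k := hxs.sub (hcs.smul hrs)
  have hkr : k * (1 - r) = 0 := by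
    rw [hk, sub_mul, mul_sub, mul_sub, smul_mul_assoc, smul_mul_assoc, mul_one, mul_one,
      mul_assoc (r * x) r r, hrr]
    simp
  have hτk : τ k = 0 := by
    rw [hk, map_sub, map_smul, smul_eq_mul, hc, inv_mul_cancel_right₀ hτr, sub_self]
  obtain ⟨a, b, ha, hb, hkab, hab⟩ := hA.exists_sq_sub_sq k hks
  have hτab : τ (a * a) = τ (b * b) := by
    rw [hkab, map_sub] at hτk
    exact sub_eq_zero.1 hτk
  have hsq : ∀ y : A, IsSelfAdjoint y → τ (y * y) = 0 → y = 0 := fun y hy h =>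
    hτ.faithful y (by rwa [hy.star_eq])
  rw [← sub_eq_zero]
  by_cases ha0 : a = 0
  · have hb0 : b = 0 := hsq b hb (by rw [← hτab, ha0, mul_zero, map_zero])
    rw [← hk, hkab, ha0, hb0]; simp
  exfalso
  have har : a * (1 - r) = 0 := hτ.mul_eq_zero_of_cube ha (by
    calc a * a * a * (1 - r) = a * ((a * a - b * b) * (1 - r)) + (a * b) * b * (1 - r) := by
          noncomm_ring
      _ = 0 := by rw [← hkab, hkr, hab]; simp)
  -- The initial projection of `u` lies under `r`, so it is `r` by minimality; but `u` kills `b`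
  -- because `a` does. Hence `r b = 0`, so `k = k r = a²`, and `τ(k) = 0` gives `a = 0`.
  obtain ⟨u, hu0, hu, hul, -⟩ := hA.exists_partialIsometry a ha0
  have hur : u * r = u := by
    have := hul _ har
    rw [mul_sub, mul_one, sub_eq_zero] at this
    exact this.symm
  have hq : star u * u = r := by
    refine hmin _ hu ?_ (fun h => hu0 (hτ.eq_zero h))
    have := congrArg star hur
    rw [star_mul, hrs.star_eq] at this
    rw [← mul_assoc, this]
  have hrb : r * b = 0 := by rw [← hq, mul_assoc, hul b hab, mul_zero]
  have hbr : b * r = 0 := by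
    have := congrArg star hrb
    rwa [star_mul, hb.star_eq, hrs.star_eq, star_zero] at this
  have hkr' : k * r = a * a := by
    have : a * r = a := by
      rw [mul_sub, mul_one, sub_eq_zero] at har
      exact har.symm
    rw [hkab, sub_mul, mul_assoc, mul_assoc, this, hbr, mul_zero, sub_zero]
  have hkk : k * r = k := by
    rw [mul_sub, mul_one, sub_eq_zero] at hkr
    exact hkr.symm
  exact ha0 (hsq a ha (by rw [← hkr', hkk, hτk]))

theorem HasComparison.corner_eq_smul (hA : HasComparison A)
    (hτ : IsFaithfulTrace τ) (hr : IsStarProjection r) (hr0 : r ≠ 0)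
    (hmin : ∀ s, IsStarProjection s → r * s = s → s ≠ 0 → s = r) (x : A) :
    ∃ c : ℂ, r * x * r = c • r := by
  obtain ⟨c, hc⟩ := hA.corner_eq_smul_of_isSelfAdjoint hτ hr hr0 hmin (realPart x).2
  obtain ⟨d, hd⟩ := hA.corner_eq_smul_of_isSelfAdjoint hτ hr hr0 hmin (imaginaryPart x).2
  refine ⟨c + Complex.I * d, ?_⟩
  conv_lhs => rw [← realPart_add_I_smul_imaginaryPart x]
  rw [mul_add, add_mul, mul_smul_comm, smul_mul_assoc, hc, hd, smul_smul, add_smul]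

/-- An infinite dimensional factor with a faithful trace has no minimal projections. -/
theorem HasComparison.exists_split (hA : HasComparison A) (hτ : IsFaithfulTrace τ)
    (hinf : ¬ FiniteDimensional ℂ A) (hr : IsStarProjection r) (hr0 : r ≠ 0) :
    ∃ s, IsStarProjection s ∧ r * s = s ∧ s ≠ 0 ∧ s ≠ r := by
  by_contra! hmin
  -- Under a minimal `r` the process never stops: a complete system would make `A` finite
  -- dimensional. The trace then gives `k τ(r) ≤ τ(1)` for every `k`.
  have key : ∀ k : ℕ, ∃ x : Fin k → A, IsSystem 1 1 x r := by
    intro k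
    induction k with
    | zero =>
      exact ⟨fun i => i.elim0, hr, fun i => i.elim0, fun i => i.elim0, fun i => i.elim0⟩
    | succ k ih =>
      obtain ⟨x, hx⟩ := ih
      have hE := (hx.isStarProjection_sum hτ).one_sub
      have hE0 : 1 - ∑ i, x i * star (x i) ≠ 0 := fun h => hinf
        (finiteDimensional_of_system hτ hx (sub_eq_zero.1 h).symm
          (hA.corner_eq_smul hτ hr hr0 hmin))
      obtain ⟨u, hu0, hu, hl, hur⟩ := hA.exists_between hE0 hr0 hE.isIdempotentElem.eq
        hr.isIdempotentElem.eq
      have hq : star u * u = r := by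
        refine hmin _ hu ?_ (fun h => hu0 (hτ.eq_zero h))
        have := congrArg star hur
        rw [star_mul, hr.isSelfAdjoint.star_eq] at this
        rw [← mul_assoc, this]
      have hxu : ∀ i, star (x i) * u = 0 := fun i => by
        rw [← hl, ← mul_assoc, mul_sub, mul_one, hx.star_mul_sum hτ, sub_self, zero_mul]
      have hux : ∀ i, star u * x i = 0 := fun i => by
        have := congrArg star (hxu i)
        rwa [star_mul, star_star, star_zero] at this
      refine ⟨Fin.cons u x, hr, fun i j => ?_, fun i => one_mul _, fun i => mul_one _⟩
      cases i using Fin.cases with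
      | zero =>
        cases j using Fin.cases with
        | zero => simpa using hq
        | succ j => simpa [(Fin.succ_ne_zero j).symm] using hux j
      | succ i =>
        cases j using Fin.cases with
        | zero => simpa using hxu i
        | succ j => simpa using hx.star_mul i j
  have hτr : 0 < τ r := lt_of_le_of_ne (hτ.nonneg_of_proj hr)
    fun h => hr0 (hτ.eq_zero_of_proj hr h.symm)
  obtain ⟨k, hk⟩ := exists_nat_gt ((τ 1).re / (τ r).re)
  obtain ⟨x, hx⟩ := key k
  have h1 := hτ.nonneg_of_proj (hx.isStarProjection_sum hτ).one_sub
  rw [map_sub, hx.trace_sum hτ, Fintype.card_fin] at h1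
  have h2 := (Complex.le_def.1 h1).1
  have h3 : 0 < (τ r).re := (Complex.lt_def.1 hτr).1
  rw [div_lt_iff₀ h3] at hk
  simp at h2
  linarith

end Minimal

/-! ### Matrices over a factor of type II₁ -/

section Transfer

variable {K : Type*} [NormedAddCommGroup K] [InnerProductSpace ℂ K] [CompleteSpace K]
variable {A : Type*} [Ring A] [StarRing A] [Algebra ℂ A]

theorem isStarProjection_map_iff {φ : A →⋆ₐ[ℂ] (K →L[ℂ] K)} (hφ : Function.Injective φ) {p : A} :
    IsStarProjection (φ p) ↔ IsStarProjection p := by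
  refine ⟨fun h => ⟨hφ ?_, hφ ?_⟩, fun h => h.map φ⟩
  · rw [map_mul, h.isIdempotentElem.eq]
  · rw [map_star, h.isSelfAdjoint.star_eq]

theorem IsSystem.map_iff {φ : A →⋆ₐ[ℂ] (K →L[ℂ] K)} (hφ : Function.Injective φ) {ι : Type*}
    [DecidableEq ι] {e f p : A} {x : ι → A} :
    IsSystem (φ e) (φ f) (fun i => φ (x i)) (φ p) ↔ IsSystem e f x p := by
  refine ⟨fun h => ⟨(isStarProjection_map_iff hφ).1 h.proj, fun i j => hφ ?_, fun i => hφ ?_,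
    fun i => hφ ?_⟩, fun h => ⟨(isStarProjection_map_iff hφ).2 h.proj, fun i j => ?_, fun i => ?_,
    fun i => ?_⟩⟩
  · rw [map_mul, map_star, h.star_mul]; split_ifs <;> simp
  · rw [map_mul, h.left]
  · rw [map_mul, h.right]
  · rw [← map_star, ← map_mul, h.star_mul]; split_ifs <;> simp
  · rw [← map_mul, h.left]
  · rw [← map_mul, h.right]

/-- Algebras isomorphic to von Neumann algebras have comparison if they are prime. -/
theorem hasComparison_of_vonNeumann (N : VonNeumannAlgebra K) {φ : A →⋆ₐ[ℂ] (K →L[ℂ] K)}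
    (hφ : Function.Injective φ) (hN : ∀ y, y ∈ N ↔ ∃ x, φ x = y)
    (hprime : ∀ a b : A, (∀ x, a * x * b = 0) → a = 0 ∨ b = 0) : HasComparison A where
  exists_partialIsometry x hx := by
    obtain ⟨u, huN, hu0, hu, h1, h2⟩ := exists_partialIsometry N ((hN _).2 ⟨x, rfl⟩)
      ((map_ne_zero_iff φ hφ).2 hx)
    obtain ⟨u, rfl⟩ := (hN _).1 huN
    refine ⟨u, fun h => hu0 (by rw [h, map_zero]), (isStarProjection_map_iff hφ).1 ?_,
      fun b hb => hφ ?_, fun b hb => hφ ?_⟩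
    · rwa [map_mul, map_star]
    · rw [map_mul, map_zero]
      exact h1 _ (by rw [← map_mul, hb, map_zero])
    · rw [map_mul, map_zero]
      exact h2 _ (by rw [← map_mul, hb, map_zero])
  exists_maximal n _ e f := by
    obtain ⟨x, p, hxN, hx, hmax⟩ := exists_maximal_system N (Fin n) (φ e) (φ f)
    choose y hy using fun i => (hN _).1 (hxN i)
    obtain rfl : (fun i => φ (y i)) = x := funext hy
    -- The maximal system records no membership of `p` in `N`; it follows from `p = x₀* x₀`, where
    -- `n ≠ 0` matters.
    have hp : ∃ q, φ q = p := ⟨star (y 0) * y 0, by rw [map_mul, map_star, hx.star_mul, if_pos rfl]⟩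
    obtain ⟨p, rfl⟩ := hp
    refine ⟨y, p, (IsSystem.map_iff hφ).1 hx, fun u q hu huy hpq => hφ ?_⟩
    rw [map_zero]
    refine hmax (fun i => φ (u i)) (φ q) (fun i => (hN _).2 ⟨_, rfl⟩) ((IsSystem.map_iff hφ).2 hu)
      (fun i j => ?_) ?_
    · rw [← map_star, ← map_mul, huy, map_zero]
    · rw [← map_mul, hpq, map_zero]
  prime := hprime
  exists_sq_sub_sq k hk := by
    obtain ⟨a, haN, b, hbN, ha, hb, h1, h2⟩ := exists_sq_sub_sq N ((hN _).2 ⟨k, rfl⟩) (hk.map φ)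
    obtain ⟨a, rfl⟩ := (hN _).1 haN
    obtain ⟨b, rfl⟩ := (hN _).1 hbN
    refine ⟨a, b, hφ ?_, hφ ?_, hφ ?_, hφ ?_⟩
    · rw [map_star, ha.star_eq]
    · rw [map_star, hb.star_eq]
    · rw [h1, map_sub, map_mul, map_mul]
    · rw [map_mul, h2, map_zero]

end Transfer

/-! ### Operators on `Hⁿ` as matrices, and the von Neumann algebra of matrices over `M` -/

section Amplification

variable {H : Type*} [NormedAddCommGroup H] [InnerProductSpace ℂ H] [CompleteSpace H]
/-- The `i`-th coordinate projection of `Hⁿ`. -/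
noncomputable def coordProj (H : Type*) [NormedAddCommGroup H] [InnerProductSpace ℂ H]
    {ι : Type*} [Fintype ι] (i : ι) : PiLp 2 (fun _ : ι => H) →L[ℂ] H :=
  PiLp.proj 2 (fun _ : ι => H) i

variable {ι : Type*} [Fintype ι]

/-- The matrix entries of an operator on `Hⁿ`. -/
noncomputable def entry (Y : PiLp 2 (fun _ : ι => H) →L[ℂ] PiLp 2 (fun _ : ι => H)) (i j : ι) :
    H →L[ℂ] H :=
  coordProj H i ∘L Y ∘L ContinuousLinearMap.adjoint (coordProj H j)

theorem entry_star (Y : PiLp 2 (fun _ : ι => H) →L[ℂ] PiLp 2 (fun _ : ι => H)) (i j : ι) :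
    entry (star Y) i j = star (entry Y j i) := by
  simp only [entry, ContinuousLinearMap.star_eq_adjoint, ContinuousLinearMap.adjoint_comp,
    ContinuousLinearMap.adjoint_adjoint, ContinuousLinearMap.comp_assoc]

variable [DecidableEq ι]

open ContinuousLinearMap in
theorem adjoint_coordProj_apply (j : ι) (h : H) :
    adjoint (coordProj H j) h = WithLp.toLp 2 (Pi.single j h) := by
  refine ext_inner_right ℂ fun y => ?_
  rw [adjoint_inner_left, PiLp.inner_apply, Finset.sum_eq_single j]
  · simp [coordProj]
  · intro i _ hi
    simp [hi]
  · simp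

open ContinuousLinearMap in
theorem coordProj_adjoint (i j : ι) :
    coordProj H i ∘L adjoint (coordProj H j) = if i = j then 1 else 0 := by
  ext h
  rw [ContinuousLinearMap.comp_apply, adjoint_coordProj_apply]
  by_cases hij : i = j
  · subst hij; simp [coordProj]
  · simp [coordProj, hij]

open ContinuousLinearMap in
theorem sum_adjoint_coordProj :
    ∑ i : ι, adjoint (coordProj H i) ∘L coordProj H i = 1 := by
  ext x i
  simp only [_root_.sum_apply, ContinuousLinearMap.comp_apply,
    adjoint_coordProj_apply, one_apply_eq_self]
  simp [coordProj, Pi.single_apply]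

open ContinuousLinearMap in
theorem sum_entry (Y : PiLp 2 (fun _ : ι => H) →L[ℂ] PiLp 2 (fun _ : ι => H)) :
    ∑ i, ∑ j, adjoint (coordProj H i) ∘L entry Y i j ∘L coordProj H j = Y := by
  have h : ∀ i j, adjoint (coordProj H i) ∘L entry Y i j ∘L coordProj H j =
      ((adjoint (coordProj H i) ∘L coordProj H i) * Y) *
        (adjoint (coordProj H j) ∘L coordProj H j) := fun i j => rfl
  simp_rw [h, ← Finset.mul_sum, sum_adjoint_coordProj, mul_one, ← Finset.sum_mul,
    sum_adjoint_coordProj, one_mul]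

theorem entry_ext {Y Z : PiLp 2 (fun _ : ι => H) →L[ℂ] PiLp 2 (fun _ : ι => H)}
    (h : ∀ i j, entry Y i j = entry Z i j) : Y = Z := by
  rw [← sum_entry Y, ← sum_entry Z]
  simp_rw [h]

theorem entry_mul (Y Z : PiLp 2 (fun _ : ι => H) →L[ℂ] PiLp 2 (fun _ : ι => H)) (i j : ι) :
    entry (Y * Z) i j = ∑ k, entry Y i k * entry Z k j := by
  have h : entry (Y * Z) i j = coordProj H i ∘L Y ∘L
      (∑ k : ι, ContinuousLinearMap.adjoint (coordProj H k) ∘L coordProj H k) ∘L Z ∘L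
        ContinuousLinearMap.adjoint (coordProj H j) := by
    rw [sum_adjoint_coordProj]; rfl
  rw [h]
  ext ξ
  simp [entry]

theorem entry_algebraMap (c : ℂ) (i j : ι) :
    entry (algebraMap ℂ (PiLp 2 (fun _ : ι => H) →L[ℂ] PiLp 2 (fun _ : ι => H)) c) i j =
      if i = j then algebraMap ℂ (H →L[ℂ] H) c else 0 := by
  have h : entry (algebraMap ℂ (PiLp 2 (fun _ : ι => H) →L[ℂ] PiLp 2 (fun _ : ι => H)) c) i j =
      c • (coordProj H i ∘L ContinuousLinearMap.adjoint (coordProj H j)) := by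
    ext ξ
    simp [entry, Algebra.algebraMap_eq_smul_one]
  rw [h, coordProj_adjoint, smul_ite, smul_zero, Algebra.algebraMap_eq_smul_one]

open ContinuousLinearMap in
/-- The operator on `Hⁿ` with given matrix entries. -/
noncomputable def blockOperator (X : ι → ι → H →L[ℂ] H) :
    PiLp 2 (fun _ : ι => H) →L[ℂ] PiLp 2 (fun _ : ι => H) :=
  ∑ i, ∑ j, adjoint (coordProj H i) ∘L X i j ∘L coordProj H j

theorem blockOperator_entry (Y : PiLp 2 (fun _ : ι => H) →L[ℂ] PiLp 2 (fun _ : ι => H)) :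
    blockOperator (entry Y) = Y := sum_entry Y

open ContinuousLinearMap in
theorem entry_blockOperator (X : ι → ι → H →L[ℂ] H) (i j : ι) :
    entry (blockOperator X) i j = X i j := by
  have h : entry (blockOperator X) i j = ∑ k, ∑ l, (coordProj H i ∘L adjoint (coordProj H k)) *
      X k l * (coordProj H l ∘L adjoint (coordProj H j)) := by
    ext ξ
    simp [entry, blockOperator]
  rw [h]
  simp_rw [coordProj_adjoint]
  simp

variable (M : VonNeumannAlgebra H) (ι)

/-- The representation of the matrices over `M` on `Hⁿ`. -/
noncomputable def matrixRep :
    Matrix ι ι M.toStarSubalgebra →⋆ₐ[ℂ]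
      (PiLp 2 (fun _ : ι => H) →L[ℂ] PiLp 2 (fun _ : ι => H)) where
  toFun X := blockOperator fun i j => (X i j : H →L[ℂ] H)
  map_one' := entry_ext fun i j => by
    have h := entry_algebraMap (H := H) 1 i j
    rw [map_one, map_one] at h
    rw [entry_blockOperator, h, Matrix.one_apply]
    split_ifs <;> rfl
  map_mul' X Y := entry_ext fun i j => by
    rw [entry_mul, entry_blockOperator, Matrix.mul_apply]
    simp [entry_blockOperator]
  map_zero' := by simp [blockOperator]
  map_add' X Y := by simp [blockOperator, Finset.sum_add_distrib]
  commutes' c := entry_ext fun i j => by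
    rw [entry_blockOperator, entry_algebraMap, Matrix.algebraMap_matrix_apply]
    split_ifs <;> rfl
  map_star' X := entry_ext fun i j => by
    rw [entry_star, entry_blockOperator, entry_blockOperator]
    rfl

variable {ι M}

theorem entry_matrixRep (X : Matrix ι ι M.toStarSubalgebra) (i j : ι) :
    entry (matrixRep ι M X) i j = X i j := entry_blockOperator _ i j

theorem matrixRep_injective : Function.Injective (matrixRep ι M) := fun X Y h => by
  ext1 i j
  exact Subtype.ext (by rw [← entry_matrixRep, h, entry_matrixRep])

theorem exists_matrixRep_eq {Y : PiLp 2 (fun _ : ι => H) →L[ℂ] PiLp 2 (fun _ : ι => H)}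
    (hY : ∀ i j, entry Y i j ∈ M) : ∃ X, matrixRep ι M X = Y :=
  ⟨Matrix.of fun i j => ⟨entry Y i j, hY i j⟩, blockOperator_entry Y⟩

variable (ι M)

/-- The von Neumann algebra of matrices over `M`. -/
noncomputable def matrixVonNeumann : VonNeumannAlgebra (PiLp 2 (fun _ : ι => H)) where
  __ := (matrixRep ι M).range
  centralizer_centralizer' := by
    refine (Set.subset_centralizer_centralizer).antisymm' fun Y hY => ?_
    refine exists_matrixRep_eq fun i j => ?_
    rw [← VonNeumannAlgebra.commutant_commutant M, VonNeumannAlgebra.mem_commutant_iff]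
    intro y hy
    rw [VonNeumannAlgebra.mem_commutant_iff] at hy
    -- Constant diagonal operators with `y` in the commutant of `M` commute with all matrices over
    -- `M`. Commuting with them forces each entry of `Y` into the bicommutant of `M`.
    let Z := blockOperator fun i j : ι => if i = j then y else 0
    have hZ : Z ∈ Set.centralizer ((matrixRep ι M).range : Set _) := by
      rintro _ ⟨X, rfl⟩
      change matrixRep ι M X * Z = Z * matrixRep ι M X
      refine entry_ext fun i j => ?_
      rw [entry_mul, entry_mul]
      simp only [Z, entry_blockOperator, entry_matrixRep]
      simpa using hy _ (X i j).2
    have h := congrArg (fun T => entry T i j) (hY Z hZ)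
    simp only [entry_mul, Z, entry_blockOperator] at h
    simpa using h

variable {M}

theorem hasComparison_vonNeumann (hM : IsTypeIIOneFactor M) : HasComparison M.toStarSubalgebra := by
  refine hasComparison_of_vonNeumann M (φ := M.toStarSubalgebra.subtype) Subtype.val_injective
    (fun y => ⟨fun h => ⟨⟨y, h⟩, rfl⟩, ?_⟩) fun a b h => ?_
  · rintro ⟨x, rfl⟩
    exact x.2
  · rcases eq_zero_or_eq_zero_of_factor M hM.factor (a := a) (b := b) b.2
      fun x hx => congrArg Subtype.val (h ⟨x, hx⟩) with h | h
    · exact Or.inl (Subtype.ext h)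
    · exact Or.inr (Subtype.ext h)

/-- Primeness descends to `M`: sandwiching a matrix with the single entry `x` at `(j, k)` between
`a` and `b` isolates `a i j * x * b k l`. -/
theorem hasComparison_matrix (hM : IsTypeIIOneFactor M) :
    HasComparison (Matrix ι ι M.toStarSubalgebra) := by
  refine hasComparison_of_vonNeumann (matrixVonNeumann ι M) (φ := matrixRep ι M)
    matrixRep_injective (fun y => Iff.rfl) fun a b h => ?_
  by_contra! hab
  obtain ⟨i, j, ha⟩ : ∃ i j, a i j ≠ 0 := by
    by_contra! h0; exact hab.1 (Matrix.ext h0)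
  obtain ⟨k, l, hb⟩ : ∃ k l, b k l ≠ 0 := by
    by_contra! h0; exact hab.2 (Matrix.ext h0)
  rcases (hasComparison_vonNeumann hM).prime (a i j) (b k l) fun x => by
    have := congrFun (congrFun (h (Matrix.single j k x)) i) l
    rw [Matrix.mul_assoc, Matrix.mul_apply, Finset.sum_eq_single j, Matrix.single_mul_apply_same]
      at this
    · rwa [← mul_assoc] at this
    · intro m _ hm
      rw [Matrix.single_mul_apply_of_ne _ _ _ _ _ hm, mul_zero]
    · simp with h | h
  · exact ha h
  · exact hb h

end Amplification

/-! ### The unnormalised trace on matrices -/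

section Trace

variable {A : Type*} [Ring A] [Algebra ℂ A] {τ : A →ₗ[ℂ] ℂ}
variable {ι : Type*} [Fintype ι]

/-- The trace on the matrices over an algebra with a trace. -/
def matrixTrace (ι : Type*) [Fintype ι] (τ : A →ₗ[ℂ] ℂ) : Matrix ι ι A →ₗ[ℂ] ℂ :=
  τ ∘ₗ Matrix.traceLinearMap ι ℂ A

theorem matrixTrace_apply (X : Matrix ι ι A) : matrixTrace ι τ X = ∑ i, τ (X i i) := by
  simp [matrixTrace, Matrix.trace]

variable [StarRing A]

theorem matrixTrace_star_mul (X : Matrix ι ι A) :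
    matrixTrace ι τ (star X * X) = ∑ i, ∑ j, τ (star (X j i) * X j i) := by
  simp [matrixTrace_apply, Matrix.mul_apply, Matrix.star_apply]

theorem IsFaithfulTrace.matrixTrace [DecidableEq ι] (hτ : IsFaithfulTrace τ) :
    IsFaithfulTrace (GroupDual.matrixTrace ι τ) where
  nonneg X := by
    rw [matrixTrace_star_mul]
    exact Finset.sum_nonneg fun i _ => Finset.sum_nonneg fun j _ => hτ.nonneg _
  faithful X h := by
    rw [matrixTrace_star_mul, Finset.sum_eq_zero_iff_of_nonneg
      fun i _ => Finset.sum_nonneg fun j _ => hτ.nonneg _] at h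
    ext j i
    have := h i (Finset.mem_univ i)
    rw [Finset.sum_eq_zero_iff_of_nonneg fun j _ => hτ.nonneg _] at this
    exact hτ.faithful _ (this j (Finset.mem_univ j))
  mul_comm X Y := by
    simp only [matrixTrace_apply, Matrix.mul_apply, map_sum]
    rw [Finset.sum_comm]
    simp_rw [hτ.mul_comm (X _ _)]

end Trace

/-- Over a factor of type II₁ the image of some element under a unital homomorphism to the matrices
of size `n` is equivalent to a diagonal matrix unit. -/
theorem exists_row {H : Type*} [NormedAddCommGroup H] [InnerProductSpace ℂ H] [CompleteSpace H]
    {M : VonNeumannAlgebra H} (hM : IsTypeIIOneFactor M) {ι : Type*} [Fintype ι] [DecidableEq ι]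
    [Nonempty ι] (Φ : M.toStarSubalgebra →⋆ₐ[ℂ] Matrix ι ι M.toStarSubalgebra) :
    ∃ (p : M.toStarSubalgebra) (v : Matrix Unit ι M.toStarSubalgebra),
      v * vᴴ = 1 ∧ vᴴ * v = Φ p := by
  obtain ⟨τ, hτ1, hτ0, hτf, hτc⟩ := hM.trace
  have hτ : IsFaithfulTrace τ := ⟨hτ0, hτf, hτc⟩
  have hA := hasComparison_vonNeumann hM
  have hn : NeZero (Fintype.card ι) := ⟨Fintype.card_ne_zero⟩
  obtain ⟨x, p, hx, hsum⟩ := hA.exists_division hτ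
    (fun r hr hr0 => hA.exists_split hτ hM.infinite hr hr0) (Fintype.card ι)
  have hT := hτ.matrixTrace (ι := ι)
  set T := matrixTrace ι τ
  let g : ι := Classical.arbitrary ι
  have hE : IsStarProjection (Matrix.single g g (1 : M.toStarSubalgebra)) :=
    ⟨by simp [IsIdempotentElem], by
      simp [IsSelfAdjoint, Matrix.star_eq_conjTranspose]⟩
  have hTE : T (Matrix.single g g 1) = 1 := by
    rw [matrixTrace_apply, Finset.sum_eq_single g]
    · simpa using hτ1
    · intro i _ hi
      simp [Matrix.single_apply_of_ne _ _ _ _ _ (fun h => hi h.1.symm)]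
    · simp
  -- `T ∘ Φ` is itself tracial, so it takes the same value on the `|ι|` equivalent projections that
  -- sum to `1`, whose total is `T(1) = |ι|`.
  have hTp : T (Φ p) = 1 := by
    have h1 : ∀ i, T (Φ (x i * star (x i))) = T (Φ p) := fun i => by
      rw [map_mul, hT.mul_comm, ← map_mul, hx.star_mul, if_pos rfl]
    have h2 : T (Φ 1) = Fintype.card ι := by
      rw [map_one, matrixTrace_apply]
      simp [hτ1]
    rw [← hsum, map_sum, map_sum, Finset.sum_congr rfl fun i _ => h1 i] at h2
    have h3 : (Fintype.card ι : ℂ) ≠ 0 := by exact_mod_cast Fintype.card_ne_zero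
    simpa [h3] using h2
  obtain ⟨u, hu1, hu2⟩ := (hasComparison_matrix ι hM).exists_equivalence hT hE (hx.proj.map Φ)
    (hTE.trans hTp.symm)
  have hu : Matrix.single g g 1 * u = u := by
    have := hT.mul_proj (x := star u) hE (by rw [star_star, hu1])
    have := congrArg star this
    rwa [star_mul, star_star, hE.isSelfAdjoint.star_eq] at this
  -- The final projection of `u` is `e_{g,g}`, so `u` is concentrated in row `g`, and this row is
  -- `v`.
  have hu0 : ∀ k, k ≠ g → ∀ j, u k j = 0 := fun k hk j => by
    rw [← hu, Matrix.single_mul_apply_of_ne _ _ _ _ _ hk]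
  refine ⟨p, Matrix.of fun _ j => u g j, ?_, ?_⟩
  · ext i j
    have := congrFun (congrFun hu1 g) g
    simp only [Matrix.mul_apply, Matrix.star_apply, Matrix.single_apply_same] at this
    simp only [Matrix.mul_apply, Matrix.conjTranspose_apply, Matrix.of_apply, this]
    rfl
  · rw [← hu2]
    ext1 i j
    rw [Matrix.mul_apply, Matrix.mul_apply, Finset.sum_eq_single g]
    · simp
    · intro k _ hk
      rw [hu0 k hk, mul_zero]
    · simp

end GroupDual

theorem mainTheorem5 {G : Type*} [Group G] [Finite G]
    {H : Type*} [NormedAddCommGroup H] [InnerProductSpace ℂ H] [CompleteSpace H]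
    (M : VonNeumannAlgebra H) (hM : GroupDual.IsTypeIIOneFactor M)
    (D : GroupDual.UnitaryDual G) (B : GroupDual.IntertwinerBasis D)
    (α : ∀ π : D, M.toStarSubalgebra →⋆ₐ[ℂ]
      Matrix (Fin π.1.dim) (Fin π.1.dim) M.toStarSubalgebra)
    (U : ∀ π ρ : D, Matrix (Fin π.1.dim × Fin ρ.1.dim) (Fin π.1.dim × Fin ρ.1.dim)
      M.toStarSubalgebra)
    (hαU : GroupDual.IsCocycleTwistedAction B α U) :
    ∃ W : ∀ π : D, Matrix (Fin π.1.dim) (Fin π.1.dim) M.toStarSubalgebra,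
      GroupDual.Trivializes α U W ∧
      ∀ π ρ : D, U π ρ = GroupDual.coboundary B α (fun π => (W π)ᴴ) π ρ := by
  classical
  have := Fintype.ofFinite G
  exact GroupDual.exists_trivializes hαU fun Φ => GroupDual.exists_row hM Φ
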